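/- Work with formal power series over $\mathbb{Q}$. Let $\theta_i=z_i\,\partial/\partial z_i$ and consider the Picard–Fuchs system (of the elliptic Calabi–Yau threefold $X_{18}(1,1,1,6,9)$) $$\mathcal L_1=\theta_1(\theta_1-3\theta_2)-12z_1(6\theta_1+1)(6\theta_1+5),\qquad \mathcal L_2=\theta_2^3+z_2\prod_{i=0}^{2}(3\theta_2-\theta_1+i),$$ acting on polynomials in $\log z_1,\log z_2$ with coefficients in $\mathbb{Q}[[z_1,z_2]]$. It has unique solutions $X_0=1+\cdots$, $X_1=X_0\log z_1+S_1$, $X_2=X_0\log z_2+S_2$ with $X_0,S_1,S_2\in\mathbb{Q}[[z_1,z_2]]$ and $S_1(0)=S_2(0)=0$. Put $t_i=X_i/X_0$, $q_E=e^{t_1}$, $q_B=e^{t_2}$. Let $E_2,E_4,E_6$ be the normalised Eisenstein series, $\eta^{24}=q\prod_{n\ge1}(1-q^n)^{24}$, and let quasi-modular forms of weight $k$ be the weighted homogeneous polynomials of weight $k$ in $\mathbb{Q}[E_2,E_4,E_6]$ (modular forms: those without $E_2$), with $\partial_{E_2}$ the formal partial derivative. All fractional powers below are the formal ones with positive constant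 term. Put $$Z=\frac{z_2}{(1-432z_1)^3E_4(q_E)^{9/2}},\qquad Q=\Big(\frac{q_E}{\eta(q_E)^{24}}\Big)^{3/2}q_B .$$ Let $\mathcal F_{cl}=\tfrac32t_1^3+\tfrac32t_1^2t_2+\tfrac12t_1t_2^2$. The instanton prepotential is the power series $F(q_E,q_B)$ with $F(0,0)=0$ such that $X_0\,\partial_{t_i}(\mathcal F_{cl}+F)$, $i=1,2$, solve the Picard–Fuchs system; write $F=\sum_{s\ge0}P^{(0)}_s(q_E)\,Q^s$ and $P^{(0)}=\sum_{s\ge1}P^{(0)}_sQ^s$. Then the following hold. (1) For $s\ge1$ the series $P^{(0)}_s$ is a quasi-modular form of weight $18s-2$, and $X_0\big(\tfrac32t_1^2+t_1t_2+\sum_{s\ge1}sP^{(0)}_s(q_E)Q^s\big)$ solves the Picard–Fuchs system. (2) $Z=\sum_{n\ge1}c_n(q_E)\,Q^n$, where $c_n$ is a quasi-modular form of weight $18(n-1)$ and $$\frac{\partial c_n}{\partial E_2}=-\frac1{12}\sum_{s=1}^{n-1}s(n-s)\,c_{n-s}\,P^{(0)}_s\qquad(n\ge1).$$ (3) Equivalently,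 $\log Q=\log Z+\sum_{n\ge1}f_n(q_E)Z^n$ with $f_n$ quasi-modular of weight $18n$, and $\partial_{E_2}\log Q=\frac1{12}\,Q\,\partial_QP^{(0)}$, i.e. $\sum_{n\ge1}(\partial_{E_2}f_n)(q_E)Z^n=\frac1{12}\sum_{s\ge1}sP^{(0)}_s(q_E)Q^s$. (4) Let $\tilde q=z_1+\cdots\in\mathbb{Q}[[z_1]]$ be defined by $J(\tilde q)=\frac1{z_1(1-432z_1)}$, $J=E_4^3/\eta^{24}$, put $\tilde t=\log\tilde q$, and write $X_2=X_0\big[\log z_2-\tfrac32t_1-\tfrac32\log\tfrac{1-432z_1}{z_1}\big]+\sum_{n\ge0}\alpha_n(z_1)z_2^n$. Then $\alpha_0=0$ and, for $n\ge1$, $$\alpha_n=\frac{E_4(\tilde q)^{1/4}}{(E_4(\tilde q)^{3/2}+E_6(\tilde q))^{3n}}\big(A_n(\tilde q)E_2(\tilde q)+B_n(\tilde q)\big)$$ with modular forms $A_n,B_n$ of weights $18n-2$, $18n$; and $$w_3=X_0\big(\tfrac32t_1^2+t_1t_2\big)-(t_1-\tilde t)\sum_{n\ge1}\alpha_nz_2^n+12\sum_{n\ge1}\frac{E_4(\tilde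 q)^{1/4}A_n(\tilde q)}{(E_4(\tilde q)^{3/2}+E_6(\tilde q))^{3n}}z_2^n$$ is a solution of the Picard–Fuchs system and equals $X_0\big(\tfrac32t_1^2+t_1t_2+\sum_{s\ge1}sP^{(0)}_s(q_E)Q^s\big)=X_0\,\partial_{t_2}(\mathcal F_{cl}+F)$. -/

import Mathlib

noncomputable section

namespace EllFib

/-! ### Power series and quasi-modular forms -/

/-- Formal power series in one variable (a `q`-expansion, or a series in `z₁` alone). -/
abbrev QSer := PowerSeries ℚ

/-- Formal power series in two variables: `z₁ = X 0`, `z₂ = X 1`. -/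
abbrev ZSer := MvPowerSeries (Fin 2) ℚ

/-- `∑ₖ aₖ(x) yᵏ` as a power series in `x = X 0`, `y = X 1`. -/
def bivariate (a : ℕ → QSer) : ZSer :=
  fun m => PowerSeries.coeff (m 0) (a (m 1))

/-- The coefficient of `yᵏ` in a power series in `x, y`, as a power series in `x`. -/
def slice (F : ZSer) (k : ℕ) : QSer :=
  PowerSeries.mk fun n => MvPowerSeries.coeff (Finsupp.single 0 n + Finsupp.single 1 k) F

/-- `∑ₖ aₖ(u) vᵏ`, for power series `u`, `v` without constant term. -/
def expansion (a : ℕ → QSer) (u v : ZSer) : ZSer :=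
  MvPowerSeries.subst ![u, v] (bivariate a)

/-- `exp u`, for a power series `u` in `z₁, z₂` without constant term. -/
def expZ (u : ZSer) : ZSer := (PowerSeries.exp ℚ).subst u

/-- The power `f ^ r = exp (r log f)` of a power series `f` with constant term `1`. -/
def rpow (f : QSer) (r : ℚ) : QSer :=
  (PowerSeries.exp ℚ).subst (r • PowerSeries.logOf f)

/-- The `q`-expansion `1 - (2k / Bₖ) ∑ σ_{k-1}(n) qⁿ` of the normalised Eisenstein series `E_k`. -/
def eisenstein (k : ℕ) : QSer :=
  PowerSeries.mk fun n =>
    if n = 0 then 1 else -(2 * (k : ℚ) / bernoulli k) * (ArithmeticFunction.sigma (k - 1) n : ℚ)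

/-- Euler's product `∏_{n ≥ 1} (1 - qⁿ)`; hence `η²⁴ = q * eulerProd ^ 24`. -/
def eulerProd : QSer :=
  PowerSeries.mk fun n =>
    PowerSeries.coeff n
      (∏ k ∈ Finset.range n, (1 - (PowerSeries.X : QSer) ^ (k + 1)))

/-- The discriminant form `η²⁴`. -/
def eta24 : QSer := PowerSeries.X * eulerProd ^ 24

/-- `q / η²⁴`. -/
def qOverEta24 : QSer := (eulerProd ^ 24)⁻¹

/-- The ring `ℚ[E₂, E₄, E₆]` of quasi-modular forms for `SL(2, ℤ)`, with `E₂ = X 0`,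
`E₄ = X 1`, `E₆ = X 2`. The derivation `∂/∂E₂` is `MvPolynomial.pderiv 0`. -/
abbrev QM := MvPolynomial (Fin 3) ℚ

/-- The `q`-expansion of a quasi-modular form. -/
def qexp : QM →ₐ[ℚ] QSer :=
  MvPolynomial.aeval ![eisenstein 2, eisenstein 4, eisenstein 6]

/-- Quasi-modular forms of weight `k`. -/
def IsQuasiModular (k : ℕ) (p : QM) : Prop :=
  MvPolynomial.IsWeightedHomogeneous ![2, 4, 6] p k

/-- Modular forms of weight `k`: quasi-modular forms in which `E₂` does not occur. -/
def IsModular (k : ℕ) (p : QM) : Prop :=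
  IsQuasiModular k p ∧ MvPolynomial.pderiv 0 p = 0

/-! ### The Picard-Fuchs system -/

/-- Polynomials in `log z₁ = X 0` and `log z₂ = X 1` with coefficients power series in
`z₁, z₂`. -/
abbrev LogSer := MvPolynomial (Fin 2) ZSer

/-- `θᵢ = zᵢ ∂/∂zᵢ` on power series. -/
def thetaZ (i : Fin 2) (f : ZSer) : ZSer :=
  MvPowerSeries.X i * MvPowerSeries.pderiv ℚ i f

/-- `θᵢ = zᵢ ∂/∂zᵢ` on `LogSer`: it acts by `thetaZ i` on the coefficients, and
`θᵢ (log zⱼ) = δᵢⱼ`. -/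
def theta (i : Fin 2) (w : LogSer) : LogSer :=
  (∑ m ∈ w.support, MvPolynomial.monomial m (thetaZ i (MvPolynomial.coeff m w))) +
    MvPolynomial.pderiv i w

/-- The first order operator `a θ₁ + b θ₂ + c`. -/
def linOp (a b c : ℚ) (w : LogSer) : LogSer :=
  a • theta 0 w + b • theta 1 w + c • w

/-- `z₁` and `z₂`. -/
def z (i : Fin 2) : ZSer := MvPowerSeries.X i

/-- `ℒ₁ = θ₁ (θ₁ - 3 θ₂) - 12 z₁ (6 θ₁ + 1) (6 θ₁ + 5)`. -/
def opL₁ (w : LogSer) : LogSer :=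
  linOp 1 0 0 (linOp 1 (-3) 0 w) -
    MvPolynomial.C (12 * z 0) * linOp 6 0 1 (linOp 6 0 5 w)

/-- `ℒ₂ = θ₂³ + z₂ (3 θ₂ - θ₁) (3 θ₂ - θ₁ + 1) (3 θ₂ - θ₁ + 2)`. -/
def opL₂ (w : LogSer) : LogSer :=
  linOp 0 1 0 (linOp 0 1 0 (linOp 0 1 0 w)) +
    MvPolynomial.C (z 1) * linOp (-1) 3 0 (linOp (-1) 3 1 (linOp (-1) 3 2 w))

/-- Solutions of the Picard-Fuchs system. -/
def IsSolution (w : LogSer) : Prop := opL₁ w = 0 ∧ opL₂ w = 0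

/-- Power series data for the three periods `X₀`, `X₁ = X₀ log z₁ + S₁`,
`X₂ = X₀ log z₂ + S₂`. -/
structure Periods where
  X₀ : ZSer
  S₁ : ZSer
  S₂ : ZSer

namespace Periods

variable (p : Periods)

/-- `X₀`, `X₁` and `X₂` solve the Picard-Fuchs system, with `X₀ = 1 + ⋯` and with `S₁` and `S₂`
vanishing at the origin. -/
structure IsNormalized : Prop where
  constX₀ : MvPowerSeries.constantCoeff p.X₀ = 1
  constS₁ : MvPowerSeries.constantCoeff p.S₁ = 0
  constS₂ : MvPowerSeries.constantCoeff p.S₂ = 0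
  solX₀ : IsSolution (MvPolynomial.C p.X₀)
  solX₁ : IsSolution (MvPolynomial.C p.X₀ * MvPolynomial.X 0 + MvPolynomial.C p.S₁)
  solX₂ : IsSolution (MvPolynomial.C p.X₀ * MvPolynomial.X 1 + MvPolynomial.C p.S₂)

/-- The flat coordinates `tᵢ = Xᵢ / X₀ = log zᵢ + Sᵢ / X₀`. -/
def t : Fin 2 → LogSer :=
  ![MvPolynomial.X 0 + MvPolynomial.C (p.S₁ * p.X₀⁻¹),
    MvPolynomial.X 1 + MvPolynomial.C (p.S₂ * p.X₀⁻¹)]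

/-- `q_E = exp (X₁ / X₀)`. -/
def qE : ZSer := z 0 * expZ (p.S₁ * p.X₀⁻¹)

/-- `q_B = exp (X₂ / X₀)`. -/
def qB : ZSer := z 1 * expZ (p.S₂ * p.X₀⁻¹)

/-- `Z = z₂ / ((1 - 432 z₁)³ E₄(q_E)^{9/2})`. -/
def Z : ZSer :=
  z 1 * ((1 - 432 * z 0) ^ 3 * (rpow (eisenstein 4) (9 / 2)).subst p.qE)⁻¹

/-- `Q = (q_E / η(q_E)²⁴)^{3/2} q_B`. -/
def Q : ZSer := (rpow qOverEta24 (3 / 2)).subst p.qE * p.qB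

end Periods

/-! ### The prepotential -/

/-- The classical prepotential `(3/2) t₁³ + (3/2) t₁² t₂ + (1/2) t₁ t₂²`. -/
def classicalF : MvPolynomial (Fin 2) ℚ :=
  MvPolynomial.C (3 / 2) * MvPolynomial.X 0 ^ 3 +
    MvPolynomial.C (3 / 2) * MvPolynomial.X 0 ^ 2 * MvPolynomial.X 1 +
    MvPolynomial.C (1 / 2) * MvPolynomial.X 0 * MvPolynomial.X 1 ^ 2

namespace Periods

variable (p : Periods)

/-- `X₀ (∂F_classical/∂tᵢ + g)`, for a power series `g`. -/
def doubleLog (i : Fin 2) (g : ZSer) : LogSer :=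
  MvPolynomial.C p.X₀ *
    (MvPolynomial.aeval p.t (MvPolynomial.pderiv i classicalF) + MvPolynomial.C g)

/-- `F`, a power series in `q_E = exp t₁` and `q_B = exp t₂`, is the instanton part of the
prepotential: `X₀ ∂(F_classical + F)/∂tᵢ` solves the Picard-Fuchs system for `i = 1, 2`. -/
def IsInstantonPrepotential (F : ZSer) : Prop :=
  MvPowerSeries.constantCoeff F = 0 ∧
    ∀ i, IsSolution (p.doubleLog i (MvPowerSeries.subst ![p.qE, p.qB] (thetaZ i F)))

/-! ### The ingredients of the double-logarithmic solution -/

/-- `q̃ = z₁ exp τ`, with `τ` a power series in `z₁`. -/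
def qTilde (τ : QSer) : QSer := PowerSeries.X * (PowerSeries.exp ℚ).subst τ

/-- `q̃ = z₁ exp τ`, where `τ(0) = 0`, is the solution of `J(q̃) = 1 / (z₁ (1 - 432 z₁))`, with
`J = E₄³ / η²⁴`. -/
def IsTau (τ : QSer) : Prop :=
  PowerSeries.constantCoeff τ = 0 ∧
    (eta24 * (eisenstein 4 ^ 3)⁻¹).subst (qTilde τ) =
      PowerSeries.X * (1 - 432 * PowerSeries.X : QSer)

/-- A power series in `z₁`, viewed as a power series in `z₁, z₂`. -/
def inZ₁ (f : QSer) : ZSer := f.subst (z 0)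

/-- `α = X₂ - X₀ (log z₂ - (3/2) t₁ - (3/2) log ((1 - 432 z₁) / z₁))`, in which all the
logarithms cancel. -/
def alpha : ZSer :=
  p.S₂ + (3 / 2 : ℚ) • p.S₁ +
    (3 / 2 : ℚ) • (p.X₀ * inZ₁ (PowerSeries.logOf (1 - 432 * PowerSeries.X : QSer)))

/-- `f(q̃)`, as a power series in `z₁`. -/
def atTilde (τ f : QSer) : QSer := f.subst (qTilde τ)

/-- `E₄(q̃)^{3/2} + E₆(q̃)`. -/
def den (τ : QSer) : QSer := atTilde τ (rpow (eisenstein 4) (3 / 2) + eisenstein 6)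

/-- `E₄(q̃)^{1/4} f(q̃) / (E₄(q̃)^{3/2} + E₆(q̃))^{3n}`. -/
def quotTilde (τ : QSer) (n : ℕ) (f : QM) : QSer :=
  atTilde τ (rpow (eisenstein 4) (1 / 4) * qexp f) * (den τ ^ (3 * n))⁻¹

/-- `- (t₁ - t̃) α + 12 ∑ₙ E₄(q̃)^{1/4} Aₙ(q̃) z₂ⁿ / (E₄(q̃)^{3/2} + E₆(q̃))^{3n}`, with
`t̃ = log q̃`. -/
def w₃Series (τ : QSer) (A : ℕ → QM) : ZSer :=
  -((p.S₁ * p.X₀⁻¹ - inZ₁ τ) * p.alpha) +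
    12 * bivariate (fun n => quotTilde τ n (A n))

/-- `w₃ = X₀ ((3/2) t₁² + t₁ t₂) - (t₁ - t̃) α
+ 12 ∑ₙ E₄(q̃)^{1/4} Aₙ(q̃) z₂ⁿ / (E₄(q̃)^{3/2} + E₆(q̃))^{3n}`. -/
def w₃ (τ : QSer) (A : ℕ → QM) : LogSer :=
  MvPolynomial.C p.X₀ * ((3 / 2 : ℚ) • p.t 0 ^ 2 + p.t 0 * p.t 1) +
    MvPolynomial.C (p.w₃Series τ A)

end Periods

end EllFib

end

/-!
The Picard-Fuchs system becomes transparent in modular coordinates. Let `q̃` be the parameter of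
the elliptic fibre at `z₂ = 0`, so that `z₁ = (1 - E₆ / E₄^{3/2}) / 864` at `q̃` (`zOfQ`), and let
`Y = z₂ / ((1 - 432 z₁) E₄(q̃)^{3/2})³`, a variable of weight `-18`. Ramanujan's differential
equations, which are derived from the vanishing of level one forms of small weight without constant
term, and the hypergeometric equation that they imply for `E₄^{1/4}` show that `E₄(q̃)^{1/4} w`
solves the Picard-Fuchs system if and only if `D₁² w = (9/4) E₄ D₂² w` and
`D₂³ w = Y · op 2 (op 1 (op 0 w))` (`PFData.L₁_φ_mul`, `PFData.L₂_φ_mul`). Here `D₂ = Y d/dY`, and `D₁` is Ramanujan's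
derivation on quasi-modular forms, with `D₁ Y = -(3/2) E₂ Y`; the first order operators `op k` have
quasi-modular coefficients. Both equations make sense over `ℚ[E₂, E₄, E₆]⟦Y⟧`, where also `∂/∂E₂`
and the weight `W` act, and `D₁`, `∂/∂E₂`, `W` satisfy the relations of `sl₂`, as for instance
`[∂/∂E₂, D₁] = W / 12`.

The second equation is a recursion in powers of `Y`. It has a solution `N ℓ + M` with a logarithm
`ℓ` such that `D₁ ℓ = 0` and `D₂ ℓ = 1`, with `N = 1 + ⋯` and `M` without constant term
(`solves_fundamental`), and a solution without constant term is zero. Applied to the images of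
`N ℓ + M` under `W`, `∂²/∂E₂²` and the first operator, uniqueness shows that `N` and `M` have weight
`0`, are at most linear in `E₂`, and solve the first equation (`W_fundamental`,
`del_del_fundamental`, `box_fundamental`). The `sl₂` relations further imply that with a solution
`w` of weight `0` also `t̃ w + 12 ∂w/∂E₂` is a solution, where `t̃ = log q̃`
(`SystemHom.lift_solves`, `SystemHom.lift_box`). This yields all periods: up to the factor
`E₄(q̃)^{1/4}` and to linear combinations they are `N`, its lift, `N ℓ + M`, and the lift of the
latter, which is the double-logarithmic solution. A power series solution is determined by its
constant term (`eq_zero_of_isSolution`); hence the periods are unique, and `∂F/∂t₂` is the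
instanton part of the double-logarithmic solution (`subst_thetaZ_eq`).

It remains to pass from `q̃` to `q_E`. Since `t₁ = t̃ + δ` with `δ = 12 (∂N/∂E₂) / N`, Taylor's
theorem expresses forms at `q_E` by forms at `q̃` (`PsiK`, `ev_PsiK`), and the same substitution
sends `Y` to `Z` (`Psi`, `ev_Psi`). The relation `∂δ/∂E₂ = -δ² / 12`, a consequence of the
linearity of `N` in `E₂`, implies that the substitution turns `∂/∂E₂` into `∂/∂E₂ - (δ / 12) W`
(`delShift_Psi`). Under this derivation the contributions of `E₄` and of the discriminant to
`log (Q / Z)` cancel, and there remains `∂(M / N)/∂E₂` (`Psi_del_fSer`); this is, up to the factor `12`,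
the instanton part of the double-logarithmic solution in flat coordinates
(`isSolution_doubleLog_evQ`). So `∂ log Q / ∂E₂ = (1/12) Q ∂P/∂Q`, and inversion of the series for
`Q` in terms of `Z` (`Theta`) turns this into the anomaly equation for `Z` (`del_cSer`). The
weights are read off from the action of `W`.
-/

noncomputable section

namespace EllFib

/-! ### Continuity of homomorphisms and derivations on power series -/

section Continuity

variable {σ τ A B K : Type*} [CommRing A] [CommRing B] [CommRing K]

theorem eq_zero_of_forall_pow_dvd {a t : MvPowerSeries σ A}
    (ht : MvPowerSeries.constantCoeff t = 0) (h : ∀ n : ℕ, t ^ n ∣ a) : a = 0 := by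
  ext m
  obtain ⟨b, hb⟩ := h (Finsupp.degree m + 1)
  rw [hb, map_zero]
  apply MvPowerSeries.coeff_of_lt_order
  have h1 := MvPowerSeries.le_order_pow_of_constantCoeff_eq_zero (f := t) (Finsupp.degree m + 1) ht
  refine lt_of_lt_of_le ?_ (h1.trans (le_trans (by simp) MvPowerSeries.le_order_mul))
  exact_mod_cast Nat.lt_succ_self _

theorem eq_trunc_add_X_pow_mul (a : PowerSeries K) (n : ℕ) :
    ∃ b, a = (PowerSeries.trunc n a : PowerSeries K) + PowerSeries.X ^ n * b := by
  have : PowerSeries.X ^ n ∣ a - (PowerSeries.trunc n a : PowerSeries K) := by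
    rw [PowerSeries.X_pow_dvd_iff]
    intro m hm
    simp [PowerSeries.coeff_trunc, hm]
  obtain ⟨b, hb⟩ := this
  exact ⟨b, by rw [← hb]; ring⟩

/-- A twisted derivation out of `K⟦X⟧` is determined by its values on constants and on `X`: it is
automatically continuous for the `X`-adic topology. -/
theorem twisted_leibniz_ext (δ : PowerSeries K →+ MvPowerSeries σ A)
    (φ φ' : PowerSeries K →+* MvPowerSeries σ A)
    (hL : ∀ a b, δ (a * b) = φ a * δ b + φ' b * δ a)
    (hC : ∀ k, δ (PowerSeries.C k) = 0) (hX : δ PowerSeries.X = 0)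
    (h0 : MvPowerSeries.constantCoeff (φ PowerSeries.X) = 0) (a : PowerSeries K) : δ a = 0 := by
  have hpow : ∀ n : ℕ, δ (PowerSeries.X ^ n) = 0 := by
    intro n
    induction n with
    | zero => simpa using hC 1
    | succ n ih => rw [pow_succ, hL, ih, hX]; simp
  have hpoly : ∀ p : Polynomial K, δ (p : PowerSeries K) = 0 := by
    intro p
    induction p using Polynomial.induction_on' with
    | add p q hp hq => rw [Polynomial.coe_add, map_add, hp, hq, add_zero]
    | monomial n k =>
      rw [← Polynomial.C_mul_X_pow_eq_monomial, Polynomial.coe_mul, Polynomial.coe_pow,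
        Polynomial.coe_C, Polynomial.coe_X, hL, hpow, hC]
      simp
  refine eq_zero_of_forall_pow_dvd h0 fun n => ?_
  obtain ⟨b, hb⟩ := eq_trunc_add_X_pow_mul a n
  refine ⟨δ b, ?_⟩
  rw [hb, map_add, hpoly, hL, hpow]
  simp

/-- Two ring homomorphisms out of `K⟦X⟧` that agree on constants and on `X` are equal as soon as
the image of `X` has no constant term. -/
theorem ringHom_ext_of_constantCoeff (f g : PowerSeries K →+* MvPowerSeries σ A)
    (hC : ∀ k, f (PowerSeries.C k) = g (PowerSeries.C k)) (hX : f PowerSeries.X = g PowerSeries.X)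
    (h0 : MvPowerSeries.constantCoeff (f PowerSeries.X) = 0) : f = g := by
  ext1 a
  have := twisted_leibniz_ext (f.toAddMonoidHom - g.toAddMonoidHom) f g
    (fun a b => by simp; ring) (fun k => by simp [hC]) (by simp [hX]) h0 a
  simpa [sub_eq_zero] using this

/-- Additive maps satisfying the Leibniz rule over a ring homomorphism. -/
def IsLeibniz {S T : Type*} [CommRing S] [CommRing T] (φ : S →+* T) (d : S →+ T) : Prop :=
  ∀ a b, d (a * b) = φ a * d b + φ b * d a

/-- Additive maps with the Leibniz rule are determined by their values on constants and on `X`. No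
continuity has to be assumed: the Leibniz rule sends multiples of `Xⁿ⁺¹` to multiples of
`φ(X)ⁿ`. -/
theorem IsLeibniz.ext_powerSeries {φ : PowerSeries K →+* MvPowerSeries σ A}
    {d d' : PowerSeries K →+ MvPowerSeries σ A} (hd : IsLeibniz φ d) (hd' : IsLeibniz φ d')
    (h0 : MvPowerSeries.constantCoeff (φ PowerSeries.X) = 0)
    (hC : ∀ k, d (PowerSeries.C k) = d' (PowerSeries.C k))
    (hX : d PowerSeries.X = d' PowerSeries.X) : d = d' := by
  ext1 a
  have := twisted_leibniz_ext (d - d') φ φ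
    (fun a b => by simp [hd a b, hd' a b]; ring) (fun k => by simp [hC]) (by simp [hX]) h0 a
  simpa [sub_eq_zero] using this

theorem IsLeibniz.map_one {S T : Type*} [CommRing S] [CommRing T] {φ : S →+* T} {d : S →+ T}
    (hd : IsLeibniz φ d) : d 1 = 0 := by
  have := hd 1 1
  simpa using this

theorem IsLeibniz.map_algebraMap {S T : Type*} [CommRing S] [CommRing T] [Algebra ℚ S]
    [Algebra ℚ T] {φ : S →+* T} {d : S →+ T} (hd : IsLeibniz φ d) (r : ℚ) :
    d (algebraMap ℚ S r) = 0 := by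
  rw [Algebra.algebraMap_eq_smul_one, map_rat_smul d r 1, hd.map_one, smul_zero]

theorem IsLeibniz.ext_mvPolynomial {ι T : Type*} [CommRing T] [Algebra ℚ T]
    {φ : MvPolynomial ι ℚ →+* T} {d d' : MvPolynomial ι ℚ →+ T} (hd : IsLeibniz φ d)
    (hd' : IsLeibniz φ d') (hX : ∀ i, d (MvPolynomial.X i) = d' (MvPolynomial.X i)) : d = d' := by
  refine AddMonoidHom.ext fun a => ?_
  induction a using MvPolynomial.induction_on with
  | C r => exact (hd.map_algebraMap r).trans (hd'.map_algebraMap r).symm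
  | add p q hp hq => rw [map_add, map_add, hp, hq]
  | mul_X p i hp => rw [hd, hd', hp, hX]

theorem IsLeibniz.ext_polynomial {T : Type*} [CommRing T]
    {φ : Polynomial K →+* T} {d d' : Polynomial K →+ T} (hd : IsLeibniz φ d)
    (hd' : IsLeibniz φ d') (hC : ∀ k, d (Polynomial.C k) = d' (Polynomial.C k))
    (hX : d Polynomial.X = d' Polynomial.X) : d = d' := by
  refine AddMonoidHom.ext fun a => ?_
  induction a using Polynomial.induction_on' with
  | add p q hp hq => rw [map_add, map_add, hp, hq]
  | monomial n k =>
    have h : d (Polynomial.X ^ n) = d' (Polynomial.X ^ n) := by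
      induction n with
      | zero => simpa using hC 1
      | succ n ih => rw [pow_succ, hd, hd', ih, hX]
    rw [← Polynomial.C_mul_X_pow_eq_monomial, hd, hd', hC, h]

end Continuity

/-! ### Evaluation of power series along a homomorphism of the coefficients -/

section Evaluation

variable {σ A K : Type*} [CommRing A] [CommRing K]

/-- The partial sum `∑_{k < N} ψ(aₖ) tᵏ`. -/
def evalPartial (ψ : K →+* MvPowerSeries σ A) (t : MvPowerSeries σ A) (N : ℕ) (a : PowerSeries K) :
    MvPowerSeries σ A := Polynomial.eval₂ ψ t (PowerSeries.trunc N a)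

/-- The coefficients of the partial sums stabilise, and they depend only on a truncation of the
series that is evaluated. -/
theorem coeff_evalPartial (ψ : K →+* MvPowerSeries σ A) {t : MvPowerSeries σ A}
    (ht : MvPowerSeries.constantCoeff t = 0) {a b : PowerSeries K} {n M N : ℕ} {m : σ →₀ ℕ}
    (hm : Finsupp.degree m < n) (hM : n ≤ M) (hN : n ≤ N)
    (hab : PowerSeries.trunc n a = PowerSeries.trunc n b) :
    MvPowerSeries.coeff m (evalPartial ψ t M a) = MvPowerSeries.coeff m (evalPartial ψ t N b) := by
  have : Polynomial.X ^ n ∣ PowerSeries.trunc M a - PowerSeries.trunc N b := by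
    rw [Polynomial.X_pow_dvd_iff]
    intro d hd
    have := congrArg (fun p => Polynomial.coeff p d) hab
    simp only [PowerSeries.coeff_trunc, hd, if_true] at this
    simp [PowerSeries.coeff_trunc, lt_of_lt_of_le hd hM, lt_of_lt_of_le hd hN, this]
  obtain ⟨p, hp⟩ := this
  have h2 : evalPartial ψ t M a - evalPartial ψ t N b = t ^ n * Polynomial.eval₂ ψ t p := by
    rw [evalPartial, evalPartial, ← Polynomial.eval₂_sub, hp, Polynomial.eval₂_mul,
      Polynomial.eval₂_pow, Polynomial.eval₂_X]
  rw [← sub_eq_zero, ← map_sub, h2]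
  apply MvPowerSeries.coeff_of_lt_order
  have h1 := MvPowerSeries.le_order_pow_of_constantCoeff_eq_zero (f := t) n ht
  exact lt_of_lt_of_le (by exact_mod_cast hm)
    (h1.trans (le_trans (by simp) MvPowerSeries.le_order_mul))

/-- The sum `∑ ψ(aₖ) tᵏ`, read off coefficientwise from its partial sums. -/
def evalFun (ψ : K →+* MvPowerSeries σ A) (t : MvPowerSeries σ A) (a : PowerSeries K) :
    MvPowerSeries σ A :=
  fun m => MvPowerSeries.coeff m (evalPartial ψ t (Finsupp.degree m + 1) a)

theorem coeff_evalFun (ψ : K →+* MvPowerSeries σ A) {t : MvPowerSeries σ A}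
    (ht : MvPowerSeries.constantCoeff t = 0) (a : PowerSeries K) {m : σ →₀ ℕ} {N : ℕ}
    (hN : Finsupp.degree m < N) :
    MvPowerSeries.coeff m (evalFun ψ t a) = MvPowerSeries.coeff m (evalPartial ψ t N a) :=
  coeff_evalPartial ψ ht (n := Finsupp.degree m + 1) (by omega) le_rfl (by omega) rfl

/-- Evaluation `∑ aₖ Xᵏ ↦ ∑ ψ(aₖ) tᵏ` of power series at a power series `t` without constant term,
along a ring homomorphism `ψ` on the coefficients that need not be a structure map. -/
def evalHom (ψ : K →+* MvPowerSeries σ A) (t : MvPowerSeries σ A)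
    (ht : MvPowerSeries.constantCoeff t = 0) : PowerSeries K →+* MvPowerSeries σ A where
  toFun := evalFun ψ t
  map_one' := by
    ext m
    rw [coeff_evalFun ψ ht _ (Nat.lt_succ_self _)]
    simp [evalPartial]
  map_zero' := by
    ext m
    rw [coeff_evalFun ψ ht _ (Nat.lt_succ_self _)]
    simp [evalPartial]
  map_add' a b := by
    ext m
    rw [map_add, coeff_evalFun ψ ht _ (Nat.lt_succ_self _),
      coeff_evalFun ψ ht _ (Nat.lt_succ_self _), coeff_evalFun ψ ht _ (Nat.lt_succ_self _)]
    simp [evalPartial, Polynomial.eval₂_add]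
  map_mul' a b := by
    classical
    ext m
    set n := Finsupp.degree m + 1 with hn
    have h2 : MvPowerSeries.coeff m (evalFun ψ t a * evalFun ψ t b) =
        MvPowerSeries.coeff m (evalPartial ψ t n a * evalPartial ψ t n b) := by
      rw [MvPowerSeries.coeff_mul, MvPowerSeries.coeff_mul]
      refine Finset.sum_congr rfl fun p hp => ?_
      have hd : Finsupp.degree p.1 + Finsupp.degree p.2 = Finsupp.degree m := by
        rw [← Finset.HasAntidiagonal.mem_antidiagonal.mp hp, map_add]
      rw [coeff_evalFun ψ ht a (N := n) (by omega), coeff_evalFun ψ ht b (N := n) (by omega)]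
    have h3 : evalPartial ψ t n a * evalPartial ψ t n b =
        evalPartial ψ t (n + n + 1) ((PowerSeries.trunc n a * PowerSeries.trunc n b :
          Polynomial K) : PowerSeries K) := by
      rw [evalPartial, evalPartial, evalPartial, ← Polynomial.eval₂_mul,
        PowerSeries.trunc_coe_eq_self]
      refine lt_of_le_of_lt Polynomial.natDegree_mul_le ?_
      have h4 := PowerSeries.natDegree_trunc_lt a (Finsupp.degree m)
      have h5 := PowerSeries.natDegree_trunc_lt b (Finsupp.degree m)
      rw [← hn] at h4 h5
      omega
    rw [h2, h3, coeff_evalFun ψ ht _ (Nat.lt_succ_self _)]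
    refine coeff_evalPartial ψ ht (n := n) (by omega) le_rfl (by omega) ?_
    rw [Polynomial.coe_mul, PowerSeries.trunc_trunc_mul_trunc]

theorem coeff_evalHom (ψ : K →+* MvPowerSeries σ A) {t : MvPowerSeries σ A}
    (ht : MvPowerSeries.constantCoeff t = 0) (a : PowerSeries K) {m : σ →₀ ℕ} {N : ℕ}
    (hN : Finsupp.degree m < N) :
    MvPowerSeries.coeff m (evalHom ψ t ht a) = MvPowerSeries.coeff m (evalPartial ψ t N a) :=
  coeff_evalFun ψ ht a hN

@[simp] theorem evalHom_C (ψ : K →+* MvPowerSeries σ A) {t : MvPowerSeries σ A}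
    (ht : MvPowerSeries.constantCoeff t = 0) (k : K) : evalHom ψ t ht (PowerSeries.C k) = ψ k := by
  ext m
  rw [coeff_evalHom ψ ht _ (Nat.lt_succ_self _), evalPartial, PowerSeries.trunc_C,
    Polynomial.eval₂_C]

@[simp] theorem evalHom_X (ψ : K →+* MvPowerSeries σ A) {t : MvPowerSeries σ A}
    (ht : MvPowerSeries.constantCoeff t = 0) : evalHom ψ t ht PowerSeries.X = t := by
  ext m
  rw [coeff_evalHom ψ ht _ (N := Finsupp.degree m + 2) (by omega), evalPartial,
    PowerSeries.trunc_X, Polynomial.eval₂_X]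

theorem constantCoeff_evalHom (ψ : K →+* MvPowerSeries σ A) {t : MvPowerSeries σ A}
    (ht : MvPowerSeries.constantCoeff t = 0) (a : PowerSeries K) :
    MvPowerSeries.constantCoeff (evalHom ψ t ht a) =
      MvPowerSeries.constantCoeff (ψ (PowerSeries.constantCoeff a)) := by
  have : a = PowerSeries.C (PowerSeries.constantCoeff a) + PowerSeries.X *
      PowerSeries.mk fun n => PowerSeries.coeff (n + 1) a := by
    conv_lhs => rw [PowerSeries.eq_X_mul_shift_add_const a]
    ring
  conv_lhs => rw [this]
  simp [ht]

end Evaluation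

/-! ### Exponential and logarithm of power series -/

section Exponential

variable {σ τ A B : Type*} [CommRing A] [CommRing B]

theorem hasSubst_of_const {a : MvPowerSeries σ A} (ha : MvPowerSeries.constantCoeff a = 0) :
    PowerSeries.HasSubst a := PowerSeries.HasSubst.of_constantCoeff_zero ha

variable [Algebra ℚ A] [Algebra ℚ B]

/-- Every ring homomorphism between power series rings commutes with the substitution of a power
series without constant term into a series with rational coefficients. -/
theorem map_subst_rat (Φ : MvPowerSeries σ A →+* MvPowerSeries τ B) {a : MvPowerSeries σ A}
    (ha : MvPowerSeries.constantCoeff a = 0) (hΦ : MvPowerSeries.constantCoeff (Φ a) = 0)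
    (F : PowerSeries ℚ) : Φ (F.subst a) = F.subst (Φ a) := by
  have h1 := hasSubst_of_const ha
  have h2 := hasSubst_of_const hΦ
  have := ringHom_ext_of_constantCoeff
    (Φ.comp (PowerSeries.substAlgHom (R := ℚ) h1).toRingHom)
    (PowerSeries.substAlgHom (R := ℚ) h2).toRingHom
    (fun k => by
      have := RingHom.ext_iff.mp (RingHom.ext_rat
        ((Φ.comp (PowerSeries.substAlgHom (R := ℚ) h1).toRingHom).comp
          (PowerSeries.C : ℚ →+* PowerSeries ℚ))
        ((PowerSeries.substAlgHom (R := ℚ) h2).toRingHom.comp PowerSeries.C)) k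
      exact this)
    (by simp [PowerSeries.coe_substAlgHom, PowerSeries.subst_X h1, PowerSeries.subst_X h2])
    (by simpa [PowerSeries.coe_substAlgHom, PowerSeries.subst_X h1] using hΦ)
  have := RingHom.ext_iff.mp this F
  simpa [PowerSeries.coe_substAlgHom] using this

/-- The chain rule for an arbitrary derivation along a ring homomorphism. -/
theorem IsLeibniz.subst {Φ : MvPowerSeries σ A →+* MvPowerSeries τ B}
    {d : MvPowerSeries σ A →+ MvPowerSeries τ B} (hd : IsLeibniz Φ d) {a : MvPowerSeries σ A}
    (ha : MvPowerSeries.constantCoeff a = 0) (hΦ : MvPowerSeries.constantCoeff (Φ a) = 0)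
    (F : PowerSeries ℚ) :
    d (F.subst a) = Φ ((PowerSeries.derivative ℚ F).subst a) * d a := by
  have h1 := hasSubst_of_const ha
  set s := (PowerSeries.substAlgHom (R := ℚ) h1).toRingHom with hs
  have hs' : ∀ G : PowerSeries ℚ, s G = G.subst a := fun G => by
    simp [hs, PowerSeries.coe_substAlgHom]
  have hC : ∀ r : ℚ, s (PowerSeries.C r) = algebraMap ℚ _ r := fun r =>
    RingHom.ext_iff.mp (RingHom.ext_rat (s.comp PowerSeries.C) (algebraMap ℚ _)) r
  have := IsLeibniz.ext_powerSeries (φ := Φ.comp s) (d := d.comp s.toAddMonoidHom)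
    (d' := (AddMonoidHom.mulRight (d a)).comp ((Φ.comp s).toAddMonoidHom.comp
      (PowerSeries.derivative ℚ).toLinearMap.toAddMonoidHom))
    (fun x y => by simp [hd (s x) (s y)])
    (fun x y => by
      simp only [AddMonoidHom.comp_apply, AddMonoidHom.mulRight_apply,
        LinearMap.toAddMonoidHom_coe, Derivation.coeFn_coe, RingHom.toAddMonoidHom_eq_coe,
        AddMonoidHom.coe_coe, Derivation.leibniz, smul_eq_mul, map_add, map_mul]
      ring)
    (by simpa [hs', PowerSeries.subst_X h1] using hΦ)
    (fun r => by
      have h := hd.map_algebraMap r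
      simpa [hC] using h)
    (by
      have h := _root_.map_one s
      rw [hs'] at h
      simp [hs', PowerSeries.subst_X h1, h])
  have h := DFunLike.congr_fun this F
  simpa [hs'] using h

/-- `exp a`, for a power series `a` without constant term. -/
def serExp (a : MvPowerSeries σ A) : MvPowerSeries σ A := (PowerSeries.exp ℚ).subst a

/-- `log u`, for a power series `u` with constant term `1`. -/
def serLog (u : MvPowerSeries σ A) : MvPowerSeries σ A := (PowerSeries.log ℚ).subst (u - 1)

theorem const_subst_rat {a : MvPowerSeries σ A} (ha : MvPowerSeries.constantCoeff a = 0)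
    (F : PowerSeries ℚ) : MvPowerSeries.constantCoeff (F.subst a) =
      algebraMap ℚ A (PowerSeries.constantCoeff F) := by
  have h : F = PowerSeries.C (PowerSeries.constantCoeff F) + PowerSeries.X *
      PowerSeries.mk fun n => PowerSeries.coeff (n + 1) F := by
    conv_lhs => rw [PowerSeries.eq_X_mul_shift_add_const F]
    ring
  have h1 := hasSubst_of_const ha
  conv_lhs => rw [h]
  rw [PowerSeries.subst_add h1, PowerSeries.subst_mul h1, PowerSeries.subst_X h1]
  simp only [map_add, map_mul, ha, zero_mul, add_zero]
  have := RingHom.ext_iff.mp (RingHom.ext_rat ((MvPowerSeries.constantCoeff.comp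
    (PowerSeries.substAlgHom (R := ℚ) h1).toRingHom).comp PowerSeries.C) (algebraMap ℚ A))
    (PowerSeries.constantCoeff F)
  simpa [PowerSeries.coe_substAlgHom] using this

theorem const_serExp {a : MvPowerSeries σ A} (ha : MvPowerSeries.constantCoeff a = 0) :
    MvPowerSeries.constantCoeff (serExp a) = 1 := by
  rw [serExp, const_subst_rat ha]; simp

theorem const_serLog {u : MvPowerSeries σ A} (hu : MvPowerSeries.constantCoeff u = 1) :
    MvPowerSeries.constantCoeff (serLog u) = 0 := by
  rw [serLog, const_subst_rat (by simp [hu])]; simp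

theorem map_serExp (Φ : MvPowerSeries σ A →+* MvPowerSeries τ B) {a : MvPowerSeries σ A}
    (ha : MvPowerSeries.constantCoeff a = 0) (hΦ : MvPowerSeries.constantCoeff (Φ a) = 0) :
    Φ (serExp a) = serExp (Φ a) := map_subst_rat Φ ha hΦ _

theorem IsLeibniz.serExp {Φ : MvPowerSeries σ A →+* MvPowerSeries τ B}
    {d : MvPowerSeries σ A →+ MvPowerSeries τ B} (hd : IsLeibniz Φ d) {a : MvPowerSeries σ A}
    (ha : MvPowerSeries.constantCoeff a = 0) (hΦ : MvPowerSeries.constantCoeff (Φ a) = 0) :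
    d (serExp a) = Φ (serExp a) * d a := by
  rw [EllFib.serExp, hd.subst ha hΦ, PowerSeries.derivative_exp]

@[simp] theorem serExp_zero : serExp (0 : MvPowerSeries σ A) = 1 := by
  rw [serExp, PowerSeries.subst_zero_eq_C_constantCoeff]
  simp

/-- The functional equation of the exponential. It is proved for the two variables of `ℚ⟦x, y⟧` by
comparison of coefficients and then specialised. -/
theorem serExp_add {a b : MvPowerSeries σ A} (ha : MvPowerSeries.constantCoeff a = 0)
    (hb : MvPowerSeries.constantCoeff b = 0) : serExp (a + b) = serExp a * serExp b := by
  set x : MvPowerSeries (Fin 2) ℚ := MvPowerSeries.X 0 with hx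
  set y : MvPowerSeries (Fin 2) ℚ := MvPowerSeries.X 1 with hy
  have hxy : serExp (x + y) = serExp x * serExp y := by
    ext e
    have h1 := PowerSeries.coeff_subst_X_zero_add_X_one (PowerSeries.exp ℚ) e
    have h2 := PowerSeries.coeff_subst_X_zero_subst_mul_X_one (PowerSeries.exp ℚ) e
    rw [serExp, serExp, serExp]
    refine h1.trans (Eq.trans ?_ h2.symm)
    simp only [PowerSeries.coeff_exp, Algebra.algebraMap_self, RingHom.id_apply]
    rw [Nat.choose_symm_add, Nat.add_choose]
    have h3 := Nat.factorial_mul_factorial_dvd_factorial_add (e 0) (e 1)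
    rw [Nat.cast_div h3 (by positivity)]
    have := Nat.factorial_pos (e 0)
    have := Nat.factorial_pos (e 1)
    have := Nat.factorial_pos (e 0 + e 1)
    push_cast
    field_simp
  have hs : MvPowerSeries.HasSubst (S := A) (![a, b] : Fin 2 → MvPowerSeries σ A) :=
    MvPowerSeries.hasSubst_of_constantCoeff_zero (fun i => by fin_cases i <;> simp [ha, hb])
  set Φ := (MvPowerSeries.substAlgHom (R := ℚ) hs).toRingHom with hΦ
  have hΦx : Φ x = a := by simp [hΦ, hx, MvPowerSeries.subst_X hs]
  have hΦy : Φ y = b := by simp [hΦ, hy, MvPowerSeries.subst_X hs]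
  have := congrArg Φ hxy
  rw [map_mul, map_serExp Φ (by simp [hx, hy]) (by simp [hΦx, hΦy, ha, hb]),
    map_serExp Φ (by simp [hx]) (by simp [hΦx, ha]),
    map_serExp Φ (by simp [hy]) (by simp [hΦy, hb]), map_add, hΦx, hΦy] at this
  exact this

theorem serExp_neg_mul {a : MvPowerSeries σ A} (ha : MvPowerSeries.constantCoeff a = 0) :
    serExp (-a) * serExp a = 1 := by
  rw [← serExp_add (by simp [ha]) ha]; simp

theorem serExp_nsmul {a : MvPowerSeries σ A} (ha : MvPowerSeries.constantCoeff a = 0) (n : ℕ) :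
    serExp (n • a) = serExp a ^ n := by
  induction n with
  | zero => simp
  | succ n ih => rw [succ_nsmul, serExp_add (by simp [ha]) ha, ih, pow_succ]

/-- `exp (log (1 + X)) = 1 + X`: the quotient of the two sides has derivative `0`. -/
theorem exp_subst_log : (PowerSeries.exp ℚ).subst (PowerSeries.log ℚ) =
    (1 + PowerSeries.X : PowerSeries ℚ) := by
  set E : PowerSeries ℚ := (PowerSeries.exp ℚ).subst (PowerSeries.log ℚ) with hE
  have hg : PowerSeries.HasSubst (PowerSeries.log ℚ) := PowerSeries.HasSubst.log
  have hd : PowerSeries.derivative ℚ E = E * PowerSeries.derivative ℚ (PowerSeries.log ℚ) := by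
    rw [hE, PowerSeries.derivative_subst hg, PowerSeries.derivative_exp]
  have hl : (1 + PowerSeries.X) * PowerSeries.derivative ℚ (PowerSeries.log ℚ) = 1 := by
    rw [PowerSeries.deriv_log]
    ext n
    rw [add_mul, one_mul, map_add]
    cases n with
    | zero => simp
    | succ n =>
      rw [PowerSeries.coeff_succ_X_mul]
      simp [pow_succ, PowerSeries.coeff_one]
  have h0 : PowerSeries.constantCoeff E = 1 := by
    have h := const_subst_rat (σ := Unit) (A := ℚ) (a := PowerSeries.log ℚ)
      (PowerSeries.constantCoeff_log) (PowerSeries.exp ℚ)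
    exact h.trans (by simp)
  have hne : (1 + PowerSeries.X : PowerSeries ℚ) ≠ 0 := by
    intro h
    have := congrArg PowerSeries.constantCoeff h
    simp at this
  -- the quotient `E / (1 + X)` has derivative zero
  have key : E * (1 + PowerSeries.X)⁻¹ = (1 : PowerSeries ℚ) := by
    refine PowerSeries.derivative.ext ?_ (by simp [h0])
    rw [Derivation.leibniz, PowerSeries.derivative_inv', hd]
    have hinv : (1 + PowerSeries.X : PowerSeries ℚ) * (1 + PowerSeries.X)⁻¹ = 1 :=
      PowerSeries.mul_inv_cancel _ (by simp)
    have hd1 : PowerSeries.derivative ℚ (1 + PowerSeries.X : PowerSeries ℚ) = 1 := by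
      simp [map_add]
    simp only [smul_eq_mul, hd1, PowerSeries.derivative_one]
    linear_combination (E * (1 + PowerSeries.X)⁻¹ ^ 2) * hl -
      E * (1 + PowerSeries.X)⁻¹ * PowerSeries.derivative ℚ (PowerSeries.log ℚ) * hinv
  have hinv : (1 + PowerSeries.X : PowerSeries ℚ) * (1 + PowerSeries.X)⁻¹ = 1 :=
      PowerSeries.mul_inv_cancel _ (by simp)
  linear_combination (1 + PowerSeries.X) * key - E * hinv

theorem serExp_serLog {u : MvPowerSeries σ A} (hu : MvPowerSeries.constantCoeff u = 1) :
    serExp (serLog u) = u := by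
  have h0 : MvPowerSeries.constantCoeff (u - 1) = 0 := by simp [hu]
  have h1 := hasSubst_of_const h0
  rw [serExp, serLog, ← PowerSeries.subst_comp_subst_apply (PowerSeries.HasSubst.log) h1,
    exp_subst_log, PowerSeries.subst_add h1, PowerSeries.subst_X h1]
  have : (1 : PowerSeries ℚ).subst (u - 1) = 1 := by
    rw [← PowerSeries.coe_substAlgHom h1, map_one]
  rw [this]; ring

/-- `exp` is injective on power series without constant term. -/
theorem serExp_injective {a b : MvPowerSeries σ A} (ha : MvPowerSeries.constantCoeff a = 0)
    (hb : MvPowerSeries.constantCoeff b = 0) (h : serExp a = serExp b) : a = b := by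
  set c := a - b with hc
  have hc0 : MvPowerSeries.constantCoeff c = 0 := by simp [hc, ha, hb]
  have h1 : serExp c = 1 := by
    have h2 : serExp a = serExp c * serExp b := by rw [← serExp_add hc0 hb]; simp [hc]
    have h3 := serExp_neg_mul hb
    calc serExp c = serExp c * serExp b * serExp (-b) := by
          rw [mul_assoc, mul_comm (serExp b), h3, mul_one]
      _ = 1 := by rw [← h2, h, mul_comm, h3]
  -- `exp c - 1 = c * (1 + ⋯)`
  obtain ⟨w, hw0, hw⟩ : ∃ w : PowerSeries ℚ, PowerSeries.constantCoeff w = 1 ∧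
      PowerSeries.exp ℚ = 1 + PowerSeries.X * w := by
    refine ⟨PowerSeries.mk fun n => PowerSeries.coeff (n + 1) (PowerSeries.exp ℚ), ?_, ?_⟩
    · rw [← PowerSeries.coeff_zero_eq_constantCoeff_apply]
      simp [PowerSeries.coeff_exp]
    · conv_lhs => rw [PowerSeries.eq_X_mul_shift_add_const (PowerSeries.exp ℚ)]
      simp [add_comm]
  have hs := hasSubst_of_const hc0
  have h2 : serExp c = 1 + c * w.subst c := by
    rw [serExp, hw, PowerSeries.subst_add hs, PowerSeries.subst_mul hs, PowerSeries.subst_X hs,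
      ← PowerSeries.coe_substAlgHom hs, map_one]
  have h3 : c * w.subst c = 0 := by rw [h1] at h2; linear_combination -h2
  have hu : IsUnit (w.subst c : MvPowerSeries σ A) := by
    rw [MvPowerSeries.isUnit_iff_constantCoeff, const_subst_rat hc0, hw0]
    simp
  exact sub_eq_zero.mp ((hu.mul_left_eq_zero).mp h3)

end Exponential

/-! ### Derivations of power series rings -/

section Derivations

/-- The derivation `X d/dX` of power series. -/
def qDeriv {R : Type*} [CommRing R] : Derivation R (PowerSeries R) (PowerSeries R) :=
  (PowerSeries.X : PowerSeries R) • PowerSeries.derivative R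

theorem qDeriv_apply {R : Type*} [CommRing R] (a : PowerSeries R) :
    qDeriv a = PowerSeries.X * PowerSeries.derivative R a := rfl

theorem coeff_qDeriv {R : Type*} [CommRing R] (a : PowerSeries R) (n : ℕ) :
    PowerSeries.coeff n (qDeriv a) = n * PowerSeries.coeff n a := by
  cases n with
  | zero => simp [qDeriv_apply]
  | succ n =>
    rw [qDeriv_apply, PowerSeries.coeff_succ_X_mul, PowerSeries.coeff_derivative]
    push_cast
    ring

@[simp] theorem constantCoeff_qDeriv {R : Type*} [CommRing R] (a : PowerSeries R) :
    PowerSeries.constantCoeff (qDeriv a) = 0 := by simp [qDeriv_apply]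

@[simp] theorem qDeriv_X {R : Type*} [CommRing R] :
    qDeriv (PowerSeries.X : PowerSeries R) = PowerSeries.X := by simp [qDeriv_apply]

/-- The underlying additive map of a derivation. -/
def derAdd {R S : Type*} [CommRing R] [CommRing S] [Algebra R S] (d : Derivation R S S) : S →+ S :=
  (d : S →ₗ[R] S).toAddMonoidHom

@[simp] theorem derAdd_apply {R S : Type*} [CommRing R] [CommRing S] [Algebra R S]
    (d : Derivation R S S) (a : S) : derAdd d a = d a := rfl

theorem derAdd_isLeibniz {R S : Type*} [CommRing R] [CommRing S] [Algebra R S]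
    (d : Derivation R S S) : IsLeibniz (RingHom.id S) (derAdd d) := fun a b => by simp

/-- The extension of a derivation of `K` to `K⟦X⟧` acting on the coefficients. -/
def coeffDer {K : Type*} [CommRing K] [Algebra ℚ K] (d : Derivation ℚ K K) :
    Derivation ℚ (PowerSeries K) (PowerSeries K) :=
  Derivation.mk'
    { toFun := fun a => PowerSeries.mk fun n => d (PowerSeries.coeff n a)
      map_add' := fun a b => by ext n; simp
      map_smul' := fun r a => by ext n; simp }
    (fun a b => by
      ext n
      simp only [LinearMap.coe_mk, AddHom.coe_mk, PowerSeries.coeff_mk, PowerSeries.coeff_mul,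
        map_sum, smul_eq_mul, map_add, Derivation.leibniz, Finset.sum_add_distrib]
      congr 1
      rw [← Finset.Nat.sum_antidiagonal_swap]
      rfl)

@[simp] theorem coeff_coeffDer {K : Type*} [CommRing K] [Algebra ℚ K] (d : Derivation ℚ K K)
    (a : PowerSeries K) (n : ℕ) :
    PowerSeries.coeff n (coeffDer d a) = d (PowerSeries.coeff n a) := by
  simp [coeffDer]

@[simp] theorem constantCoeff_coeffDer {K : Type*} [CommRing K] [Algebra ℚ K]
    (d : Derivation ℚ K K) (a : PowerSeries K) :
    PowerSeries.constantCoeff (coeffDer d a) = d (PowerSeries.constantCoeff a) := by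
  rw [← PowerSeries.coeff_zero_eq_constantCoeff_apply, coeff_coeffDer]
  simp

@[simp] theorem coeffDer_C {K : Type*} [CommRing K] [Algebra ℚ K] (d : Derivation ℚ K K) (k : K) :
    coeffDer d (PowerSeries.C k) = PowerSeries.C (d k) := by
  ext n
  rw [coeff_coeffDer, PowerSeries.coeff_C, PowerSeries.coeff_C]
  split_ifs <;> simp

@[simp] theorem coeffDer_X {K : Type*} [CommRing K] [Algebra ℚ K] (d : Derivation ℚ K K) :
    coeffDer d (PowerSeries.X : PowerSeries K) = 0 := by
  ext n
  rw [coeff_coeffDer, PowerSeries.coeff_X]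
  split_ifs <;> simp

theorem derivation_ext_powerSeries {K : Type*} [CommRing K] [Algebra ℚ K]
    {d d' : Derivation ℚ (PowerSeries K) (PowerSeries K)}
    (hC : ∀ k, d (PowerSeries.C k) = d' (PowerSeries.C k))
    (hX : d PowerSeries.X = d' PowerSeries.X) : d = d' := by
  have := IsLeibniz.ext_powerSeries (σ := Unit) (derAdd_isLeibniz d) (derAdd_isLeibniz d')
    (by exact PowerSeries.constantCoeff_X) hC hX
  ext1 a
  exact DFunLike.congr_fun this a

/-- The derivation `X d/dX`, regarded as linear over the rationals. -/
def qDerivRat {K : Type*} [CommRing K] [Algebra ℚ K] :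
    Derivation ℚ (PowerSeries K) (PowerSeries K) := (qDeriv (R := K)).restrictScalars ℚ

@[simp] theorem qDerivRat_apply {K : Type*} [CommRing K] [Algebra ℚ K] (a : PowerSeries K) :
    qDerivRat a = qDeriv a := rfl

end Derivations

/-! ### Ramanujan's differential equations -/

section Ramanujan

open Complex UpperHalfPlane Derivative EisensteinSeries
open scoped Manifold MatrixGroups ModularForm Real

/-- The power series `a` is the `q`-expansion, `q = exp (2πiτ)`, of the function `F` on the upper
half-plane. -/
def HasQExp (a : PowerSeries ℂ) (F : ℍ → ℂ) : Prop :=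
  ∀ τ : ℍ, HasSum (fun m => PowerSeries.coeff m a * cexp (2 * π * Complex.I * τ) ^ m) (F τ)

theorem HasQExp.add {a b : PowerSeries ℂ} {F G : ℍ → ℂ} (ha : HasQExp a F) (hb : HasQExp b G) :
    HasQExp (a + b) (F + G) := by
  intro τ
  simpa [add_mul] using (ha τ).add (hb τ)

theorem HasQExp.smul {a : PowerSeries ℂ} {F : ℍ → ℂ} (c : ℂ) (ha : HasQExp a F) :
    HasQExp (c • a) (c • F) := by
  intro τ
  simpa [mul_assoc] using (ha τ).mul_left c

theorem HasQExp.mul {a b : PowerSeries ℂ} {F G : ℍ → ℂ} (ha : HasQExp a F) (hb : HasQExp b G) :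
    HasQExp (a * b) (F * G) := by
  intro τ
  have h1 := (ha τ).summable.norm
  have h2 := (hb τ).summable.norm
  have h3 := (summable_norm_sum_mul_antidiagonal_of_summable_norm h1 h2).of_norm
  have h4 := tsum_mul_tsum_eq_tsum_sum_antidiagonal_of_summable_norm h1 h2
  rw [(ha τ).tsum_eq, (hb τ).tsum_eq] at h4
  have h5 := h3.hasSum
  rw [← h4] at h5
  convert! h5 using 2 with m
  rw [PowerSeries.coeff_mul, Finset.sum_mul]
  refine Finset.sum_congr rfl fun p hp => ?_
  rw [← Finset.HasAntidiagonal.mem_antidiagonal.mp hp, pow_add]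
  ring

/-- A `q`-expansion may be differentiated termwise. -/
theorem HasQExp.deriv {a : PowerSeries ℂ} {F : ℍ → ℂ} (ha : HasQExp a F) :
    HasQExp (qDeriv a) (normalizedDerivOfComplex F) := by
  intro τ
  -- the series converges uniformly on a half-plane `Im w > y` containing `τ`
  set y : ℝ := τ.im / 2 with hy
  have hy0 : 0 < y := half_pos τ.im_pos
  let U : Set ℂ := {w | y < w.im}
  have hU : IsOpen U := isOpen_lt continuous_const Complex.continuous_im
  have hτU : (τ : ℂ) ∈ U := by
    change y < τ.im
    linarith [τ.im_pos]
  let τ₀ : ℍ := ⟨y * Complex.I, by simpa using hy0⟩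
  let f : ℕ → ℂ → ℂ := fun m w => PowerSeries.coeff m a * cexp (2 * π * Complex.I * w) ^ m
  have hsum : Summable fun m => ‖f m τ₀‖ := (ha τ₀).summable.norm
  have hle : ∀ (m : ℕ) (w : ℂ), w ∈ U → ‖f m w‖ ≤ ‖f m τ₀‖ := by
    intro m w hw
    have hw' : y < w.im := hw
    simp only [f, norm_mul, norm_pow, Complex.norm_exp]
    have h1 : (2 * π * Complex.I * w).re = -(2 * π * w.im) := by simp [mul_assoc]
    have h2 : (2 * π * Complex.I * (τ₀ : ℂ)).re = -(2 * π * y) := by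
      change (2 * π * Complex.I * (y * Complex.I)).re = _
      simp [mul_assoc]
    rw [h1, h2]
    have := Real.pi_pos
    gcongr
  have hdf : ∀ m, ∀ w, HasDerivAt (f m)
      (2 * π * Complex.I *
        (PowerSeries.coeff m (qDeriv a) * cexp (2 * π * Complex.I * w) ^ m)) w := by
    intro m w
    have h1 : HasDerivAt (fun w : ℂ => cexp (2 * π * Complex.I * w))
        (cexp (2 * π * Complex.I * w) * (2 * π * Complex.I)) w := by
      have := ((hasDerivAt_id w).const_mul (2 * π * Complex.I)).cexp
      simpa using this
    have h2 := (h1.pow m).const_mul (PowerSeries.coeff m a)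
    convert! h2 using 1
    rw [coeff_qDeriv]
    cases m with
    | zero => simp
    | succ m => simp only [Nat.add_sub_cancel]; rw [pow_succ]; ring
  have h := hasSum_deriv_of_summable_norm hsum
    (fun m => fun w _ => (hdf m w).differentiableAt.differentiableWithinAt) hU hle hτU
  have hF : (fun w => ∑' m, f m w) =ᶠ[nhds (τ : ℂ)] F ∘ ofComplex := by
    filter_upwards [isOpen_upperHalfPlaneSet.mem_nhds τ.im_pos] with w hw
    rw [Function.comp_apply, ofComplex_apply_of_im_pos hw]
    exact (ha ⟨w, hw⟩).tsum_eq
  rw [hF.deriv_eq] at h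
  simp_rw [fun m => (hdf m (τ : ℂ)).deriv] at h
  have h5 := h.mul_left ((2 * π * Complex.I)⁻¹)
  have hne : (2 * π * Complex.I : ℂ) ≠ 0 := Complex.two_pi_I_ne_zero
  simp_rw [inv_mul_cancel_left₀ hne] at h5
  exact h5

/-- A level one form of weight less than `12` whose `q`-expansion has no constant term vanishes. -/
theorem HasQExp.eq_zero {a : PowerSeries ℂ} {F : ℍ → ℂ} (ha : HasQExp a F) {k : ℕ} (hk : k < 12)
    (hF : MDiff F) (hs : ∀ γ : SL(2, ℤ), F ∣[(k : ℤ)] γ = F)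
    (h0 : PowerSeries.constantCoeff a = 0) : a = 0 := by
  have ha' : ∀ τ : ℍ, HasSum (fun m => PowerSeries.coeff m a •
      Function.Periodic.qParam (1 : ℝ) τ ^ m) (F τ) := fun τ => by
    simpa only [Function.Periodic.qParam, ofReal_one, div_one, smul_eq_mul] using ha τ
  let f : ModularForm 𝒮ℒ (k : ℤ) :=
    { toFun := F
      slash_action_eq' := by
        rintro _ ⟨γ, rfl⟩
        exact hs γ
      holo' := hF
      bdd_at_cusps' := fun {c} hc => by
        rw [Subgroup.IsArithmetic.isCusp_iff_isCusp_SL2Z] at hc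
        rw [OnePoint.isBoundedAt_iff_forall_SL2Z hc]
        intro γ _
        rw [hs γ]
        exact isBoundedAtImInfty_of_hasSum_qExpansion one_pos ha' }
  have hc := ModularFormClass.qExpansion_coeff_unique (f := f) one_pos one_mem_strictPeriods_SL ha'
  have hf : f = 0 := by
    refine ModularForm.sturm_bound_levelOne_nat ?_
    rw [Nat.div_eq_of_lt hk]
    refine lt_of_lt_of_le ?_ (PowerSeries.le_order _ 1 fun i hi => ?_)
    · simp
    · have : i = 0 := by
        have : i < 1 := by exact_mod_cast hi
        omega
      subst this
      rw [← hc 0]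
      simpa using h0
  ext m
  rw [hc m, hf]
  simp [qExpansion_zero]

/-- The `q`-expansion of the normalised Eisenstein series, with complex coefficients. -/
def eisensteinC (k : ℕ) : PowerSeries ℂ := (eisenstein k).map (algebraMap ℚ ℂ)

theorem constantCoeff_eisenstein (k : ℕ) : PowerSeries.constantCoeff (eisenstein k) = 1 := by
  rw [← PowerSeries.coeff_zero_eq_constantCoeff_apply]
  simp [eisenstein]

theorem constantCoeff_eisensteinC (k : ℕ) : PowerSeries.constantCoeff (eisensteinC k) = 1 := by
  rw [eisensteinC, ← PowerSeries.coeff_zero_eq_constantCoeff_apply, PowerSeries.coeff_map]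
  simp [constantCoeff_eisenstein]

theorem hasQExp_E {k : ℕ} (hk : 3 ≤ k) (hk2 : Even k) :
    HasQExp (eisensteinC k) (ModularForm.E hk) := by
  intro τ
  have h := ModularForm.hasSum_qExpansion (ModularForm.E hk) (h := 1) one_pos
    one_mem_strictPeriods_SL τ
  convert! h using 2 with m
  rw [E_qExpansion_coeff hk hk2, eisensteinC, PowerSeries.coeff_map, eisenstein]
  simp only [PowerSeries.coeff_mk, Function.Periodic.qParam, ofReal_one, div_one]
  congr 1
  split_ifs <;> simp

theorem hasQExp_E2 : HasQExp (eisensteinC 2) E2 := by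
  intro τ
  have h := hasSum_qExpansion_E2 (z := τ)
  convert! h using 2 with m
  rw [eisensteinC, PowerSeries.coeff_map, eisenstein]
  simp only [PowerSeries.coeff_mk, smul_eq_mul]
  congr 1
  split_ifs
  · simp
  · rw [show bernoulli 2 = 1 / 6 by decide +kernel]
    norm_num

theorem mdiff_E {k : ℕ} (hk : 3 ≤ k) : MDiff (ModularForm.E hk : ℍ → ℂ) := (ModularForm.E hk).holo'

theorem E_slash {k : ℕ} (hk : 3 ≤ k) (γ : SL(2, ℤ)) :
    (ModularForm.E hk : ℍ → ℂ) ∣[(k : ℤ)] γ = ModularForm.E hk :=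
  (ModularForm.E hk).slash_action_eq' _ ⟨γ, rfl⟩

/-- The `q`-expansion of the Serre derivative of an Eisenstein series. -/
theorem serre_E {k : ℕ} (hk : 3 ≤ k) (hk2 : Even k) :
    HasQExp (qDeriv (eisensteinC k) + (-(k : ℂ) / 12) • (eisensteinC 2 * eisensteinC k))
      (serreDerivative k (ModularForm.E hk)) := by
  have h := (hasQExp_E hk hk2).deriv.add ((hasQExp_E2.mul (hasQExp_E hk hk2)).smul (-(k : ℂ) / 12))
  convert! h using 1
  ext τ
  simp [serreDerivative]
  ring

/-- The Serre derivative of `E₄` plus `E₆ / 3` is a modular form of weight `6` without constant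
term, hence zero. -/
theorem ramanujan_E₄_complex : qDeriv (eisensteinC 4) +
    (-(4 : ℂ) / 12) • (eisensteinC 2 * eisensteinC 4) + (1 / 3 : ℂ) • eisensteinC 6 = 0 := by
  have h := (serre_E (k := 4) (by norm_num) ⟨2, rfl⟩).add
    ((hasQExp_E (k := 6) (by norm_num) ⟨3, rfl⟩).smul (1 / 3))
  refine HasQExp.eq_zero (k := 6) (by simpa using h) (by norm_num) ?_ ?_ ?_
  · exact (serreDerivative_mdifferentiable _ (mdiff_E _)).add ((mdiff_E _).const_smul _)
  · intro γ
    have h1 := serreDerivative_slash_invariant (k := (4 : ℕ)) (γ := γ)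
      (mdiff_E (k := 4) (by norm_num)) (E_slash _ γ)
    have h2 := E_slash (k := 6) (by norm_num) γ
    rw [SlashAction.add_slash, ModularForm.SL_smul_slash, h2]
    congr 1
  · simp [constantCoeff_qDeriv, constantCoeff_eisensteinC]; norm_num

/-- The Serre derivative of `E₆` plus `E₄² / 2` is a modular form of weight `8` without constant
term, hence zero. -/
theorem ramanujan_E₆_complex : qDeriv (eisensteinC 6) +
    (-(6 : ℂ) / 12) • (eisensteinC 2 * eisensteinC 6) +
      (1 / 2 : ℂ) • (eisensteinC 4 * eisensteinC 4) = 0 := by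
  have h4 := hasQExp_E (k := 4) (by norm_num) ⟨2, rfl⟩
  have h := (serre_E (k := 6) (by norm_num) ⟨3, rfl⟩).add ((h4.mul h4).smul (1 / 2))
  refine HasQExp.eq_zero (k := 8) (by simpa using h) (by norm_num) ?_ ?_ ?_
  · exact (serreDerivative_mdifferentiable _ (mdiff_E _)).add
      (((mdiff_E _).mul (mdiff_E _)).const_smul _)
  · intro γ
    have h1 := serreDerivative_slash_invariant (k := (6 : ℕ)) (γ := γ)
      (mdiff_E (k := 6) (by norm_num)) (E_slash _ γ)
    have h2 := E_slash (k := 4) (by norm_num) γ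
    have h3 := ModularForm.mul_slash_SL2 ((4 : ℕ) : ℤ) ((4 : ℕ) : ℤ) γ
      (ModularForm.E (k := 4) (by norm_num)) (ModularForm.E (k := 4) (by norm_num))
    rw [h2] at h3
    rw [SlashAction.add_slash, ModularForm.SL_smul_slash]
    congr 1
    congr 1
  · simp [constantCoeff_qDeriv, constantCoeff_eisensteinC]; norm_num

/-- The quasi-modular transformation law of `E₂`, with its anomalous term in explicit form. -/
theorem E2_slash (γ : SL(2, ℤ)) (z : ℍ) :
    (E2 ∣[(2 : ℤ)] γ) z = E2 z + 12 * (2 * π * Complex.I)⁻¹ * (γ 1 0 / denom γ z) := by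
  rw [E2_slash_action]
  simp only [Pi.sub_apply, Pi.smul_apply, smul_eq_mul, D2, riemannZeta_two]
  have : (π : ℂ) ≠ 0 := by exact_mod_cast Real.pi_ne_zero
  have h2 := denom_ne_zero γ z
  field_simp
  linear_combination (-12 : ℂ) * (γ 1 0 : ℂ) * Complex.I_sq

/-- The transformation law of the derivative of `E₂`, obtained by differentiation of that of `E₂`.
-/
theorem D_E2_slash (γ : SL(2, ℤ)) (z : ℍ) :
    (normalizedDerivOfComplex E2 ∣[(4 : ℤ)] γ) z = normalizedDerivOfComplex E2 z +
      2 * (2 * π * Complex.I)⁻¹ * (γ 1 0 / denom γ z) * E2 z +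
        12 * ((2 * π * Complex.I)⁻¹ * (γ 1 0 / denom γ z)) ^ 2 := by
  have h := congrFun (normalizedDerivOfComplex_SL_slash (k := 2) E2_mdifferentiable (γ := γ)) z
  simp only [Pi.sub_apply] at h
  have h1 : HasDerivAt (fun w : ℂ => (denom γ w) ^ (-1 : ℤ))
      ((-1 : ℤ) * ((γ : GL (Fin 2) ℝ) 1 0 : ℂ) * (denom γ z) ^ ((-1 : ℤ) - 1)) ↑z :=
    hasDerivAt_denom_zpow (γ : GL (Fin 2) ℝ) (-1) z
  have hE : DifferentiableAt ℂ (E2 ∘ ofComplex) ↑z :=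
    mdifferentiableAt_iff.mp (E2_mdifferentiable z)
  have h2 := hE.hasDerivAt.add
    (h1.const_mul (12 * (2 * π * Complex.I)⁻¹ * (γ 1 0 : ℂ)))
  have hD : normalizedDerivOfComplex (E2 ∣[(2 : ℤ)] γ) z = normalizedDerivOfComplex E2 z -
      12 * ((2 * π * Complex.I)⁻¹ * (γ 1 0 / denom γ z)) ^ 2 := by
    have heq : ((E2 ∣[(2 : ℤ)] γ) ∘ ofComplex) =ᶠ[nhds (z : ℂ)] fun w => (E2 ∘ ofComplex) w +
        12 * (2 * π * Complex.I)⁻¹ * (γ 1 0 : ℂ) * (denom γ w) ^ (-1 : ℤ) := by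
      filter_upwards [isOpen_upperHalfPlaneSet.mem_nhds z.im_pos] with w hw
      rw [Function.comp_apply, Function.comp_apply, ofComplex_apply_of_im_pos hw, E2_slash]
      simp only [zpow_neg, zpow_one]
      ring
    rw [normalizedDerivOfComplex, heq.deriv_eq]
    have h3 := h2.deriv
    rw [normalizedDerivOfComplex]
    refine (congrArg _ h3).trans ?_
    have h4 : (((γ : GL (Fin 2) ℝ) 1 0 : ℝ) : ℂ) = (γ 1 0 : ℂ) := by simp
    have h5 : (denom γ z) ^ ((-1 : ℤ) - 1) = ((denom γ z) ^ 2)⁻¹ := by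
      rw [show (-1 : ℤ) - 1 = -(2 : ℕ) by norm_num, zpow_neg, zpow_natCast]
    rw [h4, h5]
    push_cast
    ring
  rw [hD, E2_slash] at h
  push_cast at h
  linear_combination -h

/-- In `q dE₂/dq - E₂² / 12` the anomalous terms cancel, so that together with `E₄ / 12` it is a
modular form of weight `4` without constant term, hence zero. -/
theorem ramanujan_E₂_complex : qDeriv (eisensteinC 2) +
    (-(1 : ℂ) / 12) • (eisensteinC 2 * eisensteinC 2) + (1 / 12 : ℂ) • eisensteinC 4 = 0 := by
  have h4 := hasQExp_E (k := 4) (by norm_num) ⟨2, rfl⟩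
  have h := (hasQExp_E2.deriv.add ((hasQExp_E2.mul hasQExp_E2).smul (-(1 : ℂ) / 12))).add
    (h4.smul (1 / 12))
  refine HasQExp.eq_zero (k := 4) h (by norm_num) ?_ ?_ ?_
  · exact ((normalizedDerivOfComplex_mdifferentiable E2_mdifferentiable).add
      ((E2_mdifferentiable.mul E2_mdifferentiable).const_smul _)).add ((mdiff_E _).const_smul _)
  · intro γ
    have h2 := E_slash (k := 4) (by norm_num) γ
    have h3 := ModularForm.mul_slash_SL2 2 2 γ E2 E2
    rw [SlashAction.add_slash, SlashAction.add_slash, ModularForm.SL_smul_slash,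
      ModularForm.SL_smul_slash, h2]
    congr 1
    ext z
    have h5 := D_E2_slash γ z
    have h6 : ((E2 * E2) ∣[((4 : ℕ) : ℤ)] γ) z = (E2 z + 12 * (2 * π * Complex.I)⁻¹ *
        (γ 1 0 / denom γ z)) ^ 2 := by
      have := congrFun h3 z
      rw [Pi.mul_apply, E2_slash] at this
      rw [pow_two]
      exact this
    have h7 : ((normalizedDerivOfComplex E2) ∣[((4 : ℕ) : ℤ)] γ) z = _ := h5
    simp only [Pi.add_apply, Pi.smul_apply, smul_eq_mul, Pi.mul_apply, h7, h6]
    ring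
  · simp [constantCoeff_qDeriv, constantCoeff_eisensteinC]; norm_num

end Ramanujan

/-! ### The differential ring of quasi-modular forms -/

section EisensteinAlgebra

/-- The generator `E₂` of `ℚ[E₂, E₄, E₆]`. -/
abbrev e₂ : QM := MvPolynomial.X 0

/-- The generator `E₄` of `ℚ[E₂, E₄, E₆]`. -/
abbrev e₄ : QM := MvPolynomial.X 1

/-- The generator `E₆` of `ℚ[E₂, E₄, E₆]`. -/
abbrev e₆ : QM := MvPolynomial.X 2

@[simp] theorem qexp_e₂ : qexp e₂ = eisenstein 2 := by simp [qexp]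
@[simp] theorem qexp_e₄ : qexp e₄ = eisenstein 4 := by simp [qexp]
@[simp] theorem qexp_e₆ : qexp e₆ = eisenstein 6 := by simp [qexp]

theorem qDeriv_eisensteinC (k : ℕ) :
    qDeriv (eisensteinC k) = (qDeriv (eisenstein k)).map (algebraMap ℚ ℂ) := by
  ext n
  simp [coeff_qDeriv, eisensteinC]

theorem map_complex_injective : Function.Injective
    (PowerSeries.map (algebraMap ℚ ℂ) : PowerSeries ℚ → PowerSeries ℂ) :=
  PowerSeries.map_injective _ (algebraMap ℚ ℂ).injective

theorem map_complex_smul (r : ℚ) (a : PowerSeries ℚ) :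
    (r • a).map (algebraMap ℚ ℂ) = (r : ℂ) • a.map (algebraMap ℚ ℂ) := by
  ext n; simp

/-- Ramanujan's differential equation for `E₂`. -/
theorem ramanujan_E₂ : qDeriv (eisenstein 2) =
    (1 / 12 : ℚ) • (eisenstein 2 * eisenstein 2 - eisenstein 4) := by
  apply map_complex_injective
  have h := ramanujan_E₂_complex
  rw [map_complex_smul, ← qDeriv_eisensteinC, map_sub, map_mul]
  change qDeriv (eisensteinC 2) = _ • (eisensteinC 2 * eisensteinC 2 - eisensteinC 4)
  push_cast
  linear_combination (norm := algebra) h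

/-- Ramanujan's differential equation for `E₄`. -/
theorem ramanujan_E₄ : qDeriv (eisenstein 4) =
    (1 / 3 : ℚ) • (eisenstein 2 * eisenstein 4 - eisenstein 6) := by
  apply map_complex_injective
  have h := ramanujan_E₄_complex
  rw [map_complex_smul, ← qDeriv_eisensteinC, map_sub, map_mul]
  change qDeriv (eisensteinC 4) = _ • (eisensteinC 2 * eisensteinC 4 - eisensteinC 6)
  push_cast
  linear_combination (norm := algebra) h

/-- Ramanujan's differential equation for `E₆`. -/
theorem ramanujan_E₆ : qDeriv (eisenstein 6) =
    (1 / 2 : ℚ) • (eisenstein 2 * eisenstein 6 - eisenstein 4 * eisenstein 4) := by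
  apply map_complex_injective
  have h := ramanujan_E₆_complex
  rw [map_complex_smul, ← qDeriv_eisensteinC, map_sub, map_mul, map_mul]
  change qDeriv (eisensteinC 6) =
    _ • (eisensteinC 2 * eisensteinC 6 - eisensteinC 4 * eisensteinC 4)
  push_cast
  linear_combination (norm := algebra) h

/-- The derivation of `ℚ[E₂, E₄, E₆]` given by Ramanujan's differential equations. -/
def ram : Derivation ℚ QM QM := MvPolynomial.mkDerivation ℚ
  ![(1 / 12 : ℚ) • (e₂ * e₂ - e₄), (1 / 3 : ℚ) • (e₂ * e₄ - e₆), (1 / 2 : ℚ) • (e₂ * e₆ - e₄ * e₄)]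

@[simp] theorem ram_e₂ : ram e₂ = (1 / 12 : ℚ) • (e₂ * e₂ - e₄) := by simp [ram]
@[simp] theorem ram_e₄ : ram e₄ = (1 / 3 : ℚ) • (e₂ * e₄ - e₆) := by simp [ram]
@[simp] theorem ram_e₆ : ram e₆ = (1 / 2 : ℚ) • (e₂ * e₆ - e₄ * e₄) := by simp [ram]

theorem qexp_ram (p : QM) : qexp (ram p) = qDeriv (qexp p) := by
  have := IsLeibniz.ext_mvPolynomial (φ := qexp.toRingHom)
    (d := qexp.toRingHom.toAddMonoidHom.comp (derAdd ram))
    (d' := (derAdd (qDeriv (R := ℚ))).comp qexp.toRingHom.toAddMonoidHom)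
    (fun a b => by simp) (fun a b => by simp) (fun i => by
      fin_cases i
      · simp [ramanujan_E₂]
      · simp [ramanujan_E₄]
      · simp [ramanujan_E₆])
  exact DFunLike.congr_fun this p

/-- The Euler derivation of `ℚ[E₂, E₄, E₆]`, multiplication by the weight. -/
def wt : Derivation ℚ QM QM := MvPolynomial.mkDerivation ℚ
  ![(2 : ℚ) • e₂, (4 : ℚ) • e₄, (6 : ℚ) • e₆]

@[simp] theorem wt_e₂ : wt e₂ = (2 : ℚ) • e₂ := by simp [wt]
@[simp] theorem wt_e₄ : wt e₄ = (4 : ℚ) • e₄ := by simp [wt]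
@[simp] theorem wt_e₆ : wt e₆ = (6 : ℚ) • e₆ := by simp [wt]

theorem wt_eq_sum (p : QM) : wt p = (2 : ℚ) • (e₂ * MvPolynomial.pderiv 0 p) +
    (4 : ℚ) • (e₄ * MvPolynomial.pderiv 1 p) + (6 : ℚ) • (e₆ * MvPolynomial.pderiv 2 p) := by
  have h : wt = (2 : ℚ) • (e₂ • MvPolynomial.pderiv 0) + (4 : ℚ) • (e₄ • MvPolynomial.pderiv 1) +
      (6 : ℚ) • (e₆ • MvPolynomial.pderiv 2) := by
    refine MvPolynomial.derivation_ext fun i => ?_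
    fin_cases i <;> simp [wt, MvPolynomial.pderiv_X]
  simpa using congrArg (fun d : Derivation ℚ QM QM => d p) h

/-- The Euler derivation multiplies every monomial by its weighted degree. -/
theorem coeff_wt (p : QM) (m : Fin 3 →₀ ℕ) : MvPolynomial.coeff m (wt p) =
    (Finsupp.weight ![2, 4, 6] m : ℕ) * MvPolynomial.coeff m p := by
  induction p using MvPolynomial.induction_on' with
  | add p q hp hq => rw [map_add, MvPolynomial.coeff_add, hp, hq, MvPolynomial.coeff_add, mul_add]
  | monomial u r =>
    rw [wt_eq_sum, MvPolynomial.X_mul_pderiv_monomial, MvPolynomial.X_mul_pderiv_monomial,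
      MvPolynomial.X_mul_pderiv_monomial]
    simp only [MvPolynomial.coeff_add, MvPolynomial.coeff_smul, MvPolynomial.coeff_monomial]
    split_ifs with h
    · subst h
      simp [Finsupp.weight_apply, Finsupp.sum_fintype, Fin.sum_univ_three]
      ring
    · simp

/-- Weighted homogeneity is the eigenvector condition for the Euler derivation. -/
theorem isQuasiModular_of_wt {k : ℕ} {p : QM} (h : wt p = (k : ℚ) • p) : IsQuasiModular k p := by
  intro m hm
  have h1 := congrArg (MvPolynomial.coeff m) h
  rw [coeff_wt, MvPolynomial.coeff_smul, smul_eq_mul] at h1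
  exact_mod_cast mul_right_cancel₀ hm h1

theorem eq_zero_of_wt_neg {k : ℚ} (hk : k < 0) {p : QM} (h : wt p = k • p) : p = 0 := by
  ext m
  have h1 := congrArg (MvPolynomial.coeff m) h
  rw [coeff_wt, MvPolynomial.coeff_smul, smul_eq_mul] at h1
  by_contra hm
  have h2 := mul_right_cancel₀ hm h1
  have h3 : (0 : ℚ) ≤ (Finsupp.weight ![2, 4, 6] m : ℕ) := Nat.cast_nonneg _
  linarith

/-- The discriminant `(E₄³ - E₆²) / 1728`. -/
def disc : QM := (1 / 1728 : ℚ) • (e₄ ^ 3 - e₆ ^ 2)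

/-- The discriminant has logarithmic derivative `E₂`. -/
theorem ram_disc : ram disc = e₂ * disc := by
  have h4 : ram (e₄ ^ 3) = (3 : ℚ) • (e₄ ^ 2 * ram e₄) := by
    rw [Derivation.leibniz_pow]
    simp only [smul_eq_mul, nsmul_eq_mul]
    algebra
  have h6 : ram (e₆ ^ 2) = (2 : ℚ) • (e₆ * ram e₆) := by
    rw [Derivation.leibniz_pow]
    simp only [smul_eq_mul, nsmul_eq_mul]
    algebra
  rw [disc, Derivation.map_smul, map_sub, h4, h6, ram_e₄, ram_e₆]
  algebra

theorem wt_disc : wt disc = (12 : ℚ) • disc := by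
  rw [disc, Derivation.map_smul, map_sub, Derivation.leibniz_pow, Derivation.leibniz_pow, wt_e₄,
    wt_e₆]
  simp only [smul_eq_mul, nsmul_eq_mul]
  push_cast
  algebra

theorem derE₂_disc : MvPolynomial.pderiv 0 disc = 0 := by
  simp [disc, MvPolynomial.pderiv_X]

end EisensteinAlgebra

/-! ### The discriminant -/

section Euler

/-- The series `X^d / (1 - X^d) = ∑_{k ≥ 1} X^{dk}`. -/
def geomSeries (d : ℕ) : QSer := PowerSeries.mk fun m => if d ∣ m ∧ m ≠ 0 then 1 else 0

theorem geomSeries_mul {d : ℕ} (hd : 0 < d) :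
    (1 - PowerSeries.X ^ d) * geomSeries d = PowerSeries.X ^ d := by
  ext m
  rw [sub_mul, one_mul, map_sub, PowerSeries.coeff_X_pow_mul', PowerSeries.coeff_X_pow]
  simp only [geomSeries, PowerSeries.coeff_mk]
  by_cases h : d ≤ m
  · obtain ⟨k, rfl⟩ := Nat.exists_eq_add_of_le h
    have h1 : d ∣ d + k ↔ d ∣ k := by simp
    by_cases hk : k = 0
    · subst hk; simp [hd.ne']
    · simp [h1, hk]
  · have h1 : ¬ (d ∣ m ∧ m ≠ 0) := fun ⟨h2, h3⟩ => h (Nat.le_of_dvd (Nat.pos_of_ne_zero h3) h2)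
    have h2 : m ≠ d := by omega
    simp [h1, h, h2]

/-- The finite product `∏_{k ≤ N} (1 - X^k)`. -/
def eulerPartial (N : ℕ) : QSer := ∏ k ∈ Finset.range N, (1 - (PowerSeries.X : QSer) ^ (k + 1))

theorem coeff_eulerPartial {n N : ℕ} (h : n ≤ N) :
    PowerSeries.coeff n (eulerPartial N) = PowerSeries.coeff n eulerProd := by
  induction N, h using Nat.le_induction with
  | base => simp [eulerProd, eulerPartial]
  | succ N hN ih =>
    rw [← ih, eulerPartial, Finset.prod_range_succ, mul_sub, mul_one, map_sub,
      PowerSeries.coeff_mul_X_pow', if_neg (by omega), sub_zero, eulerPartial]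

theorem qDeriv_eulerPartial (N : ℕ) : qDeriv (eulerPartial N) =
    -(∑ k ∈ Finset.range N, ((k + 1 : ℕ) : QSer) * geomSeries (k + 1)) * eulerPartial N := by
  induction N with
  | zero => simp [eulerPartial]
  | succ N ih =>
    have h1 : eulerPartial (N + 1) = eulerPartial N * (1 - PowerSeries.X ^ (N + 1)) := by
      rw [eulerPartial, Finset.prod_range_succ, eulerPartial]
    rw [h1, Derivation.leibniz, ih, Finset.sum_range_succ, map_sub, Derivation.map_one_eq_zero,
      Derivation.leibniz_pow, qDeriv_X]
    have := geomSeries_mul (Nat.succ_pos N)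
    simp only [smul_eq_mul, nsmul_eq_mul, Nat.succ_eq_add_one, Nat.add_sub_cancel] at this ⊢
    linear_combination (((N + 1 : ℕ) : QSer) * eulerPartial N) * this

/-- The Lambert series `∑ k Xᵏ / (1 - Xᵏ)` has the divisor sums `σ₁(n)` as coefficients. -/
theorem coeff_sum_geomSeries {n N : ℕ} (h : n ≤ N) :
    PowerSeries.coeff n (∑ k ∈ Finset.range N, ((k + 1 : ℕ) : QSer) * geomSeries (k + 1)) =
      ArithmeticFunction.sigma 1 n := by
  have h0 : ∀ (d : ℕ) (f : QSer), PowerSeries.coeff n ((d : QSer) * f) =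
      d * PowerSeries.coeff n f := fun d f => by
    rw [← nsmul_eq_mul, map_nsmul, nsmul_eq_mul]
  rw [map_sum]
  simp only [h0, geomSeries, PowerSeries.coeff_mk, ArithmeticFunction.sigma_one_apply]
  rcases Nat.eq_zero_or_pos n with rfl | hn
  · simp
  · have h1 : n.divisors = ((Finset.range N).filter (fun k => k + 1 ∣ n)).image (· + 1) := by
      ext d
      simp only [Nat.mem_divisors, Finset.mem_image, Finset.mem_filter, Finset.mem_range]
      constructor
      · rintro ⟨hd, -⟩
        have := Nat.pos_of_dvd_of_pos hd hn
        have h2 := Nat.le_of_dvd hn hd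
        exact ⟨d - 1, ⟨by omega, by rwa [Nat.sub_add_cancel this]⟩, by omega⟩
      · rintro ⟨k, ⟨-, hk⟩, rfl⟩
        exact ⟨hk, hn.ne'⟩
    rw [h1, Finset.sum_image (fun a _ b _ h => by simpa using h), Finset.sum_filter]
    push_cast
    refine Finset.sum_congr rfl fun k _ => ?_
    simp [hn.ne']

/-- The logarithmic derivative of Euler's product is `(E₂ - 1) / 24`. -/
theorem qDeriv_eulerProd : qDeriv eulerProd =
    (1 / 24 : ℚ) • (eisenstein 2 - 1) * eulerProd := by
  have hs : ∀ n, PowerSeries.coeff n ((1 / 24 : ℚ) • (eisenstein 2 - 1)) =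
      -(ArithmeticFunction.sigma 1 n : ℚ) := by
    intro n
    rw [PowerSeries.coeff_smul, map_sub, eisenstein, PowerSeries.coeff_mk, PowerSeries.coeff_one,
      show bernoulli 2 = 1 / 6 by decide +kernel]
    split_ifs with h
    · simp [h]
    · norm_num; ring
  ext n
  have h1 := congrArg (PowerSeries.coeff n) (qDeriv_eulerPartial n)
  rw [coeff_qDeriv, coeff_eulerPartial le_rfl, PowerSeries.coeff_mul] at h1
  rw [coeff_qDeriv, h1, PowerSeries.coeff_mul]
  refine Finset.sum_congr rfl fun p hp => ?_
  have hp' := Finset.HasAntidiagonal.mem_antidiagonal.mp hp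
  rw [hs, map_neg, coeff_sum_geomSeries (by omega), coeff_eulerPartial (by omega)]

theorem constantCoeff_eulerProd : PowerSeries.constantCoeff eulerProd = 1 := by
  rw [← PowerSeries.coeff_zero_eq_constantCoeff_apply, eulerProd]
  simp

theorem qDeriv_eta24 : qDeriv eta24 = eisenstein 2 * eta24 := by
  rw [eta24, Derivation.leibniz, Derivation.leibniz_pow, qDeriv_eulerProd, qDeriv_X]
  simp only [smul_eq_mul, nsmul_eq_mul, Algebra.smul_mul_assoc]
  push_cast
  algebra

/-- Solutions of `q f' = E₂ f` are determined by their coefficient of `q`. -/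
theorem eq_of_qDeriv_eq_E₂_mul {f g : QSer} (hf : qDeriv f = eisenstein 2 * f)
    (hg : qDeriv g = eisenstein 2 * g) (h1 : PowerSeries.coeff 1 f = PowerSeries.coeff 1 g) :
    f = g := by
  rw [← sub_eq_zero]
  set u := f - g with hu
  have hd : qDeriv u = eisenstein 2 * u := by rw [hu, map_sub, hf, hg]; ring
  have hu1 : PowerSeries.coeff 1 u = 0 := by rw [hu, map_sub, h1, sub_self]
  ext n
  rw [map_zero]
  induction n using Nat.strong_induction_on with
  | _ n ih =>
    by_cases h : n = 1
    · rw [h, hu1]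
    · have h2 := congrArg (PowerSeries.coeff n) hd
      rw [coeff_qDeriv, PowerSeries.coeff_mul, Finset.sum_eq_single (0, n)] at h2
      · simp only [PowerSeries.coeff_zero_eq_constantCoeff, constantCoeff_eisenstein] at h2
        have h3 : ((n : ℚ) - 1) * PowerSeries.coeff n u = 0 := by linear_combination h2
        refine (mul_eq_zero.mp h3).resolve_left ?_
        rw [← ne_eq, sub_ne_zero]
        exact_mod_cast h
      · intro p hp hp0
        have hp' := Finset.HasAntidiagonal.mem_antidiagonal.mp hp
        rw [ih p.2, mul_zero]
        by_contra hc
        exact hp0 (Prod.ext (by simp; omega) (by simp; omega))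
      · intro h; simp at h

/-- The discriminant has the `q`-expansion `η²⁴`: both are solutions `q + ⋯` of `q f' = E₂ f`. -/
theorem qexp_disc : qexp disc = eta24 := by
  refine eq_of_qDeriv_eq_E₂_mul ?_ qDeriv_eta24 ?_
  · rw [← qexp_ram, ram_disc, map_mul, qexp_e₂]
  · have h4 : PowerSeries.coeff 1 (eisenstein 4) = 240 := by
      rw [eisenstein, PowerSeries.coeff_mk, show bernoulli 4 = -1 / 30 by decide +kernel]
      norm_num
    have h6 : PowerSeries.coeff 1 (eisenstein 6) = -504 := by
      rw [eisenstein, PowerSeries.coeff_mk, show bernoulli 6 = 1 / 42 by decide +kernel]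
      norm_num
    rw [disc, map_smul, map_sub, map_pow, map_pow, qexp_e₄, qexp_e₆, eta24,
      PowerSeries.coeff_succ_X_mul]
    simp [pow_succ, PowerSeries.coeff_mul, Finset.Nat.antidiagonal_succ, h4, h6,
      constantCoeff_eisenstein, constantCoeff_eulerProd]
    norm_num

theorem disc_ne_zero : disc ≠ 0 := by
  intro h
  have h1 := congrArg (PowerSeries.coeff 1) qexp_disc
  rw [h, map_zero, eta24, PowerSeries.coeff_succ_X_mul] at h1
  simp [constantCoeff_eulerProd] at h1

end Euler

/-! ### The Picard-Fuchs system in modular coordinates -/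

section ModularSystem

/-- The differential ring in which the Picard-Fuchs system is solved: two commuting derivations,
`D₁` (Ramanujan's derivation, twisted along `Y`) and `D₂ = Y d/dY`, on a ring that contains
`E₂, E₄, E₆` and the variable `Y`. The fields state only what the operators below need, so that
polynomials in a logarithm and power series in `z₁`, `z₂` are further instances. -/
structure ModularSystem (S : Type*) [CommRing S] [Algebra ℚ S] where
  D₁ : Derivation ℚ S S
  D₂ : Derivation ℚ S S
  E₂ : S
  E₄ : S
  E₆ : S
  Y : S
  comm : ∀ a, D₁ (D₂ a) = D₂ (D₁ a)
  D₁E₂ : D₁ E₂ = (1 / 12 : ℚ) • (E₂ * E₂ - E₄)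
  D₁E₄ : D₁ E₄ = (1 / 3 : ℚ) • (E₂ * E₄ - E₆)
  D₁E₆ : D₁ E₆ = (1 / 2 : ℚ) • (E₂ * E₆ - E₄ * E₄)
  D₂E₂ : D₂ E₂ = 0
  D₂E₄ : D₂ E₄ = 0
  D₂E₆ : D₂ E₆ = 0
  D₁Y : D₁ Y = (-(3 / 2) : ℚ) • (E₂ * Y)
  D₂Y : D₂ Y = Y

namespace ModularSystem

variable {S : Type*} [CommRing S] [Algebra ℚ S] (𝒮 : ModularSystem S)

/-- The first order factors of the operator on the right hand side of the second Picard-Fuchs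
equation. -/
def op (k : ℚ) (w : S) : S :=
  𝒮.E₄ * 𝒮.D₁ w - (3 / 2 : ℚ) • (𝒮.E₆ * 𝒮.D₂ w) +
    ((1 / 12 - k / 2) • (𝒮.E₂ * 𝒮.E₄) - (1 / 12 + k / 2) • 𝒮.E₆) * w

/-- The operator into which `op` turns when it is moved past `box`. -/
def op' (k : ℚ) (w : S) : S := 𝒮.op k w + (1 / 6 : ℚ) • ((𝒮.E₂ * 𝒮.E₄ - 𝒮.E₆) * w)

/-- `D₁ - (k / 2) E₂`. -/
def conn (k : ℚ) (w : S) : S := 𝒮.D₁ w - (k / 2) • (𝒮.E₂ * w)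

/-- The second order operator `(D₁ - (k/2) E₂)² - (9/4) E₄ (D₂ + k/3)²`; for `k = 0` it is the
first Picard-Fuchs operator in modular coordinates. -/
def box (k : ℚ) (w : S) : S :=
  𝒮.conn k (𝒮.conn k w) -
    (9 / 4 : ℚ) • (𝒮.E₄ * (𝒮.D₂ (𝒮.D₂ w) + (2 * k / 3) • 𝒮.D₂ w + (k ^ 2 / 9) • w))

/-- The commutation relation behind the compatibility of the two Picard-Fuchs equations. -/
theorem op'_box (k : ℚ) (w : S) : 𝒮.op' (k + 1) (𝒮.box k w) = 𝒮.box (k + 1) (𝒮.op k w) := by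
  simp only [op', op, box, conn, map_add, map_sub, Derivation.leibniz, map_rat_smul, smul_eq_mul,
    𝒮.D₁E₂, 𝒮.D₁E₄, 𝒮.D₁E₆, 𝒮.D₂E₂, 𝒮.D₂E₄, 𝒮.D₂E₆, 𝒮.comm, mul_zero, add_zero, map_zero]
  algebra

/-- Multiplication by `Y` shifts the parameter of `box` by `3`. -/
theorem box_Y_mul (w : S) : 𝒮.box 0 (𝒮.Y * w) = 𝒮.Y * 𝒮.box 3 w := by
  simp only [box, conn, map_add, map_sub, Derivation.leibniz, map_rat_smul, smul_eq_mul,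
    𝒮.D₁E₂, 𝒮.D₁Y, 𝒮.D₂Y]
  algebra

theorem box_D₂ (w : S) : 𝒮.box 0 (𝒮.D₂ w) = 𝒮.D₂ (𝒮.box 0 w) := by
  simp only [box, conn, map_add, map_sub, Derivation.leibniz, map_rat_smul, smul_eq_mul,
    𝒮.comm, 𝒮.D₂E₂, 𝒮.D₂E₄, mul_zero, add_zero]
  algebra

/-- The operator `op 2 ∘ op 1 ∘ op 0`. -/
def cubic (w : S) : S := 𝒮.op 2 (𝒮.op 1 (𝒮.op 0 w))

/-- The second Picard-Fuchs equation in modular coordinates. -/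
def Solves (w : S) : Prop := 𝒮.D₂ (𝒮.D₂ (𝒮.D₂ w)) = 𝒮.Y * 𝒮.cubic w

/-- The first Picard-Fuchs operator maps solutions of the second equation to solutions of an
equation of the same shape. -/
theorem Solves.box {w : S} (h : 𝒮.Solves w) :
    𝒮.D₂ (𝒮.D₂ (𝒮.D₂ (𝒮.box 0 w))) = 𝒮.Y * 𝒮.op' 3 (𝒮.op' 2 (𝒮.op' 1 (𝒮.box 0 w))) := by
  have h0 := 𝒮.op'_box 0 w
  have h1 := 𝒮.op'_box 1 (𝒮.op 0 w)
  have h2 := 𝒮.op'_box 2 (𝒮.op 1 (𝒮.op 0 w))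
  norm_num at h0 h1 h2
  rw [h0, h1, h2, ← box_Y_mul, ← box_D₂, ← box_D₂, ← box_D₂]
  exact congrArg _ h

end ModularSystem

/-- A modular system with the derivations `W` (the weight, with `Y` of weight `-18`) and
`del = ∂/∂E₂`, subject to the commutation relations of `sl₂`. -/
structure GradedSystem (S : Type*) [CommRing S] [Algebra ℚ S] extends ModularSystem S where
  W : Derivation ℚ S S
  del : Derivation ℚ S S
  WE₂ : W E₂ = (2 : ℚ) • E₂
  WE₄ : W E₄ = (4 : ℚ) • E₄
  WE₆ : W E₆ = (6 : ℚ) • E₆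
  WY : W Y = (-18 : ℚ) • Y
  delE₂ : del E₂ = 1
  delE₄ : del E₄ = 0
  delE₆ : del E₆ = 0
  delY : del Y = 0
  W_D₁ : ∀ a, W (D₁ a) = D₁ (W a) + (2 : ℚ) • D₁ a
  W_D₂ : ∀ a, W (D₂ a) = D₂ (W a)
  del_D₁ : ∀ a, del (D₁ a) = D₁ (del a) + (1 / 12 : ℚ) • W a
  del_D₂ : ∀ a, del (D₂ a) = D₂ (del a)
  W_del : ∀ a, W (del a) = del (W a) - (2 : ℚ) • del a

namespace GradedSystem

variable {S : Type*} [CommRing S] [Algebra ℚ S] (𝒮 : GradedSystem S)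

/-- The operators `op k` have weight `6`. -/
theorem W_op (k : ℚ) (w : S) : 𝒮.W (𝒮.op k w) = 𝒮.op k (𝒮.W w) + (6 : ℚ) • 𝒮.op k w := by
  simp only [ModularSystem.op, map_add, map_sub, Derivation.leibniz, map_rat_smul, smul_eq_mul,
    𝒮.WE₂, 𝒮.WE₄, 𝒮.WE₆, 𝒮.W_D₁, 𝒮.W_D₂]
  algebra

/-- The commutator of `∂/∂E₂` with `op k`. The correction term vanishes if `w` has weight
`6 k - 1`; on weight `6 k`, which occurs for solutions of weight `0`, it is `E₄ w / 12`. -/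
theorem del_op (k : ℚ) (w : S) : 𝒮.del (𝒮.op k w) = 𝒮.op k (𝒮.del w) +
    𝒮.E₄ * ((1 / 12 : ℚ) • 𝒮.W w + (1 / 12 - k / 2) • w) := by
  simp only [ModularSystem.op, map_add, map_sub, Derivation.leibniz, map_rat_smul, smul_eq_mul,
    𝒮.delE₂, 𝒮.delE₄, 𝒮.delE₆, 𝒮.del_D₁, 𝒮.del_D₂]
  algebra

theorem W_cubic (w : S) : 𝒮.W (𝒮.cubic w) = 𝒮.cubic (𝒮.W w) + (18 : ℚ) • 𝒮.cubic w := by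
  have h : ∀ (k r : ℚ) (v w : S), 𝒮.op k (v + r • w) = 𝒮.op k v + r • 𝒮.op k w := by
    intro k r v w
    simp only [ModularSystem.op, map_add, map_rat_smul]
    algebra
  simp only [ModularSystem.cubic, W_op, h]
  algebra

/-- The equation `Solves` is homogeneous, since `cubic` has weight `18` and `Y` has weight `-18`. -/
theorem solves_W {w : S} (h : 𝒮.Solves w) : 𝒮.Solves (𝒮.W w) := by
  have h1 := congrArg 𝒮.W h
  rw [𝒮.W_D₂, 𝒮.W_D₂, 𝒮.W_D₂, Derivation.leibniz, W_cubic, 𝒮.WY] at h1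
  rw [ModularSystem.Solves, h1]
  simp only [smul_eq_mul]
  algebra

/-- On solutions of weight `0`, applying `∂/∂E₂` to the cubic operator produces correction terms
of the shape `E₄ * _` only. -/
theorem del_cubic {w : S} (hW : 𝒮.W w = 0) : 𝒮.del (𝒮.cubic w) =
    𝒮.op 2 (𝒮.op 1 (𝒮.op 0 (𝒮.del w) + (1 / 12 : ℚ) • (𝒮.E₄ * w)) +
      (1 / 12 : ℚ) • (𝒮.E₄ * 𝒮.op 0 w)) + (1 / 12 : ℚ) • (𝒮.E₄ * 𝒮.op 1 (𝒮.op 0 w)) := by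
  have h0 : ∀ k, 𝒮.op k 0 = 0 := fun k => by simp [ModularSystem.op]
  have h1 : 𝒮.W (𝒮.op 0 w) = (6 : ℚ) • 𝒮.op 0 w := by rw [W_op, hW, h0, zero_add]
  have h2 : 𝒮.W (𝒮.op 1 (𝒮.op 0 w)) = (12 : ℚ) • 𝒮.op 1 (𝒮.op 0 w) := by
    rw [W_op, h1]
    simp only [ModularSystem.op, map_rat_smul]
    algebra
  rw [ModularSystem.cubic, del_op, del_op, del_op, hW, h1, h2]
  congr 2
  · congr 1
    · congr 1
      algebra
    · algebra
  · algebra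

/-- The second derivative with respect to `E₂` of a solution of weight `0` is a solution. -/
theorem solves_del_del {w : S} (hW : 𝒮.W w = 0) (h : 𝒮.Solves w) :
    𝒮.Solves (𝒮.del (𝒮.del w)) := by
  have h0 : ∀ k, 𝒮.op k 0 = 0 := fun k => by simp [ModularSystem.op]
  have hs : ∀ (k r : ℚ) (v : S), 𝒮.op k (r • v) = r • 𝒮.op k v := by
    intro k r v
    simp only [ModularSystem.op, map_rat_smul]
    algebra
  have h1 : 𝒮.W (𝒮.op 0 w) = (6 : ℚ) • 𝒮.op 0 w := by rw [W_op, hW, h0, zero_add]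
  have h2 : 𝒮.W (𝒮.op 1 (𝒮.op 0 w)) = (12 : ℚ) • 𝒮.op 1 (𝒮.op 0 w) := by
    rw [W_op, h1, hs]; algebra
  have h3 : 𝒮.W (𝒮.op 2 (𝒮.op 1 (𝒮.op 0 w))) = (18 : ℚ) • 𝒮.op 2 (𝒮.op 1 (𝒮.op 0 w)) := by
    rw [W_op, h2, hs]; algebra
  -- the corrections of the first and the second differentiation cancel
  have step : ∀ (k : ℚ) (v : S), 𝒮.W v = (6 * k) • v →
      𝒮.del (𝒮.del (𝒮.op k v)) = 𝒮.op k (𝒮.del (𝒮.del v)) := by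
    intro k v hv
    have hd : 𝒮.W (𝒮.del v) = (6 * k - 2) • 𝒮.del v := by
      rw [𝒮.W_del, hv, map_rat_smul]; algebra
    rw [del_op, map_add, del_op, Derivation.leibniz, 𝒮.delE₄, map_add, map_rat_smul, map_rat_smul,
      hv, map_rat_smul, hd]
    simp only [smul_eq_mul]
    algebra
  have s0 := step 0 w (by rw [hW]; simp)
  have s1 := step 1 (𝒮.op 0 w) (by rw [h1]; norm_num)
  have s2 := step 2 (𝒮.op 1 (𝒮.op 0 w)) (by rw [h2]; norm_num)
  have h4 := congrArg (fun v => 𝒮.del (𝒮.del v)) h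
  simp only [𝒮.del_D₂, Derivation.leibniz, 𝒮.delY, add_zero, smul_eq_mul,
    mul_zero] at h4
  rw [ModularSystem.Solves, h4, ModularSystem.cubic, s2, s1, s0, ModularSystem.cubic]

end GradedSystem

end ModularSystem

/-! ### Adjoining a logarithm -/

section Logarithm

/-- The extension of a derivation of `S` to `S[ℓ]` acting on the coefficients. -/
def polyDer {S : Type*} [CommRing S] [Algebra ℚ S] (d : Derivation ℚ S S) :
    Derivation ℚ (Polynomial S) (Polynomial S) :=
  have hc : ∀ (p : Polynomial S) (n : ℕ),
      (p.sum fun k a => Polynomial.monomial k (d a)).coeff n = d (p.coeff n) := by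
    intro p n
    rw [Polynomial.sum, Polynomial.finsetSum_coeff]
    simp only [Polynomial.coeff_monomial]
    rw [Finset.sum_ite_eq']
    split_ifs with h
    · rfl
    · rw [Polynomial.notMem_support_iff.mp h, map_zero]
  Derivation.mk'
    { toFun := fun p => p.sum fun k a => Polynomial.monomial k (d a)
      map_add' := fun a b => by ext n; simp [hc]
      map_smul' := fun r a => by ext n; simp [hc] }
    (fun a b => by
      ext n
      simp only [LinearMap.coe_mk, AddHom.coe_mk, hc, Polynomial.coeff_mul,
        map_sum, smul_eq_mul, Polynomial.coeff_add, Derivation.leibniz, Finset.sum_add_distrib]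
      congr 1
      rw [← Finset.Nat.sum_antidiagonal_swap]
      rfl)

variable {S : Type*} [CommRing S] [Algebra ℚ S]

@[simp] theorem coeff_polyDer (d : Derivation ℚ S S) (p : Polynomial S) (n : ℕ) :
    (polyDer d p).coeff n = d (p.coeff n) := by
  change (p.sum fun k a => Polynomial.monomial k (d a)).coeff n = d (p.coeff n)
  rw [Polynomial.sum, Polynomial.finsetSum_coeff]
  simp only [Polynomial.coeff_monomial]
  rw [Finset.sum_ite_eq']
  split_ifs with h
  · rfl
  · rw [Polynomial.notMem_support_iff.mp h, map_zero]

@[simp] theorem polyDer_C (d : Derivation ℚ S S) (a : S) :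
    polyDer d (Polynomial.C a) = Polynomial.C (d a) := by
  simp [polyDer, Polynomial.sum_C_index]

@[simp] theorem polyDer_X (d : Derivation ℚ S S) : polyDer d (Polynomial.X : Polynomial S) = 0 := by
  simp [polyDer, Polynomial.sum_X_index]

/-- The derivative with respect to `ℓ`, regarded as linear over the rationals. -/
def dLog : Derivation ℚ (Polynomial S) (Polynomial S) :=
  (Polynomial.derivative' (R := S)).restrictScalars ℚ

@[simp] theorem dLog_C (a : S) : dLog (Polynomial.C a) = 0 := by
  simp [dLog]

@[simp] theorem dLog_X : dLog (Polynomial.X : Polynomial S) = 1 := by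
  simp [dLog]

theorem derivation_ext_polynomial {d d' : Derivation ℚ (Polynomial S) (Polynomial S)}
    (hC : ∀ a, d (Polynomial.C a) = d' (Polynomial.C a))
    (hX : d Polynomial.X = d' Polynomial.X) (p : Polynomial S) : d p = d' p :=
  DFunLike.congr_fun (IsLeibniz.ext_polynomial (derAdd_isLeibniz d) (derAdd_isLeibniz d') hC hX) p

/-- The system obtained by adjoining a logarithm `ℓ` with `D₂ ℓ = 1`, on which the other
derivations vanish. -/
def GradedSystem.adjoinLog (𝒮 : GradedSystem S) : GradedSystem (Polynomial S) where
  D₁ := polyDer 𝒮.D₁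
  D₂ := polyDer 𝒮.D₂ + dLog
  W := polyDer 𝒮.W
  del := polyDer 𝒮.del
  E₂ := Polynomial.C 𝒮.E₂
  E₄ := Polynomial.C 𝒮.E₄
  E₆ := Polynomial.C 𝒮.E₆
  Y := Polynomial.C 𝒮.Y
  comm a := by
    have := derivation_ext_polynomial (d := ⁅polyDer 𝒮.D₁, polyDer 𝒮.D₂ + dLog⁆) (d' := 0)
      (fun a => by simp [Derivation.commutator_apply, 𝒮.comm])
      (by simp [Derivation.commutator_apply]) a
    rw [Derivation.commutator_apply] at this
    exact sub_eq_zero.mp this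
  D₁E₂ := by rw [polyDer_C, 𝒮.D₁E₂, ← map_mul, ← map_sub, map_rat_smul]
  D₁E₄ := by rw [polyDer_C, 𝒮.D₁E₄, ← map_mul, ← map_sub, map_rat_smul]
  D₁E₆ := by rw [polyDer_C, 𝒮.D₁E₆, ← map_mul, ← map_mul, ← map_sub, map_rat_smul]
  D₂E₂ := by simp [𝒮.D₂E₂]
  D₂E₄ := by simp [𝒮.D₂E₄]
  D₂E₆ := by simp [𝒮.D₂E₆]
  D₁Y := by rw [polyDer_C, 𝒮.D₁Y, ← map_mul, map_rat_smul]
  D₂Y := by simp [𝒮.D₂Y]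
  WE₂ := by rw [polyDer_C, 𝒮.WE₂, map_rat_smul]
  WE₄ := by rw [polyDer_C, 𝒮.WE₄, map_rat_smul]
  WE₆ := by rw [polyDer_C, 𝒮.WE₆, map_rat_smul]
  WY := by rw [polyDer_C, 𝒮.WY, map_rat_smul]
  delE₂ := by simp [𝒮.delE₂]
  delE₄ := by simp [𝒮.delE₄]
  delE₆ := by simp [𝒮.delE₆]
  delY := by simp [𝒮.delY]
  W_D₁ a := by
    have := derivation_ext_polynomial (d := ⁅polyDer 𝒮.W, polyDer 𝒮.D₁⁆)
      (d' := (2 : ℚ) • polyDer 𝒮.D₁)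
      (fun a => by simp [Derivation.commutator_apply, 𝒮.W_D₁, Polynomial.smul_C])
      (by simp [Derivation.commutator_apply]) a
    rw [Derivation.commutator_apply] at this
    exact sub_eq_iff_eq_add'.mp this
  W_D₂ a := by
    have := derivation_ext_polynomial (d := ⁅polyDer 𝒮.W, polyDer 𝒮.D₂ + dLog⁆) (d' := 0)
      (fun a => by simp [Derivation.commutator_apply, 𝒮.W_D₂])
      (by simp [Derivation.commutator_apply]) a
    rw [Derivation.commutator_apply] at this
    exact sub_eq_zero.mp this
  del_D₁ a := by
    have := derivation_ext_polynomial (d := ⁅polyDer 𝒮.del, polyDer 𝒮.D₁⁆)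
      (d' := (1 / 12 : ℚ) • polyDer 𝒮.W)
      (fun a => by simp [Derivation.commutator_apply, 𝒮.del_D₁, Polynomial.smul_C])
      (by simp [Derivation.commutator_apply]) a
    rw [Derivation.commutator_apply] at this
    exact sub_eq_iff_eq_add'.mp this
  del_D₂ a := by
    have := derivation_ext_polynomial (d := ⁅polyDer 𝒮.del, polyDer 𝒮.D₂ + dLog⁆) (d' := 0)
      (fun a => by simp [Derivation.commutator_apply, 𝒮.del_D₂])
      (by simp [Derivation.commutator_apply]) a
    rw [Derivation.commutator_apply] at this
    exact sub_eq_zero.mp this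
  W_del a := by
    have := derivation_ext_polynomial (d := ⁅polyDer 𝒮.W, polyDer 𝒮.del⁆)
      (d' := (-2 : ℚ) • polyDer 𝒮.del)
      (fun a => by
        simp [Derivation.commutator_apply, 𝒮.W_del, Polynomial.smul_C])
      (by simp [Derivation.commutator_apply]) a
    rw [Derivation.commutator_apply] at this
    rw [sub_eq_iff_eq_add'.mp this, Derivation.smul_apply, neg_smul, sub_eq_add_neg]

/-- The polynomial `a ℓ + b` in the logarithm. -/
def linLog (a b : S) : Polynomial S :=
  Polynomial.C a * Polynomial.X + Polynomial.C b

theorem linLog_eq_zero {S : Type*} [CommRing S] {a b : S} (h : linLog a b = 0) : a = 0 ∧ b = 0 := by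
  have h1 := congrArg (fun p => Polynomial.coeff p 1) h
  have h0 := congrArg (fun p => Polynomial.coeff p 0) h
  simp [linLog, Polynomial.coeff_C] at h1 h0
  exact ⟨h1, h0⟩

namespace GradedSystem

variable (𝒮 : GradedSystem S) (a b : S)

theorem adjoinLog_D₁_linLog : 𝒮.adjoinLog.D₁ (linLog a b) = linLog (𝒮.D₁ a) (𝒮.D₁ b) := by
  simp [linLog, GradedSystem.adjoinLog]

theorem adjoinLog_D₂_linLog : 𝒮.adjoinLog.D₂ (linLog a b) =
    linLog (𝒮.D₂ a) (𝒮.D₂ b + a) := by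
  simp [linLog, GradedSystem.adjoinLog]
  ring

theorem adjoinLog_W_linLog : 𝒮.adjoinLog.W (linLog a b) = linLog (𝒮.W a) (𝒮.W b) := by
  simp [linLog, GradedSystem.adjoinLog]

theorem adjoinLog_del_linLog : 𝒮.adjoinLog.del (linLog a b) = linLog (𝒮.del a) (𝒮.del b) := by
  simp [linLog, GradedSystem.adjoinLog]

theorem adjoinLog_op_linLog (k : ℚ) : 𝒮.adjoinLog.op k (linLog a b) =
    linLog (𝒮.op k a) (𝒮.op k b - (3 / 2 : ℚ) • (𝒮.E₆ * a)) := by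
  rw [ModularSystem.op, adjoinLog_D₁_linLog, adjoinLog_D₂_linLog]
  simp only [GradedSystem.adjoinLog, linLog, ModularSystem.op, map_add, map_sub, map_mul,
    map_rat_smul]
  algebra

theorem adjoinLog_box_linLog : 𝒮.adjoinLog.box 0 (linLog a b) =
    linLog (𝒮.box 0 a) (𝒮.box 0 b - (9 / 2 : ℚ) • (𝒮.E₄ * 𝒮.D₂ a)) := by
  simp only [ModularSystem.box, ModularSystem.conn, zero_div, zero_smul, sub_zero, mul_zero,
    add_zero, ne_eq, OfNat.ofNat_ne_zero, not_false_eq_true, zero_pow, adjoinLog_D₁_linLog,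
    adjoinLog_D₂_linLog]
  simp only [GradedSystem.adjoinLog, linLog, map_add, map_sub, map_mul, map_rat_smul]
  algebra

end GradedSystem

end Logarithm

/-! ### Power series over the quasi-modular forms -/

section SeriesSystem

/-- The derivation `∂/∂E₂` of `ℚ[E₂, E₄, E₆]`. -/
abbrev derE₂ : Derivation ℚ QM QM := MvPolynomial.pderiv 0

/-- The relation `[∂/∂E₂, D] = W / 12`, where `D` is Ramanujan's derivation and `W` the weight. -/
theorem pderiv_ram (p : QM) : MvPolynomial.pderiv 0 (ram p) =
    ram (MvPolynomial.pderiv 0 p) + (1 / 12 : ℚ) • wt p := by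
  have h : ⁅(MvPolynomial.pderiv 0 : Derivation ℚ QM QM), ram⁆ = (1 / 12 : ℚ) • wt := by
    refine MvPolynomial.derivation_ext fun i => ?_
    rw [Derivation.commutator_apply]
    fin_cases i <;>
    · simp [MvPolynomial.pderiv_X]
      try algebra
  have h1 := DFunLike.congr_fun h p
  rw [Derivation.commutator_apply] at h1
  exact sub_eq_iff_eq_add'.mp h1

theorem wt_ram (p : QM) : wt (ram p) = ram (wt p) + (2 : ℚ) • ram p := by
  have h : ⁅wt, ram⁆ = (2 : ℚ) • ram := by
    refine MvPolynomial.derivation_ext fun i => ?_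
    rw [Derivation.commutator_apply]
    fin_cases i <;>
    · simp
      try algebra
  have h1 := DFunLike.congr_fun h p
  rw [Derivation.commutator_apply] at h1
  exact sub_eq_iff_eq_add'.mp h1

theorem wt_pderiv (p : QM) : wt (MvPolynomial.pderiv 0 p) =
    MvPolynomial.pderiv 0 (wt p) - (2 : ℚ) • MvPolynomial.pderiv 0 p := by
  have h : ⁅wt, (MvPolynomial.pderiv 0 : Derivation ℚ QM QM)⁆ =
      (-2 : ℚ) • (MvPolynomial.pderiv 0 : Derivation ℚ QM QM) := by
    refine MvPolynomial.derivation_ext fun i => ?_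
    rw [Derivation.commutator_apply]
    fin_cases i <;> simp [MvPolynomial.pderiv_X]
  have h1 := DFunLike.congr_fun h p
  rw [Derivation.commutator_apply] at h1
  rw [sub_eq_iff_eq_add'.mp h1, Derivation.smul_apply, neg_smul, sub_eq_add_neg]

theorem qDeriv_C {R : Type*} [CommRing R] (r : R) : qDeriv (PowerSeries.C r) = 0 := by
  simp [qDeriv_apply]

/-- The modular system on `ℚ[E₂, E₄, E₆]⟦Y⟧`, where `Y` has weight `-18` and logarithmic derivative
`-(3/2) E₂`. -/
def serSystem : GradedSystem (PowerSeries QM) where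
  D₁ := coeffDer ram - (3 / 2 : ℚ) • ((PowerSeries.C e₂ : PowerSeries QM) • qDerivRat)
  D₂ := qDerivRat
  W := coeffDer wt - (18 : ℚ) • qDerivRat
  del := coeffDer derE₂
  E₂ := PowerSeries.C e₂
  E₄ := PowerSeries.C e₄
  E₆ := PowerSeries.C e₆
  Y := PowerSeries.X
  comm a := by
    have := DFunLike.congr_fun (derivation_ext_powerSeries
      (d := ⁅coeffDer ram - (3 / 2 : ℚ) • ((PowerSeries.C e₂ : PowerSeries QM) • qDerivRat),
        qDerivRat⁆) (d' := 0)
      (fun a => by simp [Derivation.commutator_apply, qDeriv_C])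
      (by simp [Derivation.commutator_apply, qDeriv_C])) a
    rw [Derivation.commutator_apply] at this
    exact sub_eq_zero.mp this
  D₁E₂ := by simp [qDeriv_C, map_rat_smul]
  D₁E₄ := by simp [qDeriv_C, map_rat_smul]
  D₁E₆ := by simp [qDeriv_C, map_rat_smul]
  D₂E₂ := by simp [qDeriv_C]
  D₂E₄ := by simp [qDeriv_C]
  D₂E₆ := by simp [qDeriv_C]
  D₁Y := by simp
  D₂Y := by simp
  WE₂ := by simp [qDeriv_C, map_rat_smul]
  WE₄ := by simp [qDeriv_C, map_rat_smul]
  WE₆ := by simp [qDeriv_C, map_rat_smul]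
  WY := by simp
  delE₂ := by simp
  delE₄ := by simp [MvPolynomial.pderiv_X]
  delE₆ := by simp [MvPolynomial.pderiv_X]
  delY := by simp
  W_D₁ a := by
    have := DFunLike.congr_fun (derivation_ext_powerSeries
      (d := ⁅coeffDer wt - (18 : ℚ) • qDerivRat,
        coeffDer ram - (3 / 2 : ℚ) • ((PowerSeries.C e₂ : PowerSeries QM) • qDerivRat)⁆)
      (d' := (2 : ℚ) • (coeffDer ram -
        (3 / 2 : ℚ) • ((PowerSeries.C e₂ : PowerSeries QM) • qDerivRat)))
      (fun a => by simp [Derivation.commutator_apply, qDeriv_C, wt_ram, map_rat_smul])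
      (by
        simp [Derivation.commutator_apply, qDeriv_C, map_rat_smul]
        algebra)) a
    rw [Derivation.commutator_apply] at this
    exact sub_eq_iff_eq_add'.mp this
  W_D₂ a := by
    have := DFunLike.congr_fun (derivation_ext_powerSeries
      (d := ⁅coeffDer wt - (18 : ℚ) • qDerivRat, qDerivRat⁆) (d' := 0)
      (fun a => by simp [Derivation.commutator_apply, qDeriv_C])
      (by simp [Derivation.commutator_apply])) a
    rw [Derivation.commutator_apply] at this
    exact sub_eq_zero.mp this
  del_D₁ a := by
    have := DFunLike.congr_fun (derivation_ext_powerSeries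
      (d := ⁅coeffDer derE₂,
        coeffDer ram - (3 / 2 : ℚ) • ((PowerSeries.C e₂ : PowerSeries QM) • qDerivRat)⁆)
      (d' := (1 / 12 : ℚ) • (coeffDer wt - (18 : ℚ) • qDerivRat))
      (fun a => by simp [Derivation.commutator_apply, qDeriv_C, pderiv_ram, map_rat_smul])
      (by
        simp [Derivation.commutator_apply]
        algebra)) a
    rw [Derivation.commutator_apply] at this
    exact sub_eq_iff_eq_add'.mp this
  del_D₂ a := by
    have := DFunLike.congr_fun (derivation_ext_powerSeries
      (d := ⁅coeffDer derE₂, qDerivRat⁆) (d' := 0)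
      (fun a => by simp [Derivation.commutator_apply, qDeriv_C])
      (by simp [Derivation.commutator_apply])) a
    rw [Derivation.commutator_apply] at this
    exact sub_eq_zero.mp this
  W_del a := by
    have := DFunLike.congr_fun (derivation_ext_powerSeries
      (d := ⁅coeffDer wt - (18 : ℚ) • qDerivRat, coeffDer derE₂⁆)
      (d' := (-2 : ℚ) • coeffDer derE₂)
      (fun a => by simp [Derivation.commutator_apply, qDeriv_C, wt_pderiv, map_rat_smul])
      (by simp [Derivation.commutator_apply])) a
    rw [Derivation.commutator_apply] at this
    rw [sub_eq_iff_eq_add'.mp this, Derivation.smul_apply, neg_smul]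
    exact (sub_eq_add_neg _ _).symm

theorem coeff_op (k : ℚ) (F : PowerSeries QM) (n : ℕ) :
    PowerSeries.coeff n (serSystem.op k F) =
      e₄ * (ram (PowerSeries.coeff n F) - (3 / 2 * n : ℚ) • (e₂ * PowerSeries.coeff n F)) -
      (3 / 2 * n : ℚ) • (e₆ * PowerSeries.coeff n F) +
      ((1 / 12 - k / 2) • (e₂ * e₄) - (1 / 12 + k / 2) • e₆) * PowerSeries.coeff n F := by
  have h : ((1 / 12 - k / 2) • (PowerSeries.C e₂ * PowerSeries.C e₄) -
      (1 / 12 + k / 2) • PowerSeries.C e₆ : PowerSeries QM) =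
      PowerSeries.C ((1 / 12 - k / 2) • (e₂ * e₄) - (1 / 12 + k / 2) • e₆) := by
    rw [map_sub, map_rat_smul, map_rat_smul, map_mul]
  simp only [ModularSystem.op, serSystem]
  rw [h]
  generalize ((1 / 12 - k / 2) • (e₂ * e₄) - (1 / 12 + k / 2) • e₆ : QM) = c
  simp only [map_add, map_sub, PowerSeries.coeff_smul, PowerSeries.coeff_C_mul,
    Derivation.sub_apply, Derivation.smul_apply, coeff_coeffDer, qDerivRat_apply, coeff_qDeriv,
    smul_eq_mul]
  have h2 : ((n : ℕ) : QM) = algebraMap ℚ QM n := by simp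
  rw [h2]
  algebra

end SeriesSystem

/-! ### Uniqueness of solutions over the quasi-modular forms -/

section RecursionUniqueness

/-- The modular system on `ℚ[E₂, E₄, E₆]⟦Y⟧[ℓ]`. -/
abbrev logSystem : GradedSystem (Polynomial (PowerSeries QM)) := serSystem.adjoinLog

/-- The constant polynomial `Y ^ n`. -/
abbrev Ypow (n : ℕ) : Polynomial (PowerSeries QM) := Polynomial.C (PowerSeries.X ^ n)

/-- A derivation that preserves the ideal of `Y` preserves its powers. -/
theorem derivation_Ypow (d : Derivation ℚ (Polynomial (PowerSeries QM))
    (Polynomial (PowerSeries QM))) (hd : Ypow 1 ∣ d (Ypow 1)) (n : ℕ) : Ypow n ∣ d (Ypow n) := by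
  induction n with
  | zero => simp
  | succ n ih =>
    have h : Ypow (n + 1) = Ypow n * Ypow 1 := by
      simp only [Ypow, pow_succ, pow_zero, one_mul, map_mul]
    rw [h, Derivation.leibniz, smul_eq_mul, smul_eq_mul]
    exact dvd_add (mul_dvd_mul_left _ hd) (by rw [mul_comm]; exact mul_dvd_mul_left _ ih)

theorem Ypow_dvd_derivation {d : Derivation ℚ (Polynomial (PowerSeries QM))
    (Polynomial (PowerSeries QM))} (hd : Ypow 1 ∣ d (Ypow 1)) {n : ℕ}
    {a : Polynomial (PowerSeries QM)} (h : Ypow n ∣ a) : Ypow n ∣ d a := by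
  obtain ⟨b, rfl⟩ := h
  rw [Derivation.leibniz, smul_eq_mul, smul_eq_mul]
  exact dvd_add (dvd_mul_right _ _) (Dvd.dvd.mul_left (derivation_Ypow d hd n) _)

theorem Ypow_dvd_D₁ {n : ℕ} {a : Polynomial (PowerSeries QM)} (h : Ypow n ∣ a) :
    Ypow n ∣ logSystem.D₁ a := by
  refine Ypow_dvd_derivation ?_ h
  have := logSystem.D₁Y
  rw [Ypow, pow_one]
  rw [show logSystem.Y = Polynomial.C PowerSeries.X from rfl] at this
  rw [this, ← smul_mul_assoc]
  exact dvd_mul_left _ _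

theorem Ypow_dvd_D₂ {n : ℕ} {a : Polynomial (PowerSeries QM)} (h : Ypow n ∣ a) :
    Ypow n ∣ logSystem.D₂ a := by
  refine Ypow_dvd_derivation ?_ h
  have := logSystem.D₂Y
  rw [Ypow, pow_one]
  rw [show logSystem.Y = Polynomial.C PowerSeries.X from rfl] at this
  rw [this]

theorem dvd_rat_smul {S : Type*} [CommRing S] [Algebra ℚ S] {a b : S} (r : ℚ) (h : a ∣ b) :
    a ∣ r • b := by
  obtain ⟨c, rfl⟩ := h
  rw [← mul_smul_comm]
  exact dvd_mul_right _ _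

theorem Ypow_dvd_op (k : ℚ) {n : ℕ} {a : Polynomial (PowerSeries QM)} (h : Ypow n ∣ a) :
    Ypow n ∣ logSystem.op k a :=
  dvd_add (dvd_sub ((Ypow_dvd_D₁ h).mul_left _)
    (dvd_rat_smul _ ((Ypow_dvd_D₂ h).mul_left _))) (h.mul_left _)

theorem Ypow_dvd_op' (k : ℚ) {n : ℕ} {a : Polynomial (PowerSeries QM)} (h : Ypow n ∣ a) :
    Ypow n ∣ logSystem.op' k a :=
  dvd_add (Ypow_dvd_op k h) (dvd_rat_smul _ (h.mul_left _))

theorem coeff_logSystem_D₂ (a : Polynomial (PowerSeries QM)) (j : ℕ) :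
    (logSystem.D₂ a).coeff j = qDeriv (a.coeff j) + a.coeff (j + 1) * (j + 1) := by
  simp [logSystem, GradedSystem.adjoinLog, serSystem, dLog, Polynomial.coeff_derivative]

/-- On multiples of `Y ^ n`, `n ≥ 1`, the operator `D₂` is invertible modulo `Y ^ (n + 1)`. -/
theorem Ypow_succ_dvd_of_D₂ {n : ℕ} (hn : 1 ≤ n) {a : Polynomial (PowerSeries QM)}
    (h : Ypow n ∣ a) (h2 : Ypow (n + 1) ∣ logSystem.D₂ a) : Ypow (n + 1) ∣ a := by
  rw [Polynomial.C_dvd_iff_dvd_coeff] at h h2 ⊢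
  -- Descending induction on the power `j` of the logarithm.
  have key : ∀ i j, a.natDegree + 1 ≤ i + j → PowerSeries.X ^ (n + 1) ∣ a.coeff j := by
    intro i
    induction i with
    | zero =>
      intro j hj
      rw [Polynomial.coeff_eq_zero_of_natDegree_lt (by omega)]
      exact dvd_zero _
    | succ i ih =>
      intro j hj
      have h3 := h2 j
      rw [coeff_logSystem_D₂] at h3
      have h4 := (dvd_add_left ((ih (j + 1) (by omega)).mul_right _)).mp h3
      rw [PowerSeries.X_pow_dvd_iff] at h4 ⊢
      intro m hm
      rcases Nat.lt_succ_iff_lt_or_eq.mp hm with hm' | rfl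
      · exact (PowerSeries.X_pow_dvd_iff.mp (h j)) m hm'
      · have h5 := h4 m hm
        rw [coeff_qDeriv] at h5
        refine (mul_eq_zero.mp h5).resolve_left ?_
        exact_mod_cast Nat.one_le_iff_ne_zero.mp hn
  exact fun j => key (a.natDegree + 1) j (by omega)

/-- Uniqueness of solutions of an equation of the shape `D₂³ a = Y Φ(a)` with prescribed
`Y`-constant term. -/
theorem eq_zero_of_D₂_cube {Φ : Polynomial (PowerSeries QM) → Polynomial (PowerSeries QM)}
    (hΦ : ∀ n a, Ypow n ∣ a → Ypow n ∣ Φ a) {a : Polynomial (PowerSeries QM)} (h0 : Ypow 1 ∣ a)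
    (h : logSystem.D₂ (logSystem.D₂ (logSystem.D₂ a)) = logSystem.Y * Φ a) : a = 0 := by
  have key : ∀ n, Ypow (n + 1) ∣ a := by
    intro n
    induction n with
    | zero => exact h0
    | succ n ih =>
      have h3 : Ypow (n + 1 + 1) ∣ logSystem.D₂ (logSystem.D₂ (logSystem.D₂ a)) := by
        have : Ypow (n + 1 + 1) = logSystem.Y * Ypow (n + 1) := by
          rw [show logSystem.Y = Polynomial.C PowerSeries.X from rfl]
          simp only [Ypow, pow_succ, map_mul]
          ring
        rw [h, this]
        exact mul_dvd_mul_left _ (hΦ _ _ ih)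
      have hn : 1 ≤ n + 1 := by omega
      exact Ypow_succ_dvd_of_D₂ hn ih (Ypow_succ_dvd_of_D₂ hn (Ypow_dvd_D₂ ih)
        (Ypow_succ_dvd_of_D₂ hn (Ypow_dvd_D₂ (Ypow_dvd_D₂ ih)) h3))
  ext j : 1
  rw [Polynomial.coeff_zero]
  ext m : 1
  have h4 := (Polynomial.C_dvd_iff_dvd_coeff _ _).mp (key m) j
  rw [map_zero]
  exact PowerSeries.X_pow_dvd_iff.mp h4 m (by omega)

/-- A solution of the second Picard-Fuchs equation without `Y`-constant term vanishes. -/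
theorem logSystem_eq_zero_of_solves {a : Polynomial (PowerSeries QM)} (h0 : Ypow 1 ∣ a)
    (h : logSystem.Solves a) : a = 0 :=
  eq_zero_of_D₂_cube (Φ := logSystem.cubic)
    (fun _ _ h => Ypow_dvd_op _ (Ypow_dvd_op _ (Ypow_dvd_op _ h))) h0 h

end RecursionUniqueness

/-! ### The fundamental solution -/

section Fundamental

/-- The action of `op k` on the coefficient of `Yⁿ` of `a ℓ + b`, as a pair `(a, b)`. -/
def opPair (k : ℚ) (n : ℕ) (u : QM × QM) : QM × QM :=
  let L : QM → QM := fun a => e₄ * (ram a - (3 / 2 * n : ℚ) • (e₂ * a)) -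
    (3 / 2 * n : ℚ) • (e₆ * a) + ((1 / 12 - k / 2) • (e₂ * e₄) - (1 / 12 + k / 2) • e₆) * a
  (L u.1, L u.2 - (3 / 2 : ℚ) • (e₆ * u.1))

/-- The coefficients of `Yⁿ` in the two parts of the solution `N ℓ + M`. On `(a ℓ + b) Yⁿ` the
operator `D₂³` acts as `n³ (a ℓ + b) + 3 n² a`, which is inverted in each step. -/
def fundSeq : ℕ → QM × QM
  | 0 => (1, 0)
  | n + 1 =>
    let v := opPair 2 n (opPair 1 n (opPair 0 n (fundSeq n)))
    let a : QM := ((n + 1 : ℚ) ^ 3)⁻¹ • v.1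
    (a, ((n + 1 : ℚ) ^ 3)⁻¹ • (v.2 - (3 * (n + 1 : ℚ) ^ 2) • a))

/-- The holomorphic solution `N = 1 + ⋯`. -/
def solN : PowerSeries QM := PowerSeries.mk fun n => (fundSeq n).1

/-- The series `M` in the logarithmic solution `N ℓ + M`. -/
def solM : PowerSeries QM := PowerSeries.mk fun n => (fundSeq n).2

variable (a b : PowerSeries QM)

theorem coeff_op_pair (k : ℚ) (n : ℕ) :
    (PowerSeries.coeff n (serSystem.op k a),
      PowerSeries.coeff n (serSystem.op k b - (3 / 2 : ℚ) • (serSystem.E₆ * a))) =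
    opPair k n (PowerSeries.coeff n a, PowerSeries.coeff n b) := by
  have h : PowerSeries.coeff n (serSystem.E₆ * a) = e₆ * PowerSeries.coeff n a :=
    PowerSeries.coeff_C_mul _ _ _
  simp only [opPair, map_sub, PowerSeries.coeff_smul, coeff_op, h]

/-- `N ℓ + M` solves the second Picard-Fuchs equation. -/
theorem solves_fundamental : logSystem.Solves (linLog solN solM) := by
  rw [ModularSystem.Solves, GradedSystem.adjoinLog_D₂_linLog, GradedSystem.adjoinLog_D₂_linLog,
    GradedSystem.adjoinLog_D₂_linLog, ModularSystem.cubic, GradedSystem.adjoinLog_op_linLog,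
    GradedSystem.adjoinLog_op_linLog, GradedSystem.adjoinLog_op_linLog]
  have hY : ∀ a b : PowerSeries QM, logSystem.Y * linLog a b =
      linLog (PowerSeries.X * a) (PowerSeries.X * b) := by
    intro a b
    simp only [logSystem, GradedSystem.adjoinLog, serSystem, linLog, map_mul]
    ring
  rw [hY]
  have hD : ∀ (n : ℕ) (a : PowerSeries QM), PowerSeries.coeff n (serSystem.D₂ a) =
      (n : ℚ) • PowerSeries.coeff n a := by
    intro n a
    rw [show serSystem.D₂ a = qDeriv a from rfl, coeff_qDeriv, Nat.cast_smul_eq_nsmul,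
      nsmul_eq_mul]
  have hrec : ∀ n, opPair 2 n (opPair 1 n (opPair 0 n (fundSeq n))) =
      (((n + 1 : ℚ) ^ 3) • (fundSeq (n + 1)).1,
        ((n + 1 : ℚ) ^ 3) • (fundSeq (n + 1)).2 +
          (3 * (n + 1 : ℚ) ^ 2) • (fundSeq (n + 1)).1) := by
    intro n
    have hn : ((n + 1 : ℚ) ^ 3) ≠ 0 := by positivity
    simp only [fundSeq]
    rw [smul_inv_smul₀ hn, smul_inv_smul₀ hn, sub_add_cancel]
  have hpair : ∀ n, PowerSeries.coeff n solN = (fundSeq n).1 ∧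
      PowerSeries.coeff n solM = (fundSeq n).2 := fun n => by simp [solN, solM]
  have h3 : ∀ n, (PowerSeries.coeff n (serSystem.op 2 (serSystem.op 1 (serSystem.op 0 solN))),
      PowerSeries.coeff n (serSystem.op 2 (serSystem.op 1
        (serSystem.op 0 solM - (3 / 2 : ℚ) • (serSystem.E₆ * solN)) -
          (3 / 2 : ℚ) • (serSystem.E₆ * serSystem.op 0 solN)) -
            (3 / 2 : ℚ) • (serSystem.E₆ * serSystem.op 1 (serSystem.op 0 solN)))) =
      opPair 2 n (opPair 1 n (opPair 0 n (fundSeq n))) := by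
    intro n
    have h4 : (PowerSeries.coeff n solN, PowerSeries.coeff n solM) = fundSeq n := by
      simp [solN, solM]
    rw [← h4, ← coeff_op_pair, ← coeff_op_pair, ← coeff_op_pair]
  simp only [hrec, Prod.mk.injEq] at h3
  congr 1
  · ext1 n
    rw [hD, hD, hD]
    cases n with
    | zero => simp
    | succ n =>
      rw [PowerSeries.coeff_succ_X_mul, (h3 n).1, (hpair _).1]
      push_cast
      algebra
  · ext1 n
    simp only [hD, map_add]
    cases n with
    | zero => simp
    | succ n =>
      rw [PowerSeries.coeff_succ_X_mul, (h3 n).2, (hpair _).1, (hpair _).2]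
      push_cast
      algebra

theorem constantCoeff_solN : PowerSeries.constantCoeff solN = 1 := by
  rw [← PowerSeries.coeff_zero_eq_constantCoeff_apply]; simp [solN, fundSeq]

theorem constantCoeff_solM : PowerSeries.constantCoeff solM = 0 := by
  rw [← PowerSeries.coeff_zero_eq_constantCoeff_apply]; simp [solM, fundSeq]

theorem Ypow_one_dvd_linLog {a b : PowerSeries QM} (ha : PowerSeries.constantCoeff a = 0)
    (hb : PowerSeries.constantCoeff b = 0) : Ypow 1 ∣ linLog a b := by
  obtain ⟨a', rfl⟩ := PowerSeries.X_dvd_iff.mpr ha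
  obtain ⟨b', rfl⟩ := PowerSeries.X_dvd_iff.mpr hb
  exact ⟨linLog a' b', by
    simp only [linLog, Ypow, map_mul, pow_one]; ring⟩

/-- `N` and `M` have weight `0`: the weight derivation maps `N ℓ + M` to a solution without constant
term, which vanishes. -/
theorem W_fundamental : serSystem.W solN = 0 ∧ serSystem.W solM = 0 := by
  have h := logSystem.solves_W solves_fundamental
  rw [GradedSystem.adjoinLog_W_linLog] at h
  refine linLog_eq_zero (logSystem_eq_zero_of_solves (Ypow_one_dvd_linLog ?_ ?_) h)
  · simp [serSystem, constantCoeff_solN]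
  · simp [serSystem, constantCoeff_solM]

/-- `N` and `M` are at most linear in `E₂`: the second derivative `∂²/∂E₂²` maps `N ℓ + M` to a
solution without constant term, which vanishes. -/
theorem del_del_fundamental : serSystem.del (serSystem.del solN) = 0 ∧
    serSystem.del (serSystem.del solM) = 0 := by
  have hW : logSystem.W (linLog solN solM) = 0 := by
    rw [GradedSystem.adjoinLog_W_linLog, W_fundamental.1, W_fundamental.2]; simp [linLog]
  have h := logSystem.solves_del_del hW solves_fundamental
  rw [GradedSystem.adjoinLog_del_linLog, GradedSystem.adjoinLog_del_linLog] at h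
  refine linLog_eq_zero (logSystem_eq_zero_of_solves (Ypow_one_dvd_linLog ?_ ?_) h)
  · simp [serSystem, constantCoeff_solN]
  · simp [serSystem, constantCoeff_solM]

/-- `N ℓ + M` solves the first Picard-Fuchs equation, because its image under `box 0` solves an
equation of the shape `D₂³ a = Y Φ(a)` and has no constant term. -/
theorem box_fundamental : logSystem.box 0 (linLog solN solM) = 0 := by
  refine eq_zero_of_D₂_cube (Φ := fun a => logSystem.op' 3 (logSystem.op' 2 (logSystem.op' 1 a)))
    (fun _ _ h => Ypow_dvd_op' _ (Ypow_dvd_op' _ (Ypow_dvd_op' _ h))) ?_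
    (ModularSystem.Solves.box logSystem.toModularSystem solves_fundamental)
  rw [GradedSystem.adjoinLog_box_linLog]
  refine Ypow_one_dvd_linLog ?_ ?_
  · simp [ModularSystem.box, ModularSystem.conn, serSystem, constantCoeff_solN]
  · simp [ModularSystem.box, ModularSystem.conn, serSystem, constantCoeff_solM]

end Fundamental

/-! ### Homomorphisms and the second solution -/

section Homomorphisms

/-- A ring homomorphism between modular systems that respects all the structure. -/
structure SystemHom {S T : Type*} [CommRing S] [CommRing T] [Algebra ℚ S] [Algebra ℚ T]
    (𝒮 : ModularSystem S) (𝒯 : ModularSystem T) extends S →+* T where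
  map_D₁ : ∀ a, toRingHom (𝒮.D₁ a) = 𝒯.D₁ (toRingHom a)
  map_D₂ : ∀ a, toRingHom (𝒮.D₂ a) = 𝒯.D₂ (toRingHom a)
  map_E₂ : toRingHom 𝒮.E₂ = 𝒯.E₂
  map_E₄ : toRingHom 𝒮.E₄ = 𝒯.E₄
  map_E₆ : toRingHom 𝒮.E₆ = 𝒯.E₆
  map_Y : toRingHom 𝒮.Y = 𝒯.Y

variable {S T : Type*} [CommRing S] [CommRing T] [Algebra ℚ S] [Algebra ℚ T]

namespace SystemHom

variable {𝒮 : ModularSystem S} {𝒯 : ModularSystem T} (φ : SystemHom 𝒮 𝒯)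

theorem map_op (k : ℚ) (w : S) : φ.toRingHom (𝒮.op k w) = 𝒯.op k (φ.toRingHom w) := by
  simp only [ModularSystem.op, map_add, map_sub, map_mul, map_rat_smul, φ.map_D₁, φ.map_D₂,
    φ.map_E₂, φ.map_E₄, φ.map_E₆]

theorem map_box (w : S) : φ.toRingHom (𝒮.box 0 w) = 𝒯.box 0 (φ.toRingHom w) := by
  simp only [ModularSystem.box, ModularSystem.conn, map_add, map_sub, map_mul, map_rat_smul,
    φ.map_D₁, φ.map_D₂, φ.map_E₂, φ.map_E₄]

theorem map_solves {w : S} (h : 𝒮.Solves w) : 𝒯.Solves (φ.toRingHom w) := by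
  have h1 := congrArg φ.toRingHom h
  rw [map_mul] at h1
  simpa only [ModularSystem.Solves, ModularSystem.cubic, map_op, φ.map_D₂, φ.map_Y] using h1

end SystemHom

namespace SystemHom

variable {𝒮 : GradedSystem S} {𝒯 : ModularSystem T} (φ : SystemHom 𝒮.toModularSystem 𝒯) (t : T)

/-- For a solution `w` of weight `0`, the second solution `t w + 12 ∂w/∂E₂`, where `D₁ t = 1`. -/
def lift (w : S) : T := t * φ.toRingHom w + (12 : ℚ) • φ.toRingHom (𝒮.del w)

variable {t}

/-- On weight `6 k` the operator `op k` commutes with the lift: the term `E₄ w` that comes from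
`D₁ t = 1` cancels the commutator of `op k` with `12 ∂/∂E₂`. -/
theorem op_lift (h1 : 𝒯.D₁ t = 1) (h2 : 𝒯.D₂ t = 0) (k : ℚ) {w : S}
    (hw : 𝒮.W w = (6 * k) • w) : 𝒯.op k (φ.lift t w) = φ.lift t (𝒮.op k w) := by
  have h3 := 𝒮.del_op k w
  rw [hw] at h3
  have h4 : 𝒯.op k (φ.lift t w) = t * φ.toRingHom (𝒮.op k w) + 𝒯.E₄ * φ.toRingHom w +
      (12 : ℚ) • φ.toRingHom (𝒮.op k (𝒮.del w)) := by
    rw [map_op, map_op]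
    simp only [ModularSystem.op, lift, map_add, Derivation.leibniz, map_rat_smul, h1, h2,
      smul_eq_mul, mul_zero, add_zero]
    algebra
  rw [h4, lift, h3, map_add, map_mul, map_add, map_rat_smul, map_rat_smul, map_rat_smul,
    φ.map_E₄]
  algebra

theorem lift_D₂ (h2 : 𝒯.D₂ t = 0) (w : S) : 𝒯.D₂ (φ.lift t w) = φ.lift t (𝒮.D₂ w) := by
  simp only [lift, map_add, Derivation.leibniz, map_rat_smul, h2, smul_eq_mul, mul_zero, add_zero,
    𝒮.del_D₂, φ.map_D₂]

/-- The lift of a solution of weight `0` of the second Picard-Fuchs equation is a solution. -/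
theorem lift_solves (h1 : 𝒯.D₁ t = 1) (h2 : 𝒯.D₂ t = 0) {w : S} (hW : 𝒮.W w = 0)
    (h : 𝒮.Solves w) : 𝒯.Solves (φ.lift t w) := by
  have h0 : ∀ k, 𝒮.op k 0 = 0 := fun k => by simp [ModularSystem.op]
  have hs : ∀ (k r : ℚ) (v : S), 𝒮.op k (r • v) = r • 𝒮.op k v := by
    intro k r v
    simp only [ModularSystem.op, map_rat_smul]
    algebra
  have w1 : 𝒮.W (𝒮.op 0 w) = (6 : ℚ) • 𝒮.op 0 w := by
    rw [GradedSystem.W_op, hW, h0, zero_add]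
  have w2 : 𝒮.W (𝒮.op 1 (𝒮.op 0 w)) = (12 : ℚ) • 𝒮.op 1 (𝒮.op 0 w) := by
    rw [GradedSystem.W_op, w1, hs]; algebra
  rw [ModularSystem.Solves, φ.lift_D₂ h2, φ.lift_D₂ h2, φ.lift_D₂ h2, ModularSystem.cubic,
    φ.op_lift h1 h2 0 (by rw [hW]; simp), φ.op_lift h1 h2 1 (by rw [w1]; norm_num),
    φ.op_lift h1 h2 2 (by rw [w2]; norm_num), h, ModularSystem.cubic]
  simp only [lift, Derivation.leibniz, 𝒮.delY, map_mul, φ.map_Y, smul_eq_mul, mul_zero, add_zero]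
  algebra

/-- The lift of a solution of weight `0` of the first Picard-Fuchs equation is a solution. -/
theorem lift_box (h1 : 𝒯.D₁ t = 1) (h2 : 𝒯.D₂ t = 0) {w : S} (hW : 𝒮.W w = 0)
    (h : 𝒮.box 0 w = 0) : 𝒯.box 0 (φ.lift t w) = 0 := by
  have key : 𝒯.box 0 (φ.lift t w) = φ.lift t (𝒮.box 0 w) := by
    simp only [ModularSystem.box, ModularSystem.conn, lift, map_add, map_sub, Derivation.leibniz,
      map_rat_smul, h1, h2, 𝒮.del_D₁, 𝒮.del_D₂, 𝒮.W_D₁, 𝒮.delE₂, 𝒮.delE₄, hW, smul_eq_mul,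
      mul_zero, add_zero, φ.map_D₁, φ.map_D₂, φ.map_E₂, φ.map_E₄, map_mul, map_zero,
      Derivation.map_one_eq_zero]
    algebra
  rw [key, h, lift]
  simp

end SystemHom

end Homomorphisms

/-! ### The displacement of the modular parameter -/

section Divisibility

/-- `N` solves the second Picard-Fuchs equation. -/
theorem solves_solN : serSystem.Solves solN := by
  have h := solves_fundamental
  rw [ModularSystem.Solves, GradedSystem.adjoinLog_D₂_linLog, GradedSystem.adjoinLog_D₂_linLog,
    GradedSystem.adjoinLog_D₂_linLog, ModularSystem.cubic, GradedSystem.adjoinLog_op_linLog,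
    GradedSystem.adjoinLog_op_linLog, GradedSystem.adjoinLog_op_linLog] at h
  have h1 := congrArg (fun p => Polynomial.coeff p 1) h
  simp only [linLog, logSystem, GradedSystem.adjoinLog, Polynomial.coeff_add,
    Polynomial.coeff_C_mul, Polynomial.coeff_C, Polynomial.coeff_X, one_ne_zero,
    if_true, if_false, mul_one, add_zero] at h1
  exact h1

theorem box_solN : serSystem.box 0 solN = 0 := by
  have h := box_fundamental
  rw [GradedSystem.adjoinLog_box_linLog] at h
  exact (linLog_eq_zero h).1

/-- `E₄` divides `∂N/∂E₂`: modulo `E₄`, the derivative satisfies a homogeneous recursion with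
initial value `0`. -/
theorem e₄_dvd_coeff_del_solN (n : ℕ) : e₄ ∣ PowerSeries.coeff n (serSystem.del solN) := by
  have hop : ∀ (k : ℚ) (F : PowerSeries QM) (n : ℕ), e₄ ∣ PowerSeries.coeff n F →
      e₄ ∣ PowerSeries.coeff n (serSystem.op k F) := by
    intro k F n h
    rw [coeff_op]
    exact dvd_add (dvd_sub (dvd_mul_right _ _) (dvd_rat_smul _ (h.mul_left _))) (h.mul_left _)
  have hE : ∀ (F : PowerSeries QM) (n : ℕ),
      e₄ ∣ PowerSeries.coeff n ((1 / 12 : ℚ) • (serSystem.E₄ * F)) := by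
    intro F n
    rw [PowerSeries.coeff_smul]
    refine dvd_rat_smul _ ?_
    rw [show serSystem.E₄ = PowerSeries.C e₄ from rfl, PowerSeries.coeff_C_mul]
    exact dvd_mul_right _ _
  induction n with
  | zero => simp [serSystem, constantCoeff_solN]
  | succ n ih =>
    have h := congrArg serSystem.del solves_solN
    rw [serSystem.del_D₂, serSystem.del_D₂, serSystem.del_D₂, Derivation.leibniz, serSystem.delY,
      serSystem.del_cubic W_fundamental.1, smul_zero, add_zero, smul_eq_mul] at h
    have h1 := congrArg (PowerSeries.coeff (n + 1)) h
    rw [show serSystem.Y = PowerSeries.X from rfl, PowerSeries.coeff_succ_X_mul] at h1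
    have hD : ∀ (a : PowerSeries QM), PowerSeries.coeff (n + 1) (serSystem.D₂ a) =
        (n + 1 : ℚ) • PowerSeries.coeff (n + 1) a := by
      intro a
      rw [show serSystem.D₂ a = qDeriv a from rfl, coeff_qDeriv, ← nsmul_eq_mul,
        ← Nat.cast_smul_eq_nsmul ℚ]
      push_cast
      rfl
    rw [hD, hD, hD] at h1
    have hdvd : e₄ ∣ (n + 1 : ℚ) • (n + 1 : ℚ) • (n + 1 : ℚ) •
        PowerSeries.coeff (n + 1) (serSystem.del solN) := by
      rw [h1, map_add]
      refine dvd_add (hop _ _ _ ?_) (hE _ _)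
      rw [map_add]
      refine dvd_add (hop _ _ _ ?_) (hE _ _)
      rw [map_add]
      exact dvd_add (hop _ _ _ ih) (hE _ _)
    have hn : (n + 1 : ℚ) ≠ 0 := by positivity
    have := dvd_rat_smul (n + 1 : ℚ)⁻¹ (dvd_rat_smul (n + 1 : ℚ)⁻¹
      (dvd_rat_smul (n + 1 : ℚ)⁻¹ hdvd))
    rwa [inv_smul_smul₀ hn, inv_smul_smul₀ hn, inv_smul_smul₀ hn] at this

/-- The inverse of `N`. -/
def solNinv : PowerSeries QM := PowerSeries.invOfUnit solN 1

theorem solN_mul_inv : solN * solNinv = 1 :=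
  PowerSeries.mul_invOfUnit _ _ (by simp [constantCoeff_solN])

/-- The displacement `δ = 12 (∂N/∂E₂) / N` between the modular parameters `t̃` and `t₁ = t̃ + δ`. -/
def delta : PowerSeries QM := (12 : ℚ) • (serSystem.del solN * solNinv)

/-- The displacement is divisible by `E₄`. This makes the ratio of `E₄` at the two parameters a
power series over the quasi-modular forms. -/
theorem exists_delta_eq : ∃ ε : PowerSeries QM, PowerSeries.constantCoeff ε = 0 ∧
    delta = PowerSeries.C e₄ * ε := by
  choose h hh using e₄_dvd_coeff_del_solN
  have hH : serSystem.del solN = PowerSeries.C e₄ * PowerSeries.mk h := by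
    ext1 n
    rw [PowerSeries.coeff_C_mul, PowerSeries.coeff_mk, hh]
  refine ⟨(12 : ℚ) • (PowerSeries.mk h * solNinv), ?_, ?_⟩
  · have h0 := congrArg PowerSeries.constantCoeff hH
    have h1 : PowerSeries.constantCoeff (serSystem.del solN) = 0 := by
      simp [serSystem, constantCoeff_solN]
    rw [h1, map_mul, PowerSeries.constantCoeff_C] at h0
    have h2 := (mul_eq_zero.mp h0.symm).resolve_left (MvPolynomial.X_ne_zero _)
    rw [map_rat_smul, map_mul, h2, zero_mul, smul_zero]
  · rw [delta, hH]; algebra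

theorem constantCoeff_delta : PowerSeries.constantCoeff delta = 0 := by
  obtain ⟨ε, h0, h⟩ := exists_delta_eq
  rw [h, map_mul, h0, mul_zero]

theorem del_solNinv : serSystem.del solNinv =
    -(serSystem.del solN * solNinv ^ 2) := by
  have h := congrArg serSystem.del solN_mul_inv
  rw [Derivation.leibniz, Derivation.map_one_eq_zero, smul_eq_mul, smul_eq_mul] at h
  linear_combination solNinv * h - (serSystem.del solNinv) * solN_mul_inv

theorem W_solNinv : serSystem.W solNinv = 0 := by
  have h := congrArg serSystem.W solN_mul_inv
  rw [Derivation.leibniz, Derivation.map_one_eq_zero, smul_eq_mul, smul_eq_mul,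
    W_fundamental.1] at h
  linear_combination solNinv * h - (serSystem.W solNinv) * solN_mul_inv

/-- This is where the linearity of `N` in `E₂` enters. -/
theorem del_delta : serSystem.del delta = (-(1 / 12) : ℚ) • (delta * delta) := by
  rw [delta, map_rat_smul, Derivation.leibniz, del_solNinv, del_del_fundamental.1]
  simp only [smul_eq_mul]
  algebra

theorem W_delta : serSystem.W delta = (-2 : ℚ) • delta := by
  rw [delta, map_rat_smul, Derivation.leibniz, W_solNinv, serSystem.W_del, W_fundamental.1,
    map_zero]
  simp only [smul_eq_mul]
  algebra

end Divisibility

/-! ### Taylor series of a derivation -/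

section Taylor

variable {K : Type*} [CommRing K] [Algebra ℚ K]

/-- The coefficient `dⁿ a / n!` of the Taylor series. -/
def taylorCoeff (d : Derivation ℚ K K) (n : ℕ) (a : K) : K := ((n.factorial : ℚ)⁻¹) • d^[n] a

theorem taylorCoeff_succ (d : Derivation ℚ K K) (n : ℕ) (a : K) :
    (n + 1 : ℚ) • taylorCoeff d (n + 1) a = taylorCoeff d n (d a) := by
  rw [taylorCoeff, taylorCoeff, Function.iterate_succ_apply, smul_smul, Nat.factorial_succ]
  have := Nat.factorial_pos n
  congr 1
  push_cast
  field_simp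

theorem taylorCoeff_add (d : Derivation ℚ K K) (n : ℕ) (a b : K) :
    taylorCoeff d n (a + b) = taylorCoeff d n a + taylorCoeff d n b := by
  rw [taylorCoeff, iterate_map_add, smul_add]; rfl

theorem coeff_succ_rat (F : PowerSeries K) (n : ℕ) :
    (n + 1 : ℚ) • PowerSeries.coeff (n + 1) F =
      PowerSeries.coeff n (PowerSeries.derivative K F) := by
  rw [PowerSeries.coeff_derivative]
  have : ((n : K) + 1) = algebraMap ℚ K (n + 1) := by simp
  rw [this, Algebra.smul_def, mul_comm]

theorem smul_rat_cancel {n : ℕ} {a b : K} (h : (n + 1 : ℚ) • a = (n + 1 : ℚ) • b) : a = b := by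
  have hn : (n + 1 : ℚ) ≠ 0 := by positivity
  have := congrArg ((n + 1 : ℚ)⁻¹ • ·) h
  simpa only [inv_smul_smul₀ hn] using this

/-- The Taylor homomorphism `a ↦ ∑ dⁿ a / n! Xⁿ`, the flow of the derivation `d`. -/
def taylor (d : Derivation ℚ K K) : K →+* PowerSeries K where
  toFun a := PowerSeries.mk fun n => taylorCoeff d n a
  map_zero' := by
    ext n; simp [taylorCoeff]
  map_one' := by
    ext n
    cases n with
    | zero => simp [taylorCoeff]
    | succ n =>
      rw [PowerSeries.coeff_mk, PowerSeries.coeff_one, if_neg (Nat.succ_ne_zero n)]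
      refine smul_rat_cancel (n := n) ?_
      rw [taylorCoeff_succ, Derivation.map_one_eq_zero, taylorCoeff]
      simp
  map_add' a b := by
    ext n; simp [taylorCoeff_add]
  map_mul' a b := by
    ext n
    induction n generalizing a b with
    | zero => simp [taylorCoeff]
    | succ n ih =>
      refine smul_rat_cancel (n := n) ?_
      have hd : ∀ a, PowerSeries.derivative K (PowerSeries.mk fun n => taylorCoeff d n a) =
          PowerSeries.mk fun n => taylorCoeff d n (d a) := by
        intro a
        ext n
        rw [← coeff_succ_rat, PowerSeries.coeff_mk, PowerSeries.coeff_mk, taylorCoeff_succ]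
      rw [coeff_succ_rat, coeff_succ_rat, hd, Derivation.leibniz, Derivation.leibniz, hd, hd]
      simp only [smul_eq_mul, map_add, ← ih, PowerSeries.coeff_mk, taylorCoeff_add]

theorem coeff_taylor (d : Derivation ℚ K K) (a : K) (n : ℕ) :
    PowerSeries.coeff n (taylor d a) = taylorCoeff d n a := by
  simp [taylor]

@[simp] theorem constantCoeff_taylor (d : Derivation ℚ K K) (a : K) :
    PowerSeries.constantCoeff (taylor d a) = a := by
  rw [← PowerSeries.coeff_zero_eq_constantCoeff_apply, coeff_taylor]
  simp [taylorCoeff]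

theorem derivative_taylor (d : Derivation ℚ K K) (a : K) :
    PowerSeries.derivative K (taylor d a) = taylor d (d a) := by
  ext n
  rw [← coeff_succ_rat, coeff_taylor, coeff_taylor, taylorCoeff_succ]

/-- The commutator of the weight with the flow of Ramanujan's derivation. -/
theorem wt_taylor (p : QM) : coeffDer wt (taylor ram p) =
    taylor ram (wt p) + (2 : ℚ) • (PowerSeries.X * taylor ram (ram p)) := by
  ext1 n
  rw [coeff_coeffDer, coeff_taylor, map_add, coeff_taylor, PowerSeries.coeff_smul]
  induction n generalizing p with
  | zero => simp [taylorCoeff]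
  | succ n ih =>
    refine smul_rat_cancel (n := n) ?_
    rw [← map_rat_smul wt, taylorCoeff_succ, ih, PowerSeries.coeff_succ_X_mul, coeff_taylor,
      wt_ram, taylorCoeff_add]
    have h2 : taylorCoeff ram n ((2 : ℚ) • ram p) = (2 : ℚ) • taylorCoeff ram n (ram p) := by
      have : (2 : ℚ) • ram p = ram p + ram p := two_smul _ _
      rw [this, taylorCoeff_add, two_smul]
    have h3 : PowerSeries.coeff n (PowerSeries.X * taylor ram (ram (ram p))) =
        (n : ℚ) • taylorCoeff ram n (ram p) := by
      cases n with
      | zero => simp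
      | succ n =>
        rw [PowerSeries.coeff_succ_X_mul, coeff_taylor]
        push_cast
        rw [taylorCoeff_succ]
    rw [h2, h3, smul_add, taylorCoeff_succ]
    algebra

/-- The commutator of `∂/∂E₂` with the flow of Ramanujan's derivation, from the `sl₂` relations
between the three derivations. -/
theorem pderiv_taylor (p : QM) : coeffDer derE₂ (taylor ram p) =
    taylor ram (derE₂ p) + (1 / 12 : ℚ) • (PowerSeries.X * taylor ram (wt p) +
      PowerSeries.X ^ 2 * taylor ram (ram p)) := by
  ext1 n
  rw [coeff_coeffDer, coeff_taylor]
  induction n generalizing p with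
  | zero => simp [taylorCoeff]
  | succ n ih =>
    refine smul_rat_cancel (n := n) ?_
    rw [← map_rat_smul derE₂, taylorCoeff_succ, ih, coeff_succ_rat]
    congr 1
    have hr : ∀ (r : ℚ) (a : PowerSeries QM), PowerSeries.derivative QM (r • a) =
        r • PowerSeries.derivative QM a := fun r a => map_rat_smul _ r a
    have h2 : taylor ram (wt (ram p)) =
        taylor ram (ram (wt p)) + (2 : ℚ) • taylor ram (ram p) := by
      rw [wt_ram, map_add, map_rat_smul]
    have h3 : taylor ram (derE₂ (ram p)) =
        taylor ram (ram (derE₂ p)) + (1 / 12 : ℚ) • taylor ram (wt p) := by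
      rw [pderiv_ram, map_add, map_rat_smul]
    have h4 : PowerSeries.derivative QM (PowerSeries.X * taylor ram (wt p)) =
        taylor ram (wt p) + PowerSeries.X * taylor ram (ram (wt p)) := by
      rw [Derivation.leibniz, PowerSeries.derivative_X, derivative_taylor, smul_eq_mul, smul_eq_mul,
        mul_one, add_comm]
    have h5 : PowerSeries.derivative QM (PowerSeries.X ^ 2 * taylor ram (ram p)) =
        2 * (PowerSeries.X * taylor ram (ram p)) +
          PowerSeries.X ^ 2 * taylor ram (ram (ram p)) := by
      rw [pow_two, Derivation.leibniz, Derivation.leibniz, PowerSeries.derivative_X,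
        derivative_taylor]
      simp only [smul_eq_mul]
      ring
    rw [map_add, hr, map_add, derivative_taylor, h2, h3, h4, h5]
    generalize taylor ram (ram (derE₂ p)) = a1
    generalize taylor ram (wt p) = a2
    generalize taylor ram (ram (wt p)) = a3
    generalize taylor ram (ram p) = a4
    generalize taylor ram (ram (ram p)) = a5
    algebra

end Taylor

/-! ### Invertible substitutions -/

section Bijectivity

variable {K : Type*} [CommRing K]

/-- A ring endomorphism of `K⟦X⟧` that preserves constant terms and rescales `X` by a series
`1 + ⋯` is bijective: it is the identity up to terms of higher order. -/
theorem bijective_of_constantCoeff (Ψ : PowerSeries K →+* PowerSeries K)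
    (hC : ∀ a, PowerSeries.constantCoeff (Ψ a) = PowerSeries.constantCoeff a)
    {u : PowerSeries K} (hu : PowerSeries.constantCoeff u = 1)
    (hX : Ψ PowerSeries.X = PowerSeries.X * u) : Function.Bijective Ψ := by
  have hpow : ∀ n b, Ψ (PowerSeries.X ^ n * b) = PowerSeries.X ^ n * (u ^ n * Ψ b) := by
    intro n b
    rw [map_mul, map_pow, hX, mul_pow, mul_assoc]
  -- `Ψ - id` raises the order
  have hT : ∀ n a, PowerSeries.X ^ n ∣ a → PowerSeries.X ^ (n + 1) ∣ a - Ψ a := by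
    rintro n _ ⟨b, rfl⟩
    rw [hpow, ← mul_sub, pow_succ]
    refine mul_dvd_mul_left _ (PowerSeries.X_dvd_iff.mpr ?_)
    rw [map_sub, map_mul, map_pow, hu, hC, one_pow, one_mul, sub_self]
  have hzero : ∀ a : PowerSeries K, (∀ n, PowerSeries.X ^ n ∣ a) → a = 0 := by
    intro a h
    ext n
    rw [map_zero]
    exact PowerSeries.X_pow_dvd_iff.mp (h (n + 1)) n (Nat.lt_succ_self n)
  constructor
  · rw [injective_iff_map_eq_zero]
    intro a ha
    refine hzero a fun n => ?_
    induction n with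
    | zero => simp
    | succ n ih => simpa [ha] using hT n a ih
  · intro a
    -- The iteration `s ↦ s + (a - Ψ s)` converges to a preimage of `a`.
    let s : ℕ → PowerSeries K := fun n => Nat.rec 0 (fun _ t => t + (a - Ψ t)) n
    have hs : ∀ n, s (n + 1) = s n + (a - Ψ (s n)) := fun n => rfl
    have hs1 : ∀ n, PowerSeries.X ^ n ∣ a - Ψ (s n) := by
      intro n
      induction n with
      | zero => simp
      | succ n ih =>
        have h := hT n _ ih
        rw [map_sub] at h
        rw [hs, map_add, map_sub]
        convert h using 1
        ring
    have hs2 : ∀ n k, PowerSeries.X ^ n ∣ s (n + k) - s n := by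
      intro n k
      induction k with
      | zero => simp
      | succ k ih =>
        have h1 : s (n + (k + 1)) - s n = (a - Ψ (s (n + k))) + (s (n + k) - s n) := by
          rw [← add_assoc n k 1, hs]; ring
        rw [h1]
        exact dvd_add ((pow_dvd_pow _ (Nat.le_add_right n k)).trans (hs1 _)) ih
    set g : PowerSeries K := PowerSeries.mk fun n => PowerSeries.coeff n (s (n + 1)) with hg
    have hgs : ∀ n, PowerSeries.X ^ n ∣ g - s n := by
      intro n
      rw [PowerSeries.X_pow_dvd_iff]
      intro m hm
      obtain ⟨k, rfl⟩ := Nat.exists_eq_add_of_le (Nat.succ_le_of_lt hm)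
      have h := PowerSeries.X_pow_dvd_iff.mp (hs2 (m + 1) k) m (Nat.lt_succ_self m)
      rw [map_sub, sub_eq_zero] at h
      rw [map_sub, hg, PowerSeries.coeff_mk, ← Nat.succ_eq_add_one] at *
      rw [h, sub_self]
    refine ⟨g, (sub_eq_zero.mp (hzero _ fun n => ?_)).symm⟩
    have h1 : a - Ψ g = (a - Ψ (s n)) - Ψ (g - s n) := by rw [map_sub]; ring
    rw [h1]
    refine dvd_sub (hs1 n) ?_
    obtain ⟨b, hb⟩ := hgs n
    rw [hb, hpow]
    exact dvd_mul_right _ _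

end Bijectivity

/-! ### Transport of quasi-modular forms -/

section Displacement

/-- Evaluation of a power series over `ℚ[E₂, E₄, E₆]` at the displacement `δ`. -/
def evalDelta : PowerSeries QM →+* PowerSeries QM :=
  evalHom (σ := Unit) (A := QM) PowerSeries.C delta constantCoeff_delta

@[simp] theorem evalDelta_C (k : QM) : evalDelta (PowerSeries.C k) = PowerSeries.C k :=
  evalHom_C (σ := Unit) (A := QM) _ _ k

@[simp] theorem evalDelta_X : evalDelta PowerSeries.X = delta :=
  evalHom_X (σ := Unit) (A := QM) _ _

theorem constantCoeff_evalDelta (a : PowerSeries QM) :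
    PowerSeries.constantCoeff (evalDelta a) = PowerSeries.constantCoeff a := by
  refine (constantCoeff_evalHom (σ := Unit) (A := QM) PowerSeries.C constantCoeff_delta a).trans ?_
  exact PowerSeries.constantCoeff_C _

theorem derivation_evalDelta (d : Derivation ℚ (PowerSeries QM) (PowerSeries QM))
    (d₀ : Derivation ℚ QM QM) (h : ∀ k, d (PowerSeries.C k) = PowerSeries.C (d₀ k))
    (a : PowerSeries QM) : d (evalDelta a) =
      evalDelta (coeffDer d₀ a) + evalDelta (PowerSeries.derivative QM a) * d delta := by
  have := IsLeibniz.ext_powerSeries (σ := Unit) (A := QM) (φ := evalDelta)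
    (d := (derAdd d).comp evalDelta.toAddMonoidHom)
    (d' := evalDelta.toAddMonoidHom.comp (derAdd (coeffDer d₀)) +
      (AddMonoidHom.mulRight (d delta)).comp
        (evalDelta.toAddMonoidHom.comp (derAdd (PowerSeries.derivative QM))))
    (fun x y => by simp)
    (fun x y => by
      simp
      ring)
    (by rw [evalDelta_X]; exact constantCoeff_delta)
    (fun k => by simp [h])
    (by simp)
  exact DFunLike.congr_fun this a

/-- The Taylor shift of a quasi-modular form by the displacement `δ`. -/
def PsiK : QM →+* PowerSeries QM := evalDelta.comp (taylor ram)

theorem constantCoeff_PsiK (p : QM) : PowerSeries.constantCoeff (PsiK p) = p := by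
  rw [PsiK, RingHom.comp_apply, constantCoeff_evalDelta, constantCoeff_taylor]

theorem W_C (p : QM) : serSystem.W (PowerSeries.C p) = PowerSeries.C (wt p) := by
  simp [serSystem, qDeriv_C]

theorem del_C (p : QM) : serSystem.del (PowerSeries.C p) = PowerSeries.C (derE₂ p) := by
  simp [serSystem]

theorem W_PsiK (p : QM) : serSystem.W (PsiK p) = PsiK (wt p) := by
  rw [PsiK, RingHom.comp_apply, derivation_evalDelta serSystem.W wt W_C, wt_taylor,
    derivative_taylor, map_add, map_rat_smul, map_mul, evalDelta_X, W_delta, RingHom.comp_apply]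
  generalize evalDelta (taylor ram (wt p)) = a
  generalize evalDelta (taylor ram (ram p)) = b
  generalize delta = x
  algebra

/-- The derivation `∂/∂E₂ - (δ / 12) W`, into which the Taylor shift transforms `∂/∂E₂`. -/
def delShift : Derivation ℚ (PowerSeries QM) (PowerSeries QM) :=
  serSystem.del - (1 / 12 : ℚ) • (delta • serSystem.W)

theorem delShift_apply (a : PowerSeries QM) : delShift a =
    serSystem.del a - (1 / 12 : ℚ) • (delta * serSystem.W a) := rfl

/-- The transformation of `∂/∂E₂` by the shift: the corrections from `pderiv_taylor` are absorbed by
the derivative `∂δ/∂E₂ = -δ² / 12` and by the term `(δ / 12) W`. -/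
theorem delShift_PsiK (p : QM) : delShift (PsiK p) = PsiK (derE₂ p) := by
  rw [delShift_apply, W_PsiK]
  simp only [PsiK, RingHom.comp_apply]
  rw [derivation_evalDelta serSystem.del derE₂ del_C, pderiv_taylor, derivative_taylor, del_delta]
  simp only [map_add, map_mul, map_pow, map_rat_smul, evalDelta_X]
  generalize evalDelta (taylor ram (wt p)) = a
  generalize evalDelta (taylor ram (ram p)) = b
  generalize evalDelta (taylor ram (derE₂ p)) = c
  generalize delta = x
  algebra

/-- The shift multiplies `E₄` by a power series, since `E₄` divides `δ`. -/
theorem exists_PsiK_e₄ : ∃ V : PowerSeries QM, PowerSeries.constantCoeff V = 1 ∧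
    PsiK e₄ = PowerSeries.C e₄ * V := by
  obtain ⟨ε, h0, h⟩ := exists_delta_eq
  have h1 := PowerSeries.eq_X_mul_shift_add_const (taylor ram e₄)
  rw [constantCoeff_taylor] at h1
  refine ⟨1 + ε * evalDelta (PowerSeries.mk fun n => PowerSeries.coeff (n + 1) (taylor ram e₄)),
    by simp [h0], ?_⟩
  rw [PsiK, RingHom.comp_apply]
  conv_lhs => rw [h1]
  rw [map_add, map_mul, evalDelta_X, evalDelta_C, h]
  ring

/-- The shift multiplies the discriminant by a power series, since the discriminant divides its own
derivatives. -/
theorem exists_PsiK_disc : ∃ V : PowerSeries QM, PowerSeries.constantCoeff V = 1 ∧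
    PsiK disc = PowerSeries.C disc * V := by
  have h1 : ∀ n, disc ∣ PowerSeries.coeff n (taylor ram disc) := by
    intro n
    rw [coeff_taylor, taylorCoeff]
    refine dvd_rat_smul _ ?_
    induction n with
    | zero => simp
    | succ n ih =>
      rw [Function.iterate_succ_apply']
      obtain ⟨b, hb⟩ := ih
      rw [hb, Derivation.leibniz, ram_disc, smul_eq_mul, smul_eq_mul]
      exact ⟨ram b + b * e₂, by ring⟩
  choose g hg using h1
  have h2 : taylor ram disc = PowerSeries.C disc * PowerSeries.mk g := by
    ext1 n
    rw [PowerSeries.coeff_C_mul, PowerSeries.coeff_mk, hg]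
  refine ⟨evalDelta (PowerSeries.mk g), ?_, ?_⟩
  · have h3 := congrArg PowerSeries.constantCoeff h2
    rw [constantCoeff_taylor, map_mul, PowerSeries.constantCoeff_C] at h3
    rw [constantCoeff_evalDelta]
    exact mul_left_cancel₀ disc_ne_zero (by rw [← h3, mul_one])
  · rw [PsiK, RingHom.comp_apply, h2, map_mul, evalDelta_C]

/-- The ratio of `E₄` at the shifted and at the original point. -/
def ratE₄ : PowerSeries QM := exists_PsiK_e₄.choose

theorem constantCoeff_ratE₄ : PowerSeries.constantCoeff ratE₄ = 1 :=
  exists_PsiK_e₄.choose_spec.1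

theorem PsiK_e₄ : PsiK e₄ = PowerSeries.C e₄ * ratE₄ := exists_PsiK_e₄.choose_spec.2

/-- The ratio of the discriminants at the shifted and at the original point. -/
def ratDisc : PowerSeries QM := exists_PsiK_disc.choose

theorem constantCoeff_ratDisc : PowerSeries.constantCoeff ratDisc = 1 :=
  exists_PsiK_disc.choose_spec.1

theorem PsiK_disc : PsiK disc = PowerSeries.C disc * ratDisc := exists_PsiK_disc.choose_spec.2

theorem C_ne_zero {k : QM} (h : k ≠ 0) : (PowerSeries.C k : PowerSeries QM) ≠ 0 := by
  intro h1
  have := congrArg PowerSeries.constantCoeff h1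
  rw [PowerSeries.constantCoeff_C, map_zero] at this
  exact h this

/-- If the Taylor shift multiplies a modular form `k` of weight `r` by `V`, then `V` has
weight `0` and logarithmic derivative `r δ / 12`. -/
theorem derivations_ratio {k : QM} (hk : k ≠ 0) {r : ℚ} (hw : wt k = r • k) (hd : derE₂ k = 0)
    {V : PowerSeries QM} (h : PsiK k = PowerSeries.C k * V) :
    serSystem.W V = 0 ∧ delShift V = (r / 12) • (delta * V) := by
  have h1 := W_PsiK k
  have h2 := delShift_PsiK k
  rw [hw, map_rat_smul, h, Derivation.leibniz, W_C, hw, map_rat_smul] at h1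
  rw [hd, map_zero, h, Derivation.leibniz, delShift_apply (PowerSeries.C k), W_C, del_C, hd, hw,
    map_rat_smul, map_zero] at h2
  simp only [smul_eq_mul] at h1 h2
  constructor
  · refine mul_left_cancel₀ (C_ne_zero hk) ?_
    linear_combination (norm := algebra) h1
  · refine mul_left_cancel₀ (C_ne_zero hk) ?_
    linear_combination (norm := algebra) h2

theorem derivation_serLog (d : Derivation ℚ (PowerSeries QM) (PowerSeries QM))
    {V a : PowerSeries QM} (hV : PowerSeries.constantCoeff V = 1) (h : d V = a * V) :
    d (serLog (σ := Unit) (A := QM) V) = a := by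
  have h0 := const_serLog (σ := Unit) (A := QM) hV
  have h1 := IsLeibniz.serExp (σ := Unit) (τ := Unit) (A := QM) (B := QM)
    (derAdd_isLeibniz d) h0 h0
  rw [serExp_serLog (σ := Unit) (A := QM) hV] at h1
  have hne : V ≠ 0 := by
    rintro rfl
    simp at hV
  refine mul_left_cancel₀ hne ?_
  refine Eq.trans ?_ (h.trans (mul_comm _ _))
  exact h1.symm

theorem constantCoeff_serLog_unit {V : PowerSeries QM} (hV : PowerSeries.constantCoeff V = 1) :
    PowerSeries.constantCoeff (serLog (σ := Unit) (A := QM) V) = 0 :=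
  const_serLog (σ := Unit) (A := QM) hV

/-- The logarithm of `ratE₄`. -/
def logE₄ : PowerSeries QM := serLog (σ := Unit) (A := QM) ratE₄

/-- The logarithm of `ratDisc`. -/
def logDisc : PowerSeries QM := serLog (σ := Unit) (A := QM) ratDisc

theorem constantCoeff_logE₄ : PowerSeries.constantCoeff logE₄ = 0 :=
  constantCoeff_serLog_unit constantCoeff_ratE₄

theorem constantCoeff_logDisc : PowerSeries.constantCoeff logDisc = 0 :=
  constantCoeff_serLog_unit constantCoeff_ratDisc

theorem W_logE₄ : serSystem.W logE₄ = 0 := by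
  refine derivation_serLog _ constantCoeff_ratE₄ ?_
  rw [zero_mul]
  exact (derivations_ratio (MvPolynomial.X_ne_zero _) wt_e₄ (by simp [MvPolynomial.pderiv_X])
    PsiK_e₄).1

theorem delShift_logE₄ : delShift logE₄ = (1 / 3 : ℚ) • delta := by
  refine derivation_serLog _ constantCoeff_ratE₄ ?_
  rw [(derivations_ratio (MvPolynomial.X_ne_zero _) wt_e₄ (by simp [MvPolynomial.pderiv_X])
    PsiK_e₄).2, smul_mul_assoc]
  norm_num

theorem W_logDisc : serSystem.W logDisc = 0 := by
  refine derivation_serLog _ constantCoeff_ratDisc ?_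
  rw [zero_mul]
  exact (derivations_ratio disc_ne_zero wt_disc derE₂_disc PsiK_disc).1

theorem delShift_logDisc : delShift logDisc = delta := by
  refine derivation_serLog _ constantCoeff_ratDisc ?_
  rw [(derivations_ratio disc_ne_zero wt_disc derE₂_disc PsiK_disc).2]
  norm_num

end Displacement

/-! ### The shift of power series over the quasi-modular forms -/

section Shift

/-- The exponential of a power series over `ℚ[E₂, E₄, E₆]`. -/
def expY (a : PowerSeries QM) : PowerSeries QM := serExp (σ := Unit) (A := QM) a

theorem constantCoeff_expY {a : PowerSeries QM} (h : PowerSeries.constantCoeff a = 0) :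
    PowerSeries.constantCoeff (expY a) = 1 := const_serExp (σ := Unit) (A := QM) h

theorem derivation_expY (d : Derivation ℚ (PowerSeries QM) (PowerSeries QM)) {a : PowerSeries QM}
    (h : PowerSeries.constantCoeff a = 0) : d (expY a) = expY a * d a :=
  IsLeibniz.serExp (σ := Unit) (τ := Unit) (A := QM) (B := QM) (derAdd_isLeibniz d) h h

/-- The image of `Y` under the shift. The factor `E₄(t̃)^{9/2} / E₄(t₁)^{9/2}` turns
`Y = z₂ / ((1 - 432 z₁) E₄(q̃)^{3/2})³` into `Z`. -/
def shiftY : PowerSeries QM := PowerSeries.X * expY (-(9 / 2 : ℚ) • logE₄)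

theorem constantCoeff_smul_logE₄ : PowerSeries.constantCoeff (-(9 / 2 : ℚ) • logE₄) = 0 := by
  rw [map_rat_smul, constantCoeff_logE₄, smul_zero]

theorem constantCoeff_shiftY : PowerSeries.constantCoeff shiftY = 0 := by simp [shiftY]

theorem W_X : serSystem.W PowerSeries.X = (-18 : ℚ) • PowerSeries.X := serSystem.WY

theorem del_X : serSystem.del PowerSeries.X = 0 := serSystem.delY

theorem W_shiftY : serSystem.W shiftY = (-18 : ℚ) • shiftY := by
  rw [shiftY, Derivation.leibniz, derivation_expY _ constantCoeff_smul_logE₄, map_rat_smul,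
    W_logE₄, W_X]
  simp only [smul_zero, mul_zero, zero_add, smul_eq_mul]
  algebra

theorem delShift_shiftY : delShift shiftY = 0 := by
  rw [shiftY, Derivation.leibniz, derivation_expY _ constantCoeff_smul_logE₄, map_rat_smul,
    delShift_logE₄, delShift_apply PowerSeries.X, W_X, del_X]
  simp only [smul_eq_mul]
  algebra

/-- The shift of `ℚ[E₂, E₄, E₆]⟦Y⟧`: it expresses functions of the modular parameter of the
fibre at the shifted point `t₁ = t̃ + δ`, and of `Z`, by functions of `t̃` and `Y`. -/
def Psi : PowerSeries QM →+* PowerSeries QM :=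
  evalHom (σ := Unit) (A := QM) PsiK shiftY constantCoeff_shiftY

@[simp] theorem Psi_C (k : QM) : Psi (PowerSeries.C k) = PsiK k :=
  evalHom_C (σ := Unit) (A := QM) _ _ k

@[simp] theorem Psi_X : Psi PowerSeries.X = shiftY := evalHom_X (σ := Unit) (A := QM) _ _

theorem constantCoeff_Psi (a : PowerSeries QM) :
    PowerSeries.constantCoeff (Psi a) = PowerSeries.constantCoeff a := by
  refine (constantCoeff_evalHom (σ := Unit) (A := QM) PsiK constantCoeff_shiftY a).trans ?_
  exact constantCoeff_PsiK _

theorem Psi_bijective : Function.Bijective Psi :=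
  bijective_of_constantCoeff Psi constantCoeff_Psi
    (constantCoeff_expY constantCoeff_smul_logE₄) Psi_X

theorem W_Psi (a : PowerSeries QM) : serSystem.W (Psi a) = Psi (serSystem.W a) := by
  have := IsLeibniz.ext_powerSeries (σ := Unit) (A := QM) (φ := Psi)
    (d := (derAdd serSystem.W).comp Psi.toAddMonoidHom)
    (d' := Psi.toAddMonoidHom.comp (derAdd serSystem.W))
    (fun x y => by simp) (fun x y => by simp)
    (by rw [Psi_X]; exact constantCoeff_shiftY)
    (fun k => by simp [W_C, W_PsiK])
    (by simp [W_X, W_shiftY, map_rat_smul])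
  exact DFunLike.congr_fun this a

/-- The shift transforms `∂/∂E₂` into `∂/∂E₂ - (δ / 12) W`. -/
theorem delShift_Psi (a : PowerSeries QM) : delShift (Psi a) = Psi (serSystem.del a) := by
  have := IsLeibniz.ext_powerSeries (σ := Unit) (A := QM) (φ := Psi)
    (d := (derAdd delShift).comp Psi.toAddMonoidHom)
    (d' := Psi.toAddMonoidHom.comp (derAdd serSystem.del))
    (fun x y => by simp) (fun x y => by simp)
    (by rw [Psi_X]; exact constantCoeff_shiftY)
    (fun k => by simp [del_C, delShift_PsiK])
    (by simp [del_X, delShift_shiftY])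
  exact DFunLike.congr_fun this a

end Shift

/-! ### The series for Z, Q and the prepotential -/

section ModularData

/-- `log (Q / Z)`, as a function of the modular parameter `t̃` and of `Y`. -/
def logRatio : PowerSeries QM :=
  -(3 / 2 : ℚ) • logDisc + (9 / 2 : ℚ) • logE₄ + solM * solNinv

theorem constantCoeff_logRatio : PowerSeries.constantCoeff logRatio = 0 := by
  simp only [logRatio, map_add, map_rat_smul, map_mul, constantCoeff_logDisc, constantCoeff_logE₄,
    constantCoeff_solM, smul_zero, zero_mul, add_zero]

/-- `log (Q / Z)` as a power series in `Z` over the quasi-modular forms of the parameter `t₁`. -/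
def fSer : PowerSeries QM := (Psi_bijective.2 logRatio).choose

theorem Psi_fSer : Psi fSer = logRatio := (Psi_bijective.2 logRatio).choose_spec

theorem constantCoeff_fSer : PowerSeries.constantCoeff fSer = 0 := by
  rw [← constantCoeff_Psi, Psi_fSer, constantCoeff_logRatio]

theorem W_solM_mul : serSystem.W (solM * solNinv) = 0 := by
  rw [Derivation.leibniz, W_fundamental.2, W_solNinv, smul_zero, smul_zero, add_zero]

theorem W_fSer : serSystem.W fSer = 0 := by
  apply Psi_bijective.1
  rw [← W_Psi, Psi_fSer, map_zero, logRatio, map_add, map_add, map_rat_smul, map_rat_smul,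
    W_logDisc, W_logE₄, W_solM_mul, smul_zero, smul_zero, add_zero, add_zero]

/-- The derivative of `log (Q / Z)` with respect to `E₂`. The contributions `(9/2) (δ / 3)` of `E₄`
and `-(3/2) δ` of the discriminant cancel. -/
theorem Psi_del_fSer : Psi (serSystem.del fSer) = serSystem.del (solM * solNinv) := by
  rw [← delShift_Psi, Psi_fSer, logRatio, map_add, map_add, map_rat_smul, map_rat_smul,
    delShift_logDisc, delShift_logE₄, delShift_apply, W_solM_mul]
  algebra

/-- `Q` as a power series in `Z` over the quasi-modular forms. -/
def qSer : PowerSeries QM := PowerSeries.X * expY fSer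

theorem constantCoeff_qSer : PowerSeries.constantCoeff qSer = 0 := by simp [qSer]

/-- The substitution of `Q`, as a power series in `Z`, for the variable. -/
def Theta : PowerSeries QM →+* PowerSeries QM :=
  evalHom (σ := Unit) (A := QM) PowerSeries.C qSer constantCoeff_qSer

@[simp] theorem Theta_C (k : QM) : Theta (PowerSeries.C k) = PowerSeries.C k :=
  evalHom_C (σ := Unit) (A := QM) _ _ k

@[simp] theorem Theta_X : Theta PowerSeries.X = qSer := evalHom_X (σ := Unit) (A := QM) _ _

theorem constantCoeff_Theta (a : PowerSeries QM) :
    PowerSeries.constantCoeff (Theta a) = PowerSeries.constantCoeff a := by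
  refine (constantCoeff_evalHom (σ := Unit) (A := QM) PowerSeries.C constantCoeff_qSer a).trans ?_
  exact PowerSeries.constantCoeff_C _

theorem Theta_bijective : Function.Bijective Theta :=
  bijective_of_constantCoeff Theta constantCoeff_Theta
    (constantCoeff_expY constantCoeff_fSer) Theta_X

theorem W_qSer : serSystem.W qSer = (-18 : ℚ) • qSer := by
  rw [qSer, Derivation.leibniz, derivation_expY _ constantCoeff_fSer, W_fSer, W_X]
  simp only [mul_zero, zero_add, smul_eq_mul]
  algebra

theorem del_qSer : serSystem.del qSer = qSer * serSystem.del fSer := by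
  rw [qSer, Derivation.leibniz, derivation_expY _ constantCoeff_fSer, del_X]
  simp only [smul_eq_mul, mul_zero, add_zero]
  ring

theorem W_Theta (a : PowerSeries QM) : serSystem.W (Theta a) = Theta (serSystem.W a) := by
  have := IsLeibniz.ext_powerSeries (σ := Unit) (A := QM) (φ := Theta)
    (d := (derAdd serSystem.W).comp Theta.toAddMonoidHom)
    (d' := Theta.toAddMonoidHom.comp (derAdd serSystem.W))
    (fun x y => by simp) (fun x y => by simp)
    (by rw [Theta_X]; exact constantCoeff_qSer)
    (fun k => by simp [W_C])
    (by simp [W_X, W_qSer, map_rat_smul])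
  exact DFunLike.congr_fun this a

theorem del_Theta (a : PowerSeries QM) : serSystem.del (Theta a) =
    Theta (serSystem.del a) + Theta (serSystem.D₂ a) * serSystem.del fSer := by
  have hD : serSystem.D₂ PowerSeries.X = PowerSeries.X := serSystem.D₂Y
  have hC : ∀ k, serSystem.D₂ (PowerSeries.C k) = 0 := fun k => by simp [serSystem, qDeriv_C]
  have := IsLeibniz.ext_powerSeries (σ := Unit) (A := QM) (φ := Theta)
    (d := (derAdd serSystem.del).comp Theta.toAddMonoidHom)
    (d' := Theta.toAddMonoidHom.comp (derAdd serSystem.del) +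
      (AddMonoidHom.mulRight (serSystem.del fSer)).comp
        (Theta.toAddMonoidHom.comp (derAdd serSystem.D₂)))
    (fun x y => by simp) (fun x y => by simp; ring)
    (by rw [Theta_X]; exact constantCoeff_qSer)
    (fun k => by simp [del_C, hC])
    (by simp [del_X, del_qSer, hD])
  exact DFunLike.congr_fun this a

/-- `Z` as a power series in `Q` over the quasi-modular forms. -/
def cSer : PowerSeries QM := (Theta_bijective.2 PowerSeries.X).choose

theorem Theta_cSer : Theta cSer = PowerSeries.X := (Theta_bijective.2 PowerSeries.X).choose_spec

/-- `Q ∂P/∂Q` as a power series in `Q`, where `P` is the prepotential. -/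
def pSer : PowerSeries QM := (Theta_bijective.2 ((12 : ℚ) • serSystem.del fSer)).choose

theorem Theta_pSer : Theta pSer = (12 : ℚ) • serSystem.del fSer :=
  (Theta_bijective.2 ((12 : ℚ) • serSystem.del fSer)).choose_spec

theorem W_cSer : serSystem.W cSer = (-18 : ℚ) • cSer := by
  apply Theta_bijective.1
  rw [← W_Theta, Theta_cSer, map_rat_smul, Theta_cSer, W_X]

theorem W_pSer : serSystem.W pSer = (-2 : ℚ) • pSer := by
  apply Theta_bijective.1
  rw [← W_Theta, Theta_pSer, map_rat_smul serSystem.W, serSystem.W_del, W_fSer, map_zero,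
    map_rat_smul Theta, Theta_pSer]
  algebra

/-- The holomorphic anomaly equation. -/
theorem del_cSer : serSystem.del cSer = (-(1 / 12) : ℚ) • (serSystem.D₂ cSer * pSer) := by
  apply Theta_bijective.1
  have h := del_Theta cSer
  rw [Theta_cSer, del_X] at h
  rw [map_rat_smul, map_mul, Theta_pSer]
  linear_combination (norm := algebra) -h

theorem coeff_W (a : PowerSeries QM) (n : ℕ) : PowerSeries.coeff n (serSystem.W a) =
    wt (PowerSeries.coeff n a) - (18 * n : ℚ) • PowerSeries.coeff n a := by
  simp only [serSystem, Derivation.sub_apply, Derivation.smul_apply, map_sub, coeff_coeffDer,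
    PowerSeries.coeff_smul, qDerivRat_apply, coeff_qDeriv]
  rw [← nsmul_eq_mul, ← Nat.cast_smul_eq_nsmul ℚ, smul_smul]

theorem wt_coeff {a : PowerSeries QM} {r : ℚ} (h : serSystem.W a = r • a) (n : ℕ) :
    wt (PowerSeries.coeff n a) = (18 * n + r : ℚ) • PowerSeries.coeff n a := by
  have h1 := congrArg (PowerSeries.coeff n) h
  rw [coeff_W, PowerSeries.coeff_smul] at h1
  rw [sub_eq_iff_eq_add.mp h1, ← add_smul, add_comm]

end ModularData

/-! ### The coefficients -/

section Coefficients

/-- The coefficients `cₙ` of `Z` as a power series in `Q`. -/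
def zCoeff (n : ℕ) : QM := PowerSeries.coeff n cSer

/-- The coefficients `Pₛ` of the prepotential. The coefficient of `Q ∂P/∂Q` at `s = 0` vanishes, so
that the junk value of `n⁻¹` at `n = 0` does no harm. -/
def prepotCoeff (n : ℕ) : QM := (n : ℚ)⁻¹ • PowerSeries.coeff n pSer

/-- The coefficients `fₙ` of `log (Q / Z)` as a power series in `Z`. -/
def logCoeff (n : ℕ) : QM := PowerSeries.coeff n fSer

/-- The modular forms `Aₙ`; the factor `8ⁿ` comes from `Y = 8 z₂ / (E₄^{3/2} + E₆)³`. -/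
def aCoeff (n : ℕ) : QM := (8 ^ n : ℚ) • derE₂ (PowerSeries.coeff n solM)

/-- The modular forms `Bₙ`: the coefficients of `M` with their part linear in `E₂` removed. -/
def bCoeff (n : ℕ) : QM :=
  (8 ^ n : ℚ) • (PowerSeries.coeff n solM - e₂ * derE₂ (PowerSeries.coeff n solM))

theorem zCoeff_zero : zCoeff 0 = 0 :=
  eq_zero_of_wt_neg (k := -18) (by norm_num) (by
    have := wt_coeff W_cSer 0
    rw [zCoeff, this]; norm_num)

theorem isQuasiModular_zCoeff (n : ℕ) : IsQuasiModular (18 * n) (zCoeff (n + 1)) := by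
  refine isQuasiModular_of_wt ?_
  rw [zCoeff, wt_coeff W_cSer]
  congr 1
  push_cast; ring

theorem coeff_zero_pSer : PowerSeries.coeff 0 pSer = 0 :=
  eq_zero_of_wt_neg (k := -2) (by norm_num) (by
    have := wt_coeff W_pSer 0
    rw [this]; norm_num)

theorem smul_prepotCoeff (n : ℕ) : (n : ℚ) • prepotCoeff n = PowerSeries.coeff n pSer := by
  cases n with
  | zero => rw [coeff_zero_pSer]; simp
  | succ n => rw [prepotCoeff, smul_inv_smul₀ (by exact_mod_cast Nat.succ_ne_zero n)]

theorem prepotCoeff_zero : prepotCoeff 0 = 0 := by simp [prepotCoeff]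

theorem isQuasiModular_prepotCoeff (n : ℕ) :
    IsQuasiModular (18 * n + 16) (prepotCoeff (n + 1)) := by
  refine isQuasiModular_of_wt ?_
  rw [prepotCoeff, Derivation.map_smul, wt_coeff W_pSer, smul_comm]
  congr 1
  push_cast; ring

theorem logCoeff_zero : logCoeff 0 = 0 := by
  rw [logCoeff, PowerSeries.coeff_zero_eq_constantCoeff_apply, constantCoeff_fSer]

theorem isQuasiModular_logCoeff (n : ℕ) : IsQuasiModular (18 * (n + 1)) (logCoeff (n + 1)) := by
  have h : serSystem.W fSer = (0 : ℚ) • fSer := by rw [W_fSer, zero_smul]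
  refine isQuasiModular_of_wt ?_
  rw [logCoeff, wt_coeff h]
  congr 1
  push_cast; ring

/-- The holomorphic anomaly equation for the coefficients. -/
theorem pderiv_zCoeff (n : ℕ) : MvPolynomial.pderiv 0 (zCoeff n) =
    (-1 / 12 : ℚ) • ∑ s ∈ Finset.Ico 1 n,
      ((s : ℚ) * ((n : ℚ) - (s : ℚ))) • (zCoeff (n - s) * prepotCoeff s) := by
  have h := congrArg (PowerSeries.coeff n) del_cSer
  rw [PowerSeries.coeff_smul, PowerSeries.coeff_mul,
    Finset.Nat.sum_antidiagonal_eq_sum_range_succ_mk] at h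
  have h1 : PowerSeries.coeff n (serSystem.del cSer) = derE₂ (zCoeff n) := by
    simp [serSystem, zCoeff]
  have h2 : ∀ m, PowerSeries.coeff m (serSystem.D₂ cSer) = (m : ℚ) • zCoeff m := by
    intro m
    rw [show serSystem.D₂ cSer = qDeriv cSer from rfl, coeff_qDeriv, ← nsmul_eq_mul,
      ← Nat.cast_smul_eq_nsmul ℚ, zCoeff]
  rw [h1] at h
  rw [h, show (-1 / 12 : ℚ) = -(1 / 12) by norm_num]
  congr 1
  rw [← Finset.sum_range_reflect, ← Finset.sum_subset (s₁ := Finset.Ico 1 n)]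
  · refine Finset.sum_congr rfl fun s hs => ?_
    rw [Finset.mem_Ico] at hs
    have h3 : n + 1 - 1 - s = n - s := by omega
    have h4 : n - (n - s) = s := by omega
    simp only [h3, h4, h2, ← smul_prepotCoeff s]
    rw [Nat.cast_sub hs.2.le]
    algebra
  · intro s hs
    rw [Finset.mem_Ico] at hs
    rw [Finset.mem_range]; omega
  · intro s hs hs'
    rw [Finset.mem_Ico] at hs'
    rw [Finset.mem_range] at hs
    rcases Nat.eq_zero_or_pos s with rfl | h0
    · rw [show n - (n.succ - 1 - 0) = 0 by omega, coeff_zero_pSer, mul_zero]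
    · rw [show n.succ - 1 - s = 0 by omega, h2, Nat.cast_zero, zero_smul, zero_mul]

theorem wt_coeff_solM (n : ℕ) :
    wt (PowerSeries.coeff n solM) = (18 * n : ℚ) • PowerSeries.coeff n solM := by
  have h : serSystem.W solM = (0 : ℚ) • solM := by rw [W_fundamental.2, zero_smul]
  rw [wt_coeff h, add_zero]

theorem derE₂_derE₂_coeff_solM (n : ℕ) : derE₂ (derE₂ (PowerSeries.coeff n solM)) = 0 := by
  have h := congrArg (PowerSeries.coeff n) del_del_fundamental.2
  simpa [serSystem] using h

theorem coeff_zero_solM : PowerSeries.coeff 0 solM = 0 := by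
  rw [PowerSeries.coeff_zero_eq_constantCoeff_apply, constantCoeff_solM]

theorem aCoeff_zero : aCoeff 0 = 0 := by rw [aCoeff, coeff_zero_solM]; simp

theorem bCoeff_zero : bCoeff 0 = 0 := by rw [bCoeff, coeff_zero_solM]; simp

theorem isModular_aCoeff (n : ℕ) : IsModular (18 * n + 16) (aCoeff (n + 1)) := by
  constructor
  · refine isQuasiModular_of_wt ?_
    rw [aCoeff, Derivation.map_smul, wt_pderiv, wt_coeff_solM, Derivation.map_smul]
    push_cast
    module
  · rw [aCoeff, Derivation.map_smul, derE₂_derE₂_coeff_solM, smul_zero]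

theorem isModular_bCoeff (n : ℕ) : IsModular (18 * (n + 1)) (bCoeff (n + 1)) := by
  constructor
  · refine isQuasiModular_of_wt ?_
    rw [bCoeff, Derivation.map_smul, map_sub, Derivation.leibniz, wt_pderiv, wt_coeff_solM,
      Derivation.map_smul, wt_e₂]
    simp only [smul_eq_mul]
    push_cast
    algebra
  · rw [bCoeff, Derivation.map_smul, map_sub, Derivation.leibniz, derE₂_derE₂_coeff_solM]
    simp

theorem aCoeff_mul_add (n : ℕ) : aCoeff n * e₂ + bCoeff n =
    (8 ^ n : ℚ) • PowerSeries.coeff n solM := by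
  rw [aCoeff, bCoeff]
  algebra

end Coefficients

/-! ### The Picard-Fuchs operators in modular coordinates -/

section PicardFuchs

/-- The data on which the Picard-Fuchs operators act, in a differential ring `T`: the derivations
`θ₁`, `θ₂` (indexed from `0`), the variables `z₁`, `z₂`, the functions `φ = E₄^{1/4}` and `E₂` of
`z₁`, and the inverse of `(1 - 432 z₁) φ⁶`. -/
structure PFData (T : Type*) [CommRing T] [Algebra ℚ T] where
  θ₀ : Derivation ℚ T T
  θ₁ : Derivation ℚ T T
  z₁ : T
  z₂ : T
  φ : T
  E₂ : T
  mi : T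
  comm : ∀ a, θ₀ (θ₁ a) = θ₁ (θ₀ a)
  θ₀z₁ : θ₀ z₁ = z₁
  θ₁z₁ : θ₁ z₁ = 0
  θ₀z₂ : θ₀ z₂ = 0
  θ₁z₂ : θ₁ z₂ = z₂
  θ₁φ : θ₁ φ = 0
  θ₁E₂ : θ₁ E₂ = 0
  θ₀φ : 12 * ((1 - 432 * z₁) * φ * θ₀ φ) = E₂ - (1 - 864 * z₁) * φ ^ 2
  θ₀E₂ : 12 * ((1 - 432 * z₁) * φ ^ 2 * θ₀ E₂) = E₂ ^ 2 - φ ^ 4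
  hyper : (1 - 432 * z₁) * θ₀ (θ₀ φ) = 432 * (z₁ * θ₀ φ) + 60 * (z₁ * φ)
  mul_mi : (1 - 432 * z₁) * φ ^ 6 * mi = 1

namespace PFData

variable {T : Type*} [CommRing T] [Algebra ℚ T] (𝔓 : PFData T)

theorem derivation_ofNat (d : Derivation ℚ T T) (n : ℕ) [n.AtLeastTwo] :
    d (OfNat.ofNat n : T) = 0 := by
  rw [← Nat.cast_ofNat, Derivation.map_natCast]

theorem derivation_432 (d : Derivation ℚ T T) : d (432 : T) = 0 := derivation_ofNat d 432

theorem derivation_864 (d : Derivation ℚ T T) : d (864 : T) = 0 := derivation_ofNat d 864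

theorem θ₀_mi : 𝔓.θ₀ 𝔓.mi = 𝔓.mi ^ 2 *
    (432 * (𝔓.z₁ * 𝔓.φ ^ 6) - 6 * ((1 - 432 * 𝔓.z₁) * 𝔓.φ ^ 5 * 𝔓.θ₀ 𝔓.φ)) := by
  have h := congrArg 𝔓.θ₀ 𝔓.mul_mi
  simp only [Derivation.leibniz, Derivation.leibniz_pow, map_sub, Derivation.map_one_eq_zero,
    derivation_432, 𝔓.θ₀z₁, smul_eq_mul, nsmul_eq_mul] at h
  push_cast at h
  linear_combination 𝔓.mi * h - 𝔓.θ₀ 𝔓.mi * 𝔓.mul_mi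

theorem θ₁_mi : 𝔓.θ₁ 𝔓.mi = 0 := by
  have h := congrArg 𝔓.θ₁ 𝔓.mul_mi
  simp only [Derivation.leibniz, Derivation.leibniz_pow, map_sub, Derivation.map_one_eq_zero,
    derivation_432, 𝔓.θ₁z₁, 𝔓.θ₁φ, smul_eq_mul, nsmul_eq_mul] at h
  linear_combination 𝔓.mi * h - 𝔓.θ₁ 𝔓.mi * 𝔓.mul_mi

/-- The modular system in which the Picard-Fuchs operators take their modular shape. -/
def system : ModularSystem T where
  D₁ := ((1 - 432 * 𝔓.z₁) * 𝔓.φ ^ 2) • 𝔓.θ₀ - (3 / 2 : ℚ) • (𝔓.φ ^ 2 • 𝔓.θ₁)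
  D₂ := 𝔓.θ₁
  E₂ := 𝔓.E₂
  E₄ := 𝔓.φ ^ 4
  E₆ := (1 - 864 * 𝔓.z₁) * 𝔓.φ ^ 6
  Y := 𝔓.z₂ * 𝔓.mi ^ 3
  comm a := by
    simp only [Derivation.sub_apply, Derivation.smul_apply, Derivation.leibniz,
      Derivation.leibniz_pow, map_sub, map_rat_smul, Derivation.map_one_eq_zero,
      derivation_432, 𝔓.θ₁z₁, 𝔓.θ₁φ, 𝔓.comm, smul_eq_mul, nsmul_eq_mul]
    algebra
  D₁E₂ := by
    simp only [Derivation.sub_apply, Derivation.smul_apply, 𝔓.θ₁E₂, smul_eq_mul]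
    linear_combination (norm := algebra) (1 / 12 : ℚ) • 𝔓.θ₀E₂
  D₁E₄ := by
    simp only [Derivation.sub_apply, Derivation.smul_apply, Derivation.leibniz_pow, 𝔓.θ₁φ,
      smul_eq_mul, nsmul_eq_mul]
    push_cast
    linear_combination (norm := algebra) (1 / 3 : ℚ) • (𝔓.φ ^ 4 * 𝔓.θ₀φ)
  D₁E₆ := by
    simp only [Derivation.sub_apply, Derivation.smul_apply, Derivation.leibniz,
      Derivation.leibniz_pow, map_sub, Derivation.map_one_eq_zero,
      derivation_864, 𝔓.θ₁z₁, 𝔓.θ₀z₁, 𝔓.θ₁φ, smul_eq_mul, nsmul_eq_mul]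
    push_cast
    linear_combination (norm := algebra)
      (1 / 2 : ℚ) • ((1 - 864 * 𝔓.z₁) * 𝔓.φ ^ 6 * 𝔓.θ₀φ)
  D₂E₂ := 𝔓.θ₁E₂
  D₂E₄ := by simp [Derivation.leibniz_pow, 𝔓.θ₁φ]
  D₂E₆ := by
    simp [Derivation.leibniz, Derivation.leibniz_pow, 𝔓.θ₁φ, 𝔓.θ₁z₁, derivation_864]
  D₁Y := by
    simp only [Derivation.sub_apply, Derivation.smul_apply, Derivation.leibniz,
      Derivation.leibniz_pow, 𝔓.θ₀z₂, 𝔓.θ₁z₂, 𝔓.θ₀_mi, 𝔓.θ₁_mi, smul_eq_mul, nsmul_eq_mul]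
    push_cast
    linear_combination (norm := algebra)
      (3 * 𝔓.z₂ * 𝔓.mi ^ 3 * (432 * 𝔓.z₁ * 𝔓.φ ^ 2 -
        6 * ((1 - 432 * 𝔓.z₁) * 𝔓.φ * 𝔓.θ₀ 𝔓.φ))) * 𝔓.mul_mi -
      (3 / 2 : ℚ) • (𝔓.z₂ * 𝔓.mi ^ 3 * 𝔓.θ₀φ)
  D₂Y := by
    simp [Derivation.leibniz, Derivation.leibniz_pow, 𝔓.θ₁z₂, 𝔓.θ₁_mi, mul_comm]

/-- The first Picard-Fuchs operator. -/
def L₁ (w : T) : T := 𝔓.θ₀ (𝔓.θ₀ w - (3 : ℚ) • 𝔓.θ₁ w) -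
  12 * 𝔓.z₁ * ((6 : ℚ) • 𝔓.θ₀ ((6 : ℚ) • 𝔓.θ₀ w + (5 : ℚ) • w) +
    ((6 : ℚ) • 𝔓.θ₀ w + (5 : ℚ) • w))

/-- The operator `3 θ₂ - θ₁ + r`. -/
def lin (r : ℚ) (w : T) : T := (3 : ℚ) • 𝔓.θ₁ w - 𝔓.θ₀ w + r • w

/-- The second Picard-Fuchs operator. -/
def L₂ (w : T) : T :=
  𝔓.θ₁ (𝔓.θ₁ (𝔓.θ₁ w)) + 𝔓.z₂ * 𝔓.lin 0 (𝔓.lin 1 (𝔓.lin 2 w))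

/-- The first Picard-Fuchs operator as a composition of operators `a θ₁ + b θ₂ + c`. -/
theorem L₁_eq (w : T) : 𝔓.L₁ w =
    ((1 : ℚ) • 𝔓.θ₀ ((1 : ℚ) • 𝔓.θ₀ w + (-3 : ℚ) • 𝔓.θ₁ w + (0 : ℚ) • w) +
    (0 : ℚ) • 𝔓.θ₁ ((1 : ℚ) • 𝔓.θ₀ w + (-3 : ℚ) • 𝔓.θ₁ w + (0 : ℚ) • w) +
    (0 : ℚ) • ((1 : ℚ) • 𝔓.θ₀ w + (-3 : ℚ) • 𝔓.θ₁ w + (0 : ℚ) • w)) - 12 * 𝔓.z₁ *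
    ((6 : ℚ) • 𝔓.θ₀ ((6 : ℚ) • 𝔓.θ₀ w + (0 : ℚ) • 𝔓.θ₁ w + (5 : ℚ) • w) +
      (0 : ℚ) • 𝔓.θ₁ ((6 : ℚ) • 𝔓.θ₀ w + (0 : ℚ) • 𝔓.θ₁ w + (5 : ℚ) • w) +
      (1 : ℚ) • ((6 : ℚ) • 𝔓.θ₀ w + (0 : ℚ) • 𝔓.θ₁ w + (5 : ℚ) • w)) := by
  simp only [L₁, map_add, map_sub, map_rat_smul]
  algebra

theorem lin_eq (r : ℚ) (w : T) :
    𝔓.lin r w = (-1 : ℚ) • 𝔓.θ₀ w + (3 : ℚ) • 𝔓.θ₁ w + r • w := by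
  simp only [lin]
  algebra

theorem L₁_add (v w : T) : 𝔓.L₁ (v + w) = 𝔓.L₁ v + 𝔓.L₁ w := by
  simp only [L₁, map_add, map_sub, map_rat_smul]
  algebra

theorem L₁_smul (r : ℚ) (w : T) : 𝔓.L₁ (r • w) = r • 𝔓.L₁ w := by
  simp only [L₁, map_add, map_sub, map_rat_smul]
  algebra

theorem L₂_add (v w : T) : 𝔓.L₂ (v + w) = 𝔓.L₂ v + 𝔓.L₂ w := by
  simp only [L₂, lin, map_add, map_sub, map_rat_smul]
  algebra

theorem L₂_smul (r : ℚ) (w : T) : 𝔓.L₂ (r • w) = r • 𝔓.L₂ w := by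
  simp only [L₂, lin, map_add, map_sub, map_rat_smul]
  algebra

/-- Conjugation by `φ = E₄^{1/4}` turns the first Picard-Fuchs operator into `box 0`. The term
without derivatives of `w` vanishes by the hypergeometric equation for `φ`. -/
theorem L₁_φ_mul (w : T) : (1 - 432 * 𝔓.z₁) * 𝔓.φ ^ 3 * 𝔓.L₁ (𝔓.φ * w) = 𝔓.system.box 0 w := by
  simp only [ModularSystem.box, ModularSystem.conn, system, L₁, Derivation.sub_apply,
    Derivation.smul_apply, Derivation.leibniz, Derivation.leibniz_pow, map_sub, map_add,
    map_rat_smul, Derivation.map_one_eq_zero, derivation_432, 𝔓.θ₁z₁, 𝔓.θ₀z₁, 𝔓.θ₁φ, 𝔓.comm,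
    smul_eq_mul, nsmul_eq_mul, map_zero]
  push_cast
  linear_combination (norm := algebra) ((1 - 432 * 𝔓.z₁) * 𝔓.φ ^ 3 * w) * 𝔓.hyper

theorem lin_comm (r s : ℚ) (w : T) : 𝔓.lin r (𝔓.lin s w) = 𝔓.lin s (𝔓.lin r w) := by
  simp only [lin, map_add, map_sub, map_rat_smul]
  algebra

/-- Conjugation by `mi ^ k φ` turns `3 θ₂ - θ₁ + k` into `-op k`. -/
theorem lin_mi_pow (k : ℕ) (w : T) : 𝔓.lin k (𝔓.mi ^ k * 𝔓.φ * w) =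
    -(𝔓.mi ^ (k + 1) * 𝔓.φ * 𝔓.system.op k w) := by
  have h0 : ∀ k : ℕ, 𝔓.θ₀ (𝔓.mi ^ k) = (k : ℚ) • (𝔓.mi ^ (k + 1) *
      (432 * (𝔓.z₁ * 𝔓.φ ^ 6) - 6 * ((1 - 432 * 𝔓.z₁) * 𝔓.φ ^ 5 * 𝔓.θ₀ 𝔓.φ))) := by
    intro k
    induction k with
    | zero => simp
    | succ k ih =>
      rw [pow_succ, Derivation.leibniz, ih, 𝔓.θ₀_mi]
      push_cast
      simp only [smul_eq_mul]
      algebra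
  have h1 : 𝔓.θ₁ (𝔓.mi ^ k) = 0 := by
    rw [Derivation.leibniz_pow, 𝔓.θ₁_mi, smul_zero, smul_zero]
  simp only [lin, ModularSystem.op, system, Derivation.sub_apply, Derivation.smul_apply,
    Derivation.leibniz, h0, h1, 𝔓.θ₁φ, smul_eq_mul]
  linear_combination (norm := algebra)
    (-(3 * (𝔓.mi ^ k * 𝔓.φ * 𝔓.θ₁ w)) + 𝔓.mi ^ k * 𝔓.φ * 𝔓.θ₀ w + 𝔓.mi ^ k * 𝔓.θ₀ 𝔓.φ * w -
      (k : ℚ) • (𝔓.mi ^ k * 𝔓.φ * w)) * 𝔓.mul_mi -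
    (1 / 12 - (k : ℚ) / 2) • (𝔓.mi ^ (k + 1) * 𝔓.φ ^ 5 * w * 𝔓.θ₀φ)

/-- Conjugation by `φ = E₄^{1/4}` turns the second Picard-Fuchs operator into `D₂³ - Y cubic`. -/
theorem L₂_φ_mul (w : T) : 𝔓.L₂ (𝔓.φ * w) =
    𝔓.φ * (𝔓.θ₁ (𝔓.θ₁ (𝔓.θ₁ w)) - 𝔓.z₂ * 𝔓.mi ^ 3 * 𝔓.system.cubic w) := by
  have h : ∀ r w, 𝔓.lin r (-w) = -𝔓.lin r w := by
    intro r w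
    simp only [lin, map_neg]
    algebra
  have h0 := 𝔓.lin_mi_pow 0 w
  have h1 := 𝔓.lin_mi_pow 1 (𝔓.system.op 0 w)
  have h2 := 𝔓.lin_mi_pow 2 (𝔓.system.op 1 (𝔓.system.op 0 w))
  norm_num at h0 h1 h2
  rw [L₂, 𝔓.lin_comm 1 2, 𝔓.lin_comm 0 2, 𝔓.lin_comm 0 1, h0, h, h1, neg_neg, h2,
    ModularSystem.cubic]
  simp only [Derivation.leibniz, 𝔓.θ₁φ, smul_eq_mul, mul_zero, add_zero]
  ring

end PFData

end PicardFuchs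

/-! ### Rational powers -/

section RationalPowers

variable {f : QSer}

theorem rpow_eq (f : QSer) (r : ℚ) :
    rpow f r = serExp (σ := Unit) (A := ℚ) (r • serLog (σ := Unit) (A := ℚ) f) := rfl

theorem constantCoeff_smul_serLog (hf : PowerSeries.constantCoeff f = 1) (r : ℚ) :
    PowerSeries.constantCoeff (r • serLog (σ := Unit) (A := ℚ) f) = 0 := by
  rw [map_rat_smul, show PowerSeries.constantCoeff (serLog (σ := Unit) (A := ℚ) f) = 0 from
    const_serLog (σ := Unit) (A := ℚ) hf, smul_zero]

theorem constantCoeff_rpow (hf : PowerSeries.constantCoeff f = 1) (r : ℚ) :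
    PowerSeries.constantCoeff (rpow f r) = 1 :=
  const_serExp (σ := Unit) (A := ℚ) (constantCoeff_smul_serLog hf r)

theorem rpow_one (hf : PowerSeries.constantCoeff f = 1) : rpow f 1 = f := by
  rw [rpow_eq, one_smul]
  exact serExp_serLog (σ := Unit) (A := ℚ) hf

theorem rpow_nat_mul (hf : PowerSeries.constantCoeff f = 1) (n : ℕ) (r : ℚ) :
    rpow f (n * r) = rpow f r ^ n := by
  have h := serExp_nsmul (σ := Unit) (A := ℚ) (constantCoeff_smul_serLog hf r) n
  rw [rpow_eq, mul_smul, Nat.cast_smul_eq_nsmul]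
  exact h

end RationalPowers

/-! ### Substitution into power series -/

section Substitution

variable {σ : Type*}

/-- The substitution of `u` as a ring homomorphism. -/
def subHom (u : MvPowerSeries σ ℚ) (hu : MvPowerSeries.constantCoeff u = 0) :
    QSer →+* MvPowerSeries σ ℚ :=
  (PowerSeries.substAlgHom (R := ℚ) (hasSubst_of_const hu)).toRingHom

theorem subHom_apply {u : MvPowerSeries σ ℚ} (hu : MvPowerSeries.constantCoeff u = 0) (f : QSer) :
    subHom u hu f = f.subst u := by
  simp [subHom, PowerSeries.coe_substAlgHom]

@[simp] theorem subHom_X {u : MvPowerSeries σ ℚ} (hu : MvPowerSeries.constantCoeff u = 0) :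
    subHom u hu PowerSeries.X = u := by
  rw [subHom_apply, PowerSeries.subst_X (hasSubst_of_const hu)]

theorem constantCoeff_subHom {u : MvPowerSeries σ ℚ} (hu : MvPowerSeries.constantCoeff u = 0)
    (f : QSer) : MvPowerSeries.constantCoeff (subHom u hu f) = PowerSeries.constantCoeff f := by
  rw [subHom_apply, const_subst_rat hu]
  rfl

/-- The chain rule for the substitution of a series `u` with logarithmic derivative `l`. -/
theorem derivation_subHom (d : Derivation ℚ (MvPowerSeries σ ℚ) (MvPowerSeries σ ℚ))
    {u : MvPowerSeries σ ℚ} (hu : MvPowerSeries.constantCoeff u = 0) {l : MvPowerSeries σ ℚ}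
    (h : d u = u * l) (f : QSer) : d (subHom u hu f) = subHom u hu (qDeriv f) * l := by
  have h1 := (derAdd_isLeibniz d).subst (a := u) hu hu f
  rw [subHom_apply, qDeriv_apply, map_mul, subHom_X, subHom_apply]
  refine h1.trans ?_
  simp only [derAdd_apply, RingHom.id_apply, h]
  ring

end Substitution

/-! ### The modular parameter -/

section ModularParameter

/-- The fourth root of `E₄`. -/
def rootE₄ : QSer := rpow (eisenstein 4) (1 / 4)

theorem constantCoeff_rootE₄ : PowerSeries.constantCoeff rootE₄ = 1 :=
  constantCoeff_rpow (constantCoeff_eisenstein 4) _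

theorem rootE₄_pow_four : rootE₄ ^ 4 = eisenstein 4 := by
  rw [rootE₄, ← rpow_nat_mul (constantCoeff_eisenstein 4)]
  norm_num
  exact rpow_one (constantCoeff_eisenstein 4)

theorem rootE₄_pow_six : rootE₄ ^ 6 = rpow (eisenstein 4) (3 / 2) := by
  rw [rootE₄, ← rpow_nat_mul (constantCoeff_eisenstein 4)]
  norm_num

theorem mul_inv_of_const {f : QSer} (h : PowerSeries.constantCoeff f = 1) : f * f⁻¹ = 1 :=
  PowerSeries.mul_inv_cancel _ (by rw [h]; exact one_ne_zero)

/-- The coordinate `z₁ = (1 - E₆ / E₄^{3/2}) / 864` as a function of the modular parameter. -/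
def zOfQ : QSer := (1 / 864 : ℚ) • (1 - eisenstein 6 * (rootE₄ ^ 6)⁻¹)

theorem zOfQ_mul : (1 - 864 * zOfQ) * rootE₄ ^ 6 = eisenstein 6 := by
  have h := mul_inv_of_const (f := rootE₄ ^ 6) (by rw [map_pow, constantCoeff_rootE₄, one_pow])
  have h2 : (864 : QSer) * zOfQ = 1 - eisenstein 6 * (rootE₄ ^ 6)⁻¹ := by
    rw [zOfQ]; algebra
  rw [h2]
  linear_combination eisenstein 6 * h

theorem constantCoeff_zOfQ : PowerSeries.constantCoeff zOfQ = 0 := by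
  have h := congrArg PowerSeries.constantCoeff zOfQ_mul
  rw [map_mul, map_pow, constantCoeff_rootE₄, map_sub, map_mul, map_one,
    constantCoeff_eisenstein] at h
  have h2 : PowerSeries.constantCoeff (864 : QSer) = 864 := map_ofNat _ _
  rw [h2] at h
  linarith

/-- The relation `1 / J = z₁ (1 - 432 z₁)`. -/
theorem zOfQ_mul_one_sub : zOfQ * (1 - 432 * zOfQ) = eta24 * (eisenstein 4 ^ 3)⁻¹ := by
  have h := mul_inv_of_const (f := eisenstein 4 ^ 3)
    (by rw [map_pow, constantCoeff_eisenstein, one_pow])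
  have h1 : (1728 : QSer) * eta24 = eisenstein 4 ^ 3 - eisenstein 6 ^ 2 := by
    rw [← qexp_disc, disc, map_smul, map_sub, map_pow, map_pow, qexp_e₄, qexp_e₆]
    algebra
  have h2 := zOfQ_mul
  have h3 : (eisenstein 4 ^ 3 : QSer) = rootE₄ ^ 12 := by rw [← rootE₄_pow_four]; ring
  have hne : (1728 : QSer) ≠ 0 := by
    intro h0
    have h5 := congrArg PowerSeries.constantCoeff h0
    rw [map_zero, show PowerSeries.constantCoeff (1728 : QSer) = 1728 from map_ofNat _ _] at h5
    norm_num at h5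
  refine mul_left_cancel₀ hne ?_
  have h4 : (1728 : QSer) * (zOfQ * (1 - 432 * zOfQ)) * eisenstein 4 ^ 3 = 1728 * eta24 := by
    rw [h1, h3]
    linear_combination -((1 - 864 * zOfQ) * rootE₄ ^ 6 + eisenstein 6) * h2
  calc (1728 : QSer) * (zOfQ * (1 - 432 * zOfQ))
      = 1728 * (zOfQ * (1 - 432 * zOfQ)) * eisenstein 4 ^ 3 * (eisenstein 4 ^ 3)⁻¹ := by
        rw [mul_assoc _ (eisenstein 4 ^ 3), h, mul_one]
    _ = _ := by rw [h4, mul_assoc]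

theorem coeff_one_zOfQ : PowerSeries.coeff 1 zOfQ = 1 := by
  have h := congrArg (PowerSeries.coeff 1) zOfQ_mul_one_sub
  have h0 := constantCoeff_zOfQ
  rw [← PowerSeries.coeff_zero_eq_constantCoeff_apply] at h0
  rw [eta24, mul_assoc, PowerSeries.coeff_succ_X_mul, mul_sub, mul_one, map_sub,
    show zOfQ * (432 * zOfQ) = (432 : ℕ) • (zOfQ * zOfQ) by rw [nsmul_eq_mul]; push_cast; ring,
    map_nsmul, PowerSeries.coeff_mul] at h
  simp only [Finset.Nat.antidiagonal_succ, Finset.Nat.antidiagonal_zero] at h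
  simpa [h0, constantCoeff_eulerProd, constantCoeff_eisenstein] using h

theorem isUnit_coeff_one_zOfQ : IsUnit (PowerSeries.coeff 1 zOfQ) := by
  rw [coeff_one_zOfQ]; exact isUnit_one

/-- The modular parameter `q̃` as a function of `z₁`: the inverse series of `zOfQ`. -/
def qt : QSer := PowerSeries.substInvOfIsUnit zOfQ isUnit_coeff_one_zOfQ

theorem constantCoeff_qt : PowerSeries.constantCoeff qt = 0 :=
  PowerSeries.constantCoeff_substInvOfIsUnit _ _

theorem coeff_one_qt : PowerSeries.coeff 1 qt = 1 := by
  rw [qt, PowerSeries.coeff_one_substInvOfIsUnit]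
  have h := isUnit_coeff_one_zOfQ.unit.mul_inv
  have h2 : (isUnit_coeff_one_zOfQ.unit : ℚ) = 1 := coeff_one_zOfQ
  rw [Units.val_inv_eq_inv_val, h2, inv_one]

/-- `q̃ / z₁`. -/
def qtUnit : QSer := PowerSeries.mk fun n => PowerSeries.coeff (n + 1) qt

theorem constantCoeff_qtUnit : PowerSeries.constantCoeff qtUnit = 1 := by
  rw [← PowerSeries.coeff_zero_eq_constantCoeff_apply, qtUnit, PowerSeries.coeff_mk, coeff_one_qt]

theorem qt_eq : qt = PowerSeries.X * qtUnit := by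
  conv_lhs => rw [PowerSeries.eq_X_mul_shift_add_const qt, constantCoeff_qt, map_zero, add_zero]
  rfl

/-- `log (q̃ / z₁)`. -/
def tau : QSer := serLog (σ := Unit) (A := ℚ) qtUnit

theorem constantCoeff_tau : PowerSeries.constantCoeff tau = 0 :=
  const_serLog (σ := Unit) (A := ℚ) constantCoeff_qtUnit

theorem exp_tau : (PowerSeries.exp ℚ).subst tau = qtUnit :=
  serExp_serLog (σ := Unit) (A := ℚ) constantCoeff_qtUnit

theorem qTilde_tau : Periods.qTilde tau = qt := by
  rw [Periods.qTilde, exp_tau, qt_eq]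

/-- Evaluation at `q̃`. -/
def tild : QSer →+* QSer := subHom (σ := Unit) qt constantCoeff_qt

theorem tild_apply (f : QSer) : tild f = Periods.atTilde tau f := by
  rw [Periods.atTilde, qTilde_tau]
  exact subHom_apply (σ := Unit) _ f

@[simp] theorem tild_X : tild PowerSeries.X = qt := subHom_X (σ := Unit) _

theorem constantCoeff_tild (f : QSer) :
    PowerSeries.constantCoeff (tild f) = PowerSeries.constantCoeff f :=
  constantCoeff_subHom (σ := Unit) _ f

theorem tild_zOfQ : tild zOfQ = PowerSeries.X := by
  refine (subHom_apply (σ := Unit) constantCoeff_qt zOfQ).trans ?_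
  exact PowerSeries.subst_substInvOfIsUnit_right _ constantCoeff_zOfQ _

theorem isTau_tau : Periods.IsTau tau := by
  refine ⟨constantCoeff_tau, ?_⟩
  have h := congrArg tild zOfQ_mul_one_sub
  rw [tild_apply (eta24 * _), Periods.atTilde] at h
  rw [← h, map_mul, map_sub, map_mul, tild_zOfQ, map_one, map_ofNat]

/-- The logarithmic derivative of `q̃`. -/
def lam : QSer := 1 + qDeriv tau

theorem qDeriv_qt : qDeriv qt = qt * lam := by
  have h : qDeriv qtUnit = qtUnit * qDeriv tau := by
    have h1 := IsLeibniz.serExp (σ := Unit) (τ := Unit) (A := ℚ) (B := ℚ)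
      (derAdd_isLeibniz (qDeriv (R := ℚ))) constantCoeff_tau constantCoeff_tau
    rw [serExp, exp_tau] at h1
    exact h1
  rw [qt_eq, Derivation.leibniz, h, qDeriv_X, lam]
  simp only [smul_eq_mul]
  ring

theorem qDeriv_tild (f : QSer) : qDeriv (tild f) = tild (qDeriv f) * lam :=
  derivation_subHom (σ := Unit) (qDeriv (R := ℚ)) constantCoeff_qt qDeriv_qt f

/-- `E₄(q̃)^{1/4}`. -/
def phi : QSer := tild rootE₄

theorem constantCoeff_phi : PowerSeries.constantCoeff phi = 1 := by
  rw [phi, constantCoeff_tild, constantCoeff_rootE₄]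

theorem ne_zero_of_const {f : QSer} (h : PowerSeries.constantCoeff f = 1) : f ≠ 0 := by
  rintro rfl
  simp at h

theorem tild_E₄ : tild (eisenstein 4) = phi ^ 4 := by
  rw [← rootE₄_pow_four, map_pow, phi]

theorem tild_E₆ : tild (eisenstein 6) = (1 - 864 * PowerSeries.X) * phi ^ 6 := by
  rw [← zOfQ_mul, map_mul, map_sub, map_mul, tild_zOfQ, map_one, map_ofNat, map_pow, phi]

theorem qDeriv_ofNat (n : ℕ) [n.AtLeastTwo] : qDeriv (OfNat.ofNat n : QSer) = 0 := by
  rw [← Nat.cast_ofNat, Derivation.map_natCast]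

theorem qDeriv_phi_pow_four : 12 * (phi ^ 3 * qDeriv phi) =
    phi ^ 4 * (tild (eisenstein 2) - (1 - 864 * PowerSeries.X) * phi ^ 2) * lam := by
  have h := congrArg qDeriv tild_E₄
  rw [qDeriv_tild, ramanujan_E₄, map_rat_smul, map_sub, map_mul, tild_E₄, tild_E₆,
    Derivation.leibniz_pow] at h
  simp only [smul_eq_mul, nsmul_eq_mul] at h
  push_cast at h
  linear_combination (norm := algebra) (-3 : ℚ) • h

/-- The logarithmic derivative of `q̃` in terms of `E₄`. -/
theorem lam_mul : (1 - 432 * PowerSeries.X) * phi ^ 2 * lam = 1 := by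
  have h := congrArg qDeriv tild_E₆
  have h864 : qDeriv (864 : QSer) = 0 := qDeriv_ofNat 864
  rw [qDeriv_tild, ramanujan_E₆, map_rat_smul, map_sub, map_mul, map_mul, tild_E₄, tild_E₆,
    Derivation.leibniz, Derivation.leibniz_pow, map_sub, Derivation.leibniz, qDeriv_X, h864,
    Derivation.map_one_eq_zero] at h
  simp only [smul_eq_mul, nsmul_eq_mul] at h
  push_cast at h
  have hne : (864 * PowerSeries.X * phi ^ 6 : QSer) ≠ 0 := by
    refine mul_ne_zero (mul_ne_zero ?_ PowerSeries.X_ne_zero)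
      (pow_ne_zero _ (ne_zero_of_const constantCoeff_phi))
    intro h0
    have h5 := congrArg PowerSeries.constantCoeff h0
    rw [map_zero, show PowerSeries.constantCoeff (864 : QSer) = 864 from map_ofNat _ _] at h5
    norm_num at h5
  refine mul_left_cancel₀ hne ?_
  linear_combination (norm := algebra) -h -
    (1 / 2 : ℚ) • ((1 - 864 * PowerSeries.X) * phi ^ 2 * qDeriv_phi_pow_four)

/-- Ramanujan's equation for `E₄^{1/4}` in the coordinate `z₁`. -/
theorem qDeriv_phi : 12 * ((1 - 432 * PowerSeries.X) * phi * qDeriv phi) =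
    tild (eisenstein 2) - (1 - 864 * PowerSeries.X) * phi ^ 2 := by
  refine mul_left_cancel₀ (pow_ne_zero 4 (ne_zero_of_const constantCoeff_phi)) ?_
  linear_combination ((1 - 432 * PowerSeries.X) * phi ^ 2) * qDeriv_phi_pow_four +
    phi ^ 4 * (tild (eisenstein 2) - (1 - 864 * PowerSeries.X) * phi ^ 2) * lam_mul

/-- Ramanujan's equation for `E₂` in the coordinate `z₁`. -/
theorem qDeriv_tild_E₂ : 12 * ((1 - 432 * PowerSeries.X) * phi ^ 2 *
    qDeriv (tild (eisenstein 2))) = tild (eisenstein 2) ^ 2 - phi ^ 4 := by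
  rw [qDeriv_tild, ramanujan_E₂, map_rat_smul, map_sub, map_mul, tild_E₄]
  linear_combination (norm := algebra) (tild (eisenstein 2) ^ 2 - phi ^ 4) * lam_mul

/-- `E₄(q̃)^{1/4}` solves the hypergeometric differential equation of the elliptic fibre. It follows
from Ramanujan's equations for `E₄` and `E₂` by elimination of `E₂`. -/
theorem hypergeometric_phi : (1 - 432 * PowerSeries.X) * qDeriv (qDeriv phi) =
    432 * (PowerSeries.X * qDeriv phi) + 60 * (PowerSeries.X * phi) := by
  have h1 := qDeriv_phi
  have h2 := qDeriv_tild_E₂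
  have h := congrArg qDeriv qDeriv_phi
  have h864 : qDeriv (864 : QSer) = 0 := qDeriv_ofNat 864
  have h432 : qDeriv (432 : QSer) = 0 := qDeriv_ofNat 432
  have h12 : qDeriv (12 : QSer) = 0 := qDeriv_ofNat 12
  simp only [Derivation.leibniz, Derivation.leibniz_pow, map_sub, qDeriv_X, h864, h432, h12,
    Derivation.map_one_eq_zero, smul_eq_mul, nsmul_eq_mul] at h
  push_cast at h
  have hne : (144 * ((1 - 432 * PowerSeries.X) * phi ^ 3) : QSer) ≠ 0 := by
    intro h0
    have h5 := congrArg PowerSeries.constantCoeff h0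
    rw [map_zero, map_mul, show PowerSeries.constantCoeff (144 : QSer) = 144 from map_ofNat _ _]
      at h5
    simp [constantCoeff_phi] at h5
  refine mul_left_cancel₀ hne ?_
  linear_combination (12 * ((1 - 432 * PowerSeries.X) * phi ^ 2)) * h + h2 -
    (12 * ((1 - 432 * PowerSeries.X) * phi * qDeriv phi) +
      (1 - 864 * PowerSeries.X) * phi ^ 2 + tild (eisenstein 2)) * h1

end ModularParameter

/-! ### The logarithmic derivations -/

section ThetaOperators

/-- `thetaZ i` as a derivation. -/
def thZ (i : Fin 2) : Derivation ℚ ZSer ZSer :=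
  (MvPowerSeries.X i : ZSer) • MvPowerSeries.pderiv ℚ i

theorem thZ_apply (i : Fin 2) (f : ZSer) : thZ i f = thetaZ i f := rfl

theorem coeff_thZ (i : Fin 2) (f : ZSer) (m : Fin 2 →₀ ℕ) :
    MvPowerSeries.coeff m (thZ i f) = m i * MvPowerSeries.coeff m f := by
  rw [thZ_apply, thetaZ]
  rw [MvPowerSeries.X, MvPowerSeries.coeff_monomial_mul, one_mul, MvPowerSeries.coeff_pderiv]
  split_ifs with h
  · have h1 : 1 ≤ m i := by simpa using h i
    rw [tsub_add_cancel_of_le h, Finsupp.tsub_apply, Finsupp.single_eq_same, Nat.cast_sub h1]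
    push_cast
    ring
  · have h1 : m i = 0 := by
      by_contra h2
      refine h (Finsupp.single_le_iff.mpr (Nat.one_le_iff_ne_zero.mpr h2))
    rw [h1, Nat.cast_zero, zero_mul]

theorem thZ_comm (f : ZSer) : thZ 0 (thZ 1 f) = thZ 1 (thZ 0 f) := by
  ext m
  simp only [coeff_thZ]
  ring

theorem thZ_z (i j : Fin 2) : thZ i (z j) = if i = j then z j else 0 := by
  rw [thZ_apply, thetaZ, z, MvPowerSeries.pderiv_X]
  split_ifs <;> simp_all

/-- `theta i` as a derivation. -/
def thL (i : Fin 2) : Derivation ℚ LogSer LogSer :=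
  have hc : ∀ (p : LogSer) (n : Fin 2 →₀ ℕ), MvPolynomial.coeff n (∑ m ∈ p.support,
      MvPolynomial.monomial m (thetaZ i (MvPolynomial.coeff m p))) =
      thZ i (MvPolynomial.coeff n p) := by
    intro p n
    rw [MvPolynomial.coeff_sum]
    simp only [MvPolynomial.coeff_monomial]
    rw [Finset.sum_ite_eq']
    split_ifs with h
    · rfl
    · rw [MvPolynomial.notMem_support_iff.mp h, map_zero]
  Derivation.mk'
    { toFun := fun w => ∑ m ∈ w.support,
        MvPolynomial.monomial m (thetaZ i (MvPolynomial.coeff m w))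
      map_add' := fun a b => by
        ext1 n
        rw [MvPolynomial.coeff_add, hc, hc, hc, MvPolynomial.coeff_add, map_add]
      map_smul' := fun r a => by
        ext1 n
        rw [RingHom.id_apply, MvPolynomial.coeff_smul, hc, hc, MvPolynomial.coeff_smul,
          map_rat_smul] }
    (fun a b => by
      classical
      ext1 n
      simp only [LinearMap.coe_mk, AddHom.coe_mk]
      rw [hc, MvPolynomial.coeff_add, smul_eq_mul, smul_eq_mul, MvPolynomial.coeff_mul,
        MvPolynomial.coeff_mul, MvPolynomial.coeff_mul, map_sum]
      simp only [hc, Derivation.leibniz, smul_eq_mul, Finset.sum_add_distrib]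
      congr 1
      exact Finset.sum_equiv (Equiv.prodComm _ _)
        (fun p => by simp [Finset.HasAntidiagonal.mem_antidiagonal, add_comm]) (fun _ _ => rfl)) +
    (MvPolynomial.pderiv i : Derivation ZSer LogSer LogSer).restrictScalars ℚ

theorem thL_apply (i : Fin 2) (w : LogSer) : thL i w = theta i w := rfl

@[simp] theorem thL_C (i : Fin 2) (f : ZSer) :
    thL i (MvPolynomial.C f) = MvPolynomial.C (thZ i f) := by
  classical
  rw [thL_apply, theta, MvPolynomial.pderiv_C, add_zero]
  ext1 n
  rw [MvPolynomial.coeff_sum]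
  simp only [MvPolynomial.coeff_monomial]
  have h : ∀ g : LogSer, (if n ∈ g.support then thetaZ i (MvPolynomial.coeff n g) else 0) =
      thZ i (MvPolynomial.coeff n g) := by
    intro g
    split_ifs with h
    · rfl
    · rw [MvPolynomial.notMem_support_iff.mp h, map_zero]
  rw [Finset.sum_ite_eq', h, MvPolynomial.coeff_C, MvPolynomial.coeff_C]
  split_ifs
  · rfl
  · exact map_zero _

@[simp] theorem thL_X (i j : Fin 2) :
    thL i (MvPolynomial.X j) = if i = j then 1 else 0 := by
  classical
  rw [thL_apply, theta, MvPolynomial.pderiv_X, MvPolynomial.support_X, Finset.sum_singleton,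
    MvPolynomial.coeff_X, if_pos rfl, ← thZ_apply, Derivation.map_one_eq_zero, map_zero, zero_add]
  simp [Pi.single_apply, eq_comm]

theorem derivation_ext_logSer {d d' : Derivation ℚ LogSer LogSer}
    (hC : ∀ a, d (MvPolynomial.C a) = d' (MvPolynomial.C a))
    (hX : ∀ i, d (MvPolynomial.X i) = d' (MvPolynomial.X i)) (p : LogSer) : d p = d' p := by
  induction p using MvPolynomial.induction_on with
  | C a => exact hC a
  | add p q hp hq => rw [map_add, map_add, hp, hq]
  | mul_X p i hp => rw [Derivation.leibniz, Derivation.leibniz, hp, hX]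

theorem thL_comm (w : LogSer) : thL 0 (thL 1 w) = thL 1 (thL 0 w) := by
  have := derivation_ext_logSer (d := ⁅thL 0, thL 1⁆) (d' := 0)
    (fun a => by simp [Derivation.commutator_apply, thZ_comm])
    (fun i => by fin_cases i <;> simp [Derivation.commutator_apply]) w
  rw [Derivation.commutator_apply] at this
  exact sub_eq_zero.mp this

end ThetaOperators

/-! ### Modular coordinates on the moduli space -/

section ModularCoordinates

theorem constantCoeff_z (i : Fin 2) : MvPowerSeries.constantCoeff (z i) = 0 := by simp [z]

/-- Power series in `z₁` as power series in `z₁`, `z₂`. -/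
def iot : QSer →+* ZSer := subHom (z 0) (constantCoeff_z 0)

theorem iot_apply (f : QSer) : iot f = Periods.inZ₁ f := subHom_apply _ f

@[simp] theorem iot_X : iot PowerSeries.X = z 0 := subHom_X _

theorem constantCoeff_iot (f : QSer) :
    MvPowerSeries.constantCoeff (iot f) = PowerSeries.constantCoeff f := constantCoeff_subHom _ f

theorem thZ_zero_iot (f : QSer) : thZ 0 (iot f) = iot (qDeriv f) := by
  have h := derivation_subHom (thZ 0) (constantCoeff_z 0) (l := 1) (by simp [thZ_z]) f
  rwa [mul_one] at h

theorem thZ_one_iot (f : QSer) : thZ 1 (iot f) = 0 := by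
  have h := derivation_subHom (thZ 1) (constantCoeff_z 0) (l := 0) (by simp [thZ_z]) f
  rwa [mul_zero] at h

/-- The inverse of `(1 - 432 z₁) E₄(q̃)^{3/2} = (E₄(q̃)^{3/2} + E₆(q̃)) / 2`. -/
def mInv : QSer := ((1 - 432 * PowerSeries.X) * phi ^ 6)⁻¹

theorem mul_mInv : (1 - 432 * PowerSeries.X) * phi ^ 6 * mInv = 1 :=
  mul_inv_of_const (by simp [constantCoeff_phi])

/-- The Picard-Fuchs data on power series. -/
def zPF : PFData ZSer where
  θ₀ := thZ 0
  θ₁ := thZ 1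
  z₁ := z 0
  z₂ := z 1
  φ := iot phi
  E₂ := iot (tild (eisenstein 2))
  mi := iot mInv
  comm := thZ_comm
  θ₀z₁ := by simp [thZ_z]
  θ₁z₁ := by simp [thZ_z]
  θ₀z₂ := by simp [thZ_z]
  θ₁z₂ := by simp [thZ_z]
  θ₁φ := thZ_one_iot _
  θ₁E₂ := thZ_one_iot _
  θ₀φ := by
    have h := congrArg iot qDeriv_phi
    simpa only [map_mul, map_sub, map_one, map_ofNat, map_pow, iot_X, thZ_zero_iot] using h
  θ₀E₂ := by
    have h := congrArg iot qDeriv_tild_E₂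
    simpa only [map_mul, map_sub, map_one, map_ofNat, map_pow, iot_X, thZ_zero_iot] using h
  hyper := by
    have h := congrArg iot hypergeometric_phi
    simpa only [map_mul, map_add, map_sub, map_one, map_ofNat, map_pow, iot_X, thZ_zero_iot] using h
  mul_mi := by
    have h := congrArg iot mul_mInv
    simpa only [map_mul, map_sub, map_one, map_ofNat, map_pow, iot_X] using h

/-- The Picard-Fuchs data on polynomials in the logarithms. -/
def logPF : PFData LogSer where
  θ₀ := thL 0
  θ₁ := thL 1
  z₁ := MvPolynomial.C (z 0)
  z₂ := MvPolynomial.C (z 1)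
  φ := MvPolynomial.C (iot phi)
  E₂ := MvPolynomial.C (iot (tild (eisenstein 2)))
  mi := MvPolynomial.C (iot mInv)
  comm := thL_comm
  θ₀z₁ := by rw [thL_C]; exact congrArg _ zPF.θ₀z₁
  θ₁z₁ := by rw [thL_C]; exact (congrArg _ zPF.θ₁z₁).trans (map_zero _)
  θ₀z₂ := by rw [thL_C]; exact (congrArg _ zPF.θ₀z₂).trans (map_zero _)
  θ₁z₂ := by rw [thL_C]; exact congrArg _ zPF.θ₁z₂
  θ₁φ := by rw [thL_C]; exact (congrArg _ zPF.θ₁φ).trans (map_zero _)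
  θ₁E₂ := by rw [thL_C]; exact (congrArg _ zPF.θ₁E₂).trans (map_zero _)
  θ₀φ := by
    have h := congrArg (MvPolynomial.C (σ := Fin 2)) zPF.θ₀φ
    simp only [map_mul, map_sub, map_one, map_ofNat, map_pow] at h
    simp only [thL_C]
    exact h
  θ₀E₂ := by
    have h := congrArg (MvPolynomial.C (σ := Fin 2)) zPF.θ₀E₂
    simp only [map_mul, map_sub, map_one, map_ofNat, map_pow] at h
    simp only [thL_C]
    exact h
  hyper := by
    have h := congrArg (MvPolynomial.C (σ := Fin 2)) zPF.hyper
    simp only [map_mul, map_add, map_sub, map_one, map_ofNat] at h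
    simp only [thL_C]
    exact h
  mul_mi := by
    have h := congrArg (MvPolynomial.C (σ := Fin 2)) zPF.mul_mi
    simp only [map_mul, map_sub, map_one, map_ofNat, map_pow] at h
    exact h

end ModularCoordinates

/-! ### Solutions of the Picard-Fuchs system -/

section PicardFuchsOperators

theorem opL₁_eq (w : LogSer) : opL₁ w = logPF.L₁ w := by
  rw [logPF.L₁_eq, opL₁, map_mul, map_ofNat]
  rfl

theorem opL₂_eq (w : LogSer) : opL₂ w = logPF.L₂ w := by
  have h : ∀ w : LogSer, linOp 0 1 0 w = logPF.θ₁ w := by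
    intro w
    rw [linOp, zero_smul, one_smul, zero_smul, zero_add, add_zero]
    rfl
  rw [opL₂, h, h, h, PFData.L₂, logPF.lin_eq, logPF.lin_eq, logPF.lin_eq]
  rfl

theorem isSolution_add {v w : LogSer} (hv : IsSolution v) (hw : IsSolution w) :
    IsSolution (v + w) :=
  ⟨by rw [opL₁_eq, PFData.L₁_add, ← opL₁_eq, ← opL₁_eq, hv.1, hw.1, add_zero],
    by rw [opL₂_eq, PFData.L₂_add, ← opL₂_eq, ← opL₂_eq, hv.2, hw.2, add_zero]⟩

theorem isSolution_smul (r : ℚ) {w : LogSer} (hw : IsSolution w) : IsSolution (r • w) :=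
  ⟨by rw [opL₁_eq, PFData.L₁_smul, ← opL₁_eq, hw.1, smul_zero],
    by rw [opL₂_eq, PFData.L₂_smul, ← opL₂_eq, hw.2, smul_zero]⟩

theorem isSolution_sub {v w : LogSer} (hv : IsSolution v) (hw : IsSolution w) :
    IsSolution (v - w) := by
  have h := isSolution_add hv (isSolution_smul (-1) hw)
  rwa [neg_one_smul, ← sub_eq_add_neg] at h

/-- Solutions of the Picard-Fuchs system in modular coordinates yield solutions of the
original system on multiplication by `E₄^{1/4}`. -/
theorem isSolution_phi_mul {w : LogSer} (h1 : logPF.system.box 0 w = 0)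
    (h2 : logPF.system.Solves w) : IsSolution (MvPolynomial.C (iot phi) * w) := by
  constructor
  · have h := logPF.L₁_φ_mul w
    rw [h1] at h
    rw [opL₁_eq]
    refine (mul_eq_zero.mp h).resolve_left ?_
    have h3 : (1 - 432 * logPF.z₁) * logPF.φ ^ 3 =
        MvPolynomial.C (iot ((1 - 432 * PowerSeries.X) * phi ^ 3)) := by
      simp only [logPF, map_mul, map_sub, map_one, map_ofNat, map_pow, iot_X]
    rw [h3]
    intro h4
    have h5 := congrArg MvPowerSeries.constantCoeff (MvPolynomial.C_injective _ _
      (h4.trans (map_zero _).symm))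
    rw [constantCoeff_iot] at h5
    simp [constantCoeff_phi] at h5
  · have h := logPF.L₂_φ_mul w
    rw [opL₂_eq]
    refine h.trans ?_
    have h3 : logPF.θ₁ (logPF.θ₁ (logPF.θ₁ w)) = logPF.z₂ * logPF.mi ^ 3 * logPF.system.cubic w :=
      h2
    rw [h3, sub_self, mul_zero]

end PicardFuchsOperators

/-! ### Evaluation of modular solutions -/

section EvaluationMap

/-- A quasi-modular form at `q̃`, as a power series in `z₁`, `z₂`. -/
def evK : QM →+* ZSer := (iot.comp tild).comp qexp.toRingHom

theorem evK_apply (p : QM) : evK p = iot (tild (qexp p)) := rfl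

/-- The value `z₂ / ((1 - 432 z₁) E₄(q̃)^{3/2})³` of the variable `Y`. -/
def yVal : ZSer := z 1 * iot mInv ^ 3

theorem constantCoeff_yVal : MvPowerSeries.constantCoeff yVal = 0 := by
  rw [yVal, map_mul, constantCoeff_z, zero_mul]

/-- Evaluation at `q̃` and at `Y = z₂ / ((1 - 432 z₁) E₄(q̃)^{3/2})³`. -/
def ev : PowerSeries QM →+* ZSer := evalHom evK yVal constantCoeff_yVal

@[simp] theorem ev_C (p : QM) : ev (PowerSeries.C p) = evK p := evalHom_C _ _ p

@[simp] theorem ev_X : ev PowerSeries.X = yVal := evalHom_X _ _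

theorem evK_e₂ : evK e₂ = iot (tild (eisenstein 2)) := by rw [evK_apply, qexp_e₂]

theorem evK_e₄ : evK e₄ = zPF.system.E₄ := by
  rw [evK_apply, qexp_e₄, tild_E₄, map_pow]; rfl

theorem evK_e₆ : evK e₆ = zPF.system.E₆ := by
  rw [evK_apply, qexp_e₆, tild_E₆, map_mul, map_sub, map_mul, map_pow, map_one, map_ofNat, iot_X]
  rfl

theorem constantCoeff_ev (a : PowerSeries QM) : MvPowerSeries.constantCoeff (ev a) =
    MvPowerSeries.constantCoeff (evK (PowerSeries.constantCoeff a)) :=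
  constantCoeff_evalHom _ _ a

theorem D₁_evK (p : QM) : zPF.system.D₁ (evK p) = evK (ram p) := by
  have h2 : evK e₂ = zPF.system.E₂ := evK_e₂
  have := IsLeibniz.ext_mvPolynomial (φ := evK)
    (d := (derAdd zPF.system.D₁).comp evK.toAddMonoidHom)
    (d' := evK.toAddMonoidHom.comp (derAdd ram))
    (fun a b => by simp) (fun a b => by simp) (fun i => by
      fin_cases i
      · change zPF.system.D₁ (evK e₂) = evK (ram e₂)
        rw [h2, zPF.system.D₁E₂, ram_e₂, map_rat_smul, map_sub, map_mul, h2, evK_e₄]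
      · change zPF.system.D₁ (evK e₄) = evK (ram e₄)
        rw [evK_e₄, zPF.system.D₁E₄, ram_e₄, map_rat_smul, map_sub, map_mul, h2, evK_e₄, evK_e₆]
      · change zPF.system.D₁ (evK e₆) = evK (ram e₆)
        rw [evK_e₆, zPF.system.D₁E₆, ram_e₆, map_rat_smul, map_sub, map_mul, map_mul, h2, evK_e₄,
          evK_e₆])
  exact DFunLike.congr_fun this p

theorem D₂_evK (p : QM) : zPF.system.D₂ (evK p) = 0 := thZ_one_iot _

/-- Evaluation as a homomorphism of modular systems. -/
def evSystem : SystemHom serSystem.toModularSystem zPF.system where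
  toRingHom := ev
  map_D₁ a := by
    have hX : serSystem.D₁ PowerSeries.X =
        (-(3 / 2) : ℚ) • (PowerSeries.C e₂ * PowerSeries.X) := serSystem.D₁Y
    have hC : ∀ k, serSystem.D₁ (PowerSeries.C k) = PowerSeries.C (ram k) := fun k => by
      simp [serSystem, qDeriv_C]
    have hY : zPF.system.D₁ yVal = (-(3 / 2) : ℚ) • (evK e₂ * yVal) := by
      rw [evK_e₂]; exact zPF.system.D₁Y
    have := IsLeibniz.ext_powerSeries (φ := ev)
      (d := ev.toAddMonoidHom.comp (derAdd serSystem.D₁))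
      (d' := (derAdd zPF.system.D₁).comp ev.toAddMonoidHom)
      (fun a b => by simp) (fun a b => by simp)
      (by rw [ev_X]; exact constantCoeff_yVal)
      (fun k => by simp [hC, D₁_evK])
      (by
        change ev (serSystem.D₁ PowerSeries.X) = zPF.system.D₁ (ev PowerSeries.X)
        rw [hX, map_rat_smul, map_mul, ev_C, ev_X, hY])
    exact DFunLike.congr_fun this a
  map_D₂ a := by
    have hX : serSystem.D₂ PowerSeries.X = PowerSeries.X := serSystem.D₂Y
    have hC : ∀ k, serSystem.D₂ (PowerSeries.C k) = 0 := fun k => by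
      simp [serSystem, qDeriv_C]
    have hY : zPF.system.D₂ yVal = yVal := zPF.system.D₂Y
    have := IsLeibniz.ext_powerSeries (φ := ev)
      (d := ev.toAddMonoidHom.comp (derAdd serSystem.D₂))
      (d' := (derAdd zPF.system.D₂).comp ev.toAddMonoidHom)
      (fun a b => by simp) (fun a b => by simp)
      (by rw [ev_X]; exact constantCoeff_yVal)
      (fun k => by simp [hC, D₂_evK])
      (by simp [hX, hY])
    exact DFunLike.congr_fun this a
  map_E₂ := (ev_C _).trans evK_e₂
  map_E₄ := (ev_C _).trans evK_e₄
  map_E₆ := (ev_C _).trans evK_e₆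
  map_Y := ev_X

/-- The inclusion of power series into polynomials in the logarithms. -/
def constSystem : SystemHom zPF.system logPF.system where
  toRingHom := MvPolynomial.C
  map_D₁ a := by
    simp only [PFData.system, zPF, logPF, Derivation.sub_apply, Derivation.smul_apply, thL_C,
      smul_eq_mul, map_sub, map_mul, map_rat_smul, map_pow, map_one, map_ofNat]
  map_D₂ a := (thL_C 1 a).symm
  map_E₂ := rfl
  map_E₄ := by
    simp only [PFData.system, zPF, logPF, map_pow]
  map_E₆ := by
    simp only [PFData.system, zPF, logPF, map_mul, map_sub, map_pow, map_one, map_ofNat]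
  map_Y := by
    simp only [PFData.system, zPF, logPF, map_mul, map_pow]

/-- Evaluation with values in polynomials in the logarithms. -/
def evLog : SystemHom serSystem.toModularSystem logPF.system where
  toRingHom := (MvPolynomial.C : ZSer →+* LogSer).comp ev
  map_D₁ a := (congrArg MvPolynomial.C (evSystem.map_D₁ a)).trans (constSystem.map_D₁ _)
  map_D₂ a := (congrArg MvPolynomial.C (evSystem.map_D₂ a)).trans (constSystem.map_D₂ _)
  map_E₂ := (congrArg MvPolynomial.C evSystem.map_E₂).trans constSystem.map_E₂
  map_E₄ := (congrArg MvPolynomial.C evSystem.map_E₄).trans constSystem.map_E₄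
  map_E₆ := (congrArg MvPolynomial.C evSystem.map_E₆).trans constSystem.map_E₆
  map_Y := (congrArg MvPolynomial.C evSystem.map_Y).trans constSystem.map_Y

theorem evLog_apply (a : PowerSeries QM) : evLog.toRingHom a = MvPolynomial.C (ev a) := rfl

/-- The series `log (1 - 432 z₁)`. -/
def logDiscr : QSer := PowerSeries.logOf (1 - 432 * PowerSeries.X : QSer)

theorem constantCoeff_logDiscr : PowerSeries.constantCoeff logDiscr = 0 :=
  PowerSeries.constantCoeff_logOf (by simp)

theorem qDeriv_logDiscr : (1 - 432 * PowerSeries.X) * qDeriv logDiscr = -(432 * PowerSeries.X) := by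
  have h1 : PowerSeries.constantCoeff (1 - 432 * PowerSeries.X : QSer) = 1 := by simp
  have h0 := const_serLog (σ := Unit) (A := ℚ) h1
  have h := IsLeibniz.serExp (σ := Unit) (τ := Unit) (A := ℚ) (B := ℚ)
    (derAdd_isLeibniz (qDeriv (R := ℚ))) h0 h0
  rw [serExp_serLog (σ := Unit) (A := ℚ) h1] at h
  refine h.symm.trans ?_
  change qDeriv (1 - 432 * PowerSeries.X : QSer) = _
  rw [map_sub, Derivation.map_one_eq_zero, Derivation.leibniz, qDeriv_X,
    show qDeriv (432 : QSer) = 0 from qDeriv_ofNat 432]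
  simp

/-- The value `log z₂ + (3/2) log (z₁ / (1 - 432 z₁))` of the variable `ℓ`. It is chosen such that
`D₁` annihilates it. -/
def logU : LogSer := MvPolynomial.X 1 + (3 / 2 : ℚ) • MvPolynomial.X 0 -
  (3 / 2 : ℚ) • MvPolynomial.C (iot logDiscr)

theorem D₁_logU : logPF.system.D₁ logU = 0 := by
  have h := congrArg (fun f => MvPolynomial.C (σ := Fin 2) (iot f)) qDeriv_logDiscr
  simp only [map_mul, map_sub, map_neg, map_one, map_ofNat, iot_X] at h
  have h0 : thL 0 logU = (3 / 2 : ℚ) • (1 : LogSer) -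
      (3 / 2 : ℚ) • MvPolynomial.C (iot (qDeriv logDiscr)) := by
    rw [logU, map_sub, map_add, map_rat_smul, map_rat_smul, thL_X, thL_X, thL_C, thZ_zero_iot]
    simp
  have h1 : thL 1 logU = 1 := by
    rw [logU, map_sub, map_add, map_rat_smul, map_rat_smul, thL_X, thL_X, thL_C, thZ_one_iot]
    simp
  have h2 : logPF.system.D₁ logU =
      (1 - 432 * MvPolynomial.C (z 0)) * MvPolynomial.C (iot phi) ^ 2 * thL 0 logU -
        (3 / 2 : ℚ) • (MvPolynomial.C (iot phi) ^ 2 * thL 1 logU) := rfl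
  rw [h2, h0, h1]
  generalize (MvPolynomial.C (iot (qDeriv logDiscr)) : LogSer) = a at h ⊢
  generalize (MvPolynomial.C (iot phi) : LogSer) = b
  generalize (MvPolynomial.C (z 0) : LogSer) = c at h ⊢
  linear_combination (norm := algebra) (-(3 / 2) : ℚ) • (b ^ 2 * h)

theorem D₂_logU : logPF.system.D₂ logU = 1 := by
  change thL 1 logU = 1
  rw [logU, map_sub, map_add, map_rat_smul, map_rat_smul, thL_X, thL_X, thL_C, thZ_one_iot]
  simp

/-- Evaluation of series with a logarithm. -/
def evLogHom : Polynomial (PowerSeries QM) →+* LogSer :=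
  Polynomial.eval₂RingHom ((MvPolynomial.C : ZSer →+* LogSer).comp ev) logU

@[simp] theorem evLogHom_C (a : PowerSeries QM) :
    evLogHom (Polynomial.C a) = MvPolynomial.C (ev a) := by simp [evLogHom]

@[simp] theorem evLogHom_X : evLogHom Polynomial.X = logU := by simp [evLogHom]

/-- Evaluation of series with a logarithm as a homomorphism of modular systems. -/
def evLogSystem : SystemHom logSystem.toModularSystem logPF.system where
  toRingHom := evLogHom
  map_D₁ a := by
    have := IsLeibniz.ext_polynomial (φ := evLogHom)
      (d := evLogHom.toAddMonoidHom.comp (derAdd logSystem.D₁))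
      (d' := (derAdd logPF.system.D₁).comp evLogHom.toAddMonoidHom)
      (fun a b => by simp) (fun a b => by simp)
      (fun k => by
        have h := evLog.map_D₁ k
        rw [evLog_apply, evLog_apply] at h
        simp [GradedSystem.adjoinLog, h])
      (by simp [GradedSystem.adjoinLog, D₁_logU])
    exact DFunLike.congr_fun this a
  map_D₂ a := by
    have := IsLeibniz.ext_polynomial (φ := evLogHom)
      (d := evLogHom.toAddMonoidHom.comp (derAdd logSystem.D₂))
      (d' := (derAdd logPF.system.D₂).comp evLogHom.toAddMonoidHom)
      (fun a b => by simp) (fun a b => by simp)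
      (fun k => by
        have h := evLog.map_D₂ k
        rw [evLog_apply, evLog_apply] at h
        simp [GradedSystem.adjoinLog, h])
      (by simp [GradedSystem.adjoinLog, D₂_logU])
    exact DFunLike.congr_fun this a
  map_E₂ := (evLogHom_C _).trans evLog.map_E₂
  map_E₄ := (evLogHom_C _).trans evLog.map_E₄
  map_E₆ := (evLogHom_C _).trans evLog.map_E₆
  map_Y := (evLogHom_C _).trans evLog.map_Y

theorem evLogHom_linLog (a b : PowerSeries QM) :
    evLogHom (linLog a b) = logU * MvPolynomial.C (ev a) + MvPolynomial.C (ev b) := by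
  rw [linLog, map_add, map_mul, evLogHom_C, evLogHom_C, evLogHom_X, mul_comm]

/-- `log q̃`. -/
def logQt : LogSer := MvPolynomial.X 0 + MvPolynomial.C (iot tau)

theorem D₁_logQt : logPF.system.D₁ logQt = 1 := by
  have h := congrArg (fun f => MvPolynomial.C (σ := Fin 2) (iot f)) lam_mul
  simp only [map_mul, map_sub, map_one, map_ofNat, map_pow, iot_X] at h
  have h0 : thL 0 logQt = MvPolynomial.C (iot lam) := by
    rw [logQt, map_add, thL_X, thL_C, thZ_zero_iot, lam, map_add, map_one, map_add, map_one]
    simp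
  have h1 : thL 1 logQt = 0 := by
    rw [logQt, map_add, thL_X, thL_C, thZ_one_iot]
    simp
  have h2 : logPF.system.D₁ logQt =
      (1 - 432 * MvPolynomial.C (z 0)) * MvPolynomial.C (iot phi) ^ 2 * thL 0 logQt -
        (3 / 2 : ℚ) • (MvPolynomial.C (iot phi) ^ 2 * thL 1 logQt) := rfl
  rw [h2, h0, h1, mul_zero, smul_zero, sub_zero, h]

theorem D₂_logQt : logPF.system.D₂ logQt = 0 := by
  change thL 1 logQt = 0
  rw [logQt, map_add, thL_X, thL_C, thZ_one_iot]
  simp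

end EvaluationMap

/-! ### The periods -/

section Solutions

/-- The holomorphic solutions. -/
theorem isSolution_evLog {w : PowerSeries QM} (h1 : serSystem.box 0 w = 0)
    (h2 : serSystem.Solves w) :
    IsSolution (MvPolynomial.C (iot phi) * MvPolynomial.C (ev w)) := by
  refine isSolution_phi_mul ?_ (evLog.map_solves h2)
  rw [← evLog_apply, ← evLog.map_box, h1, map_zero]

/-- The solutions with `log q̃`. -/
theorem isSolution_lift {w : PowerSeries QM} (hW : serSystem.W w = 0)
    (h1 : serSystem.box 0 w = 0) (h2 : serSystem.Solves w) :
    IsSolution (MvPolynomial.C (iot phi) * (logQt * MvPolynomial.C (ev w) +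
      (12 : ℚ) • MvPolynomial.C (ev (serSystem.del w)))) :=
  isSolution_phi_mul (evLog.lift_box D₁_logQt D₂_logQt hW h1)
    (evLog.lift_solves D₁_logQt D₂_logQt hW h2)

theorem W_linLog_fundamental : logSystem.W (linLog solN solM) = 0 := by
  rw [GradedSystem.adjoinLog_W_linLog, W_fundamental.1, W_fundamental.2]
  simp [linLog]

/-- The logarithmic solution. -/
theorem isSolution_log : IsSolution (MvPolynomial.C (iot phi) *
    (logU * MvPolynomial.C (ev solN) + MvPolynomial.C (ev solM))) := by
  rw [← evLogHom_linLog]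
  refine isSolution_phi_mul ?_ (evLogSystem.map_solves solves_fundamental)
  have h := evLogSystem.map_box (linLog solN solM)
  rw [box_fundamental, map_zero] at h
  exact h.symm

/-- The double-logarithmic solution. -/
theorem isSolution_doubleLog : IsSolution (MvPolynomial.C (iot phi) *
    (logQt * (logU * MvPolynomial.C (ev solN) + MvPolynomial.C (ev solM)) +
      (12 : ℚ) • (logU * MvPolynomial.C (ev (serSystem.del solN)) +
        MvPolynomial.C (ev (serSystem.del solM))))) := by
  rw [← evLogHom_linLog, ← evLogHom_linLog, ← GradedSystem.adjoinLog_del_linLog]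
  exact isSolution_phi_mul
    (evLogSystem.lift_box D₁_logQt D₂_logQt W_linLog_fundamental box_fundamental)
    (evLogSystem.lift_solves D₁_logQt D₂_logQt W_linLog_fundamental solves_fundamental)

/-- The normalised periods, with `X₁` the lift of `X₀` and `X₂` the logarithmic solution minus
`(3/2) X₁`. -/
def periods : Periods where
  X₀ := iot phi * ev solN
  S₁ := iot phi * (iot tau * ev solN + (12 : ℚ) • ev (serSystem.del solN))
  S₂ := iot phi * ev solM -
    (3 / 2 : ℚ) • (iot phi * (iot tau * ev solN + (12 : ℚ) • ev (serSystem.del solN))) -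
    (3 / 2 : ℚ) • (iot phi * ev solN * iot logDiscr)

theorem constantCoeff_iot_tau : MvPowerSeries.constantCoeff (iot tau) = 0 := by
  rw [constantCoeff_iot, constantCoeff_tau]

theorem constantCoeff_del_solN : PowerSeries.constantCoeff (serSystem.del solN) = 0 := by
  simp [serSystem, constantCoeff_solN]

theorem isNormalized_periods : periods.IsNormalized where
  constX₀ := by
    simp [periods, constantCoeff_iot, constantCoeff_ev, constantCoeff_phi, constantCoeff_solN]
  constS₁ := by
    rw [periods, map_mul, map_add, map_mul, constantCoeff_iot_tau, map_rat_smul,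
      constantCoeff_ev solN, constantCoeff_ev (serSystem.del solN), constantCoeff_del_solN]
    simp
  constS₂ := by
    rw [periods, map_sub, map_sub, map_mul, constantCoeff_ev solM, constantCoeff_solM, map_rat_smul,
      map_mul, map_add, map_mul, constantCoeff_iot_tau, map_rat_smul,
      constantCoeff_ev (serSystem.del solN), constantCoeff_del_solN, map_rat_smul,
      map_mul _ _ (iot logDiscr), constantCoeff_iot logDiscr,
      constantCoeff_logDiscr]
    simp
  solX₀ := by
    have h := isSolution_evLog box_solN solves_solN
    rwa [← map_mul] at h
  solX₁ := by
    have h := isSolution_lift W_fundamental.1 box_solN solves_solN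
    convert h using 1
    simp only [periods, logQt, map_mul, map_add, map_rat_smul]
    generalize (MvPolynomial.C (iot phi) : LogSer) = a
    generalize (MvPolynomial.C (iot tau) : LogSer) = b
    generalize (MvPolynomial.C (ev solN) : LogSer) = c
    generalize (MvPolynomial.C (ev (serSystem.del solN)) : LogSer) = d
    algebra
  solX₂ := by
    have h1 := isSolution_lift W_fundamental.1 box_solN solves_solN
    have h := isSolution_sub isSolution_log (isSolution_smul (3 / 2) h1)
    convert h using 1
    simp only [periods, logQt, logU, map_mul, map_add, map_sub, map_rat_smul]
    generalize (MvPolynomial.C (iot phi) : LogSer) = a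
    generalize (MvPolynomial.C (iot tau) : LogSer) = b
    generalize (MvPolynomial.C (ev solN) : LogSer) = c
    generalize (MvPolynomial.C (ev (serSystem.del solN)) : LogSer) = d
    generalize (MvPolynomial.C (ev solM) : LogSer) = e
    generalize (MvPolynomial.C (iot logDiscr) : LogSer) = f
    generalize (MvPolynomial.X 0 : LogSer) = x
    generalize (MvPolynomial.X 1 : LogSer) = y
    algebra

end Solutions

/-! ### Uniqueness of the periods -/

section Uniqueness

theorem coeff_z_mul_eq_zero (i : Fin 2) {g : ZSer} {m : Fin 2 →₀ ℕ}
    (h : ∀ m', Finsupp.degree m' < Finsupp.degree m → MvPowerSeries.coeff m' g = 0) :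
    MvPowerSeries.coeff m (z i * g) = 0 := by
  classical
  rw [MvPowerSeries.coeff_mul]
  refine Finset.sum_eq_zero fun x hx => ?_
  have hd : x.1 + x.2 = m := Finset.HasAntidiagonal.mem_antidiagonal.mp hx
  by_cases h1 : x.1 = Finsupp.single i 1
  · rw [h x.2, mul_zero]
    rw [← hd, map_add, h1, Finsupp.degree_single]
    omega
  · rw [z, MvPowerSeries.coeff_X, if_neg h1, zero_mul]

/-- The operator `a θ₁ + b θ₂ + c` on power series. -/
def linZ (a b c : ℚ) (f : ZSer) : ZSer := a • thZ 0 f + b • thZ 1 f + c • f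

theorem linOp_C (a b c : ℚ) (f : ZSer) :
    linOp a b c (MvPolynomial.C f) = MvPolynomial.C (linZ a b c f) := by
  simp only [linOp, linZ, ← thL_apply, thL_C, map_add, map_rat_smul]

theorem coeff_linZ (a b c : ℚ) (f : ZSer) (m : Fin 2 →₀ ℕ) :
    MvPowerSeries.coeff m (linZ a b c f) =
      (a * m 0 + b * m 1 + c) * MvPowerSeries.coeff m f := by
  simp only [linZ, map_add, MvPowerSeries.coeff_smul, coeff_thZ]
  ring

/-- The recursion of the Picard-Fuchs system determines a power series solution by its constant
term. -/
theorem eq_zero_of_isSolution {f : ZSer} (h : IsSolution (MvPolynomial.C f))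
    (h0 : MvPowerSeries.constantCoeff f = 0) : f = 0 := by
  obtain ⟨h1, h2⟩ := h
  simp only [opL₁, opL₂, linOp_C, ← map_mul, ← map_sub, ← map_add] at h1 h2
  rw [MvPolynomial.C_eq_zero] at h1 h2
  suffices H : ∀ n : ℕ, ∀ m : Fin 2 →₀ ℕ, Finsupp.degree m = n → MvPowerSeries.coeff m f = 0 by
    ext m
    rw [H _ m rfl, map_zero]
  intro n
  induction n using Nat.strong_induction_on with
  | _ n ih =>
    intro m hm
    have hlow : ∀ (a b c a' b' c' : ℚ) (m' : Fin 2 →₀ ℕ), Finsupp.degree m' < Finsupp.degree m →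
        MvPowerSeries.coeff m' (linZ a b c (linZ a' b' c' f)) = 0 := by
      intro a b c a' b' c' m' h
      rw [coeff_linZ, coeff_linZ, ih _ (hm ▸ h) m' rfl, mul_zero, mul_zero]
    have e1 := congrArg (MvPowerSeries.coeff m) h1
    have e2 := congrArg (MvPowerSeries.coeff m) h2
    rw [map_sub, mul_comm (12 : ZSer), mul_assoc, coeff_z_mul_eq_zero 0 (fun m' h => by
      rw [show (12 : ZSer) * linZ 6 0 1 (linZ 6 0 5 f) =
        (12 : ℚ) • linZ 6 0 1 (linZ 6 0 5 f) by algebra, MvPowerSeries.coeff_smul,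
        hlow _ _ _ _ _ _ m' h, mul_zero]), coeff_linZ, coeff_linZ,
      map_zero (MvPowerSeries.coeff m)] at e1
    rw [map_add, coeff_z_mul_eq_zero 1 (fun m' h => by
      rw [coeff_linZ, hlow _ _ _ _ _ _ m' h, mul_zero]), coeff_linZ, coeff_linZ, coeff_linZ,
      map_zero (MvPowerSeries.coeff m)] at e2
    -- The second equation determines the coefficients with `m 1 ≠ 0`, the first one the others.
    by_cases hm1 : m 1 = 0
    · by_cases hm0 : m 0 = 0
      · have : m = 0 := by
          ext i; fin_cases i
          · exact hm0
          · exact hm1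
        rw [this]
        exact h0
      · have : (m 0 : ℚ) ≠ 0 := by exact_mod_cast hm0
        rw [hm1] at e1
        simpa [this] using e1
    · have : (m 1 : ℚ) ≠ 0 := by exact_mod_cast hm1
      simpa [this] using e2

/-- The differences of two normalised triples of periods are power series solutions without constant
term. -/
theorem normalized_unique {p p' : Periods} (h : p.IsNormalized) (h' : p'.IsNormalized) :
    p = p' := by
  have e0 : p.X₀ = p'.X₀ := by
    refine sub_eq_zero.mp (eq_zero_of_isSolution ?_ ?_)
    · rw [map_sub]; exact isSolution_sub h.solX₀ h'.solX₀
    · rw [map_sub, h.constX₀, h'.constX₀, sub_self]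
  have e1 : p.S₁ = p'.S₁ := by
    refine sub_eq_zero.mp (eq_zero_of_isSolution ?_ ?_)
    · have := isSolution_sub h.solX₁ h'.solX₁
      rwa [e0, add_sub_add_left_eq_sub, ← map_sub] at this
    · rw [map_sub, h.constS₁, h'.constS₁, sub_self]
  have e2 : p.S₂ = p'.S₂ := by
    refine sub_eq_zero.mp (eq_zero_of_isSolution ?_ ?_)
    · have := isSolution_sub h.solX₂ h'.solX₂
      rwa [e0, add_sub_add_left_eq_sub, ← map_sub] at this
    · rw [map_sub, h.constS₂, h'.constS₂, sub_self]
  cases p; cases p'; simp_all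

end Uniqueness

/-! ### Power series in two variables -/

section Bivariate

theorem coeff_bivariate (a : ℕ → QSer) (m : Fin 2 →₀ ℕ) :
    MvPowerSeries.coeff m (bivariate a) = PowerSeries.coeff (m 0) (a (m 1)) := rfl

theorem slice_bivariate (a : ℕ → QSer) (n : ℕ) : slice (bivariate a) n = a n := by
  ext k
  simp [slice, coeff_bivariate]

theorem coeff_iot (f : QSer) (m : Fin 2 →₀ ℕ) :
    MvPowerSeries.coeff m (iot f) = if m 1 = 0 then PowerSeries.coeff (m 0) f else 0 := by
  classical
  rw [iot_apply, Periods.inZ₁, PowerSeries.coeff_subst (hasSubst_of_const (constantCoeff_z 0))]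
  have hm : ∀ d : ℕ, MvPowerSeries.coeff m (z 0 ^ d) =
      if m = Finsupp.single 0 d then (1 : ℚ) else 0 := fun d => by
    rw [z, MvPowerSeries.coeff_X_pow]
  simp only [hm]
  rw [finsum_eq_single _ (m 0)]
  · have : (m = Finsupp.single 0 (m 0)) ↔ m 1 = 0 := by
      constructor
      · intro h; rw [h]; simp
      · intro h
        ext i; fin_cases i
        · simp
        · simpa using h
    simp [this]
  · intro d hd
    rw [if_neg, smul_zero]
    intro h
    exact hd (by rw [h]; simp)

/-- The series `∑ aₖ yᵏ` over `ℚ⟦x⟧` as a power series in two variables. -/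
def biv : PowerSeries QSer →+* ZSer := evalHom iot (z 1) (constantCoeff_z 1)

@[simp] theorem biv_C (f : QSer) : biv (PowerSeries.C f) = iot f := evalHom_C _ _ f

@[simp] theorem biv_X : biv PowerSeries.X = z 1 := evalHom_X _ _

theorem coeff_iot_mul_pow (f : QSer) (k : ℕ) (m : Fin 2 →₀ ℕ) :
    MvPowerSeries.coeff m (iot f * z 1 ^ k) =
      if m 1 = k then PowerSeries.coeff (m 0) f else 0 := by
  classical
  rw [mul_comm, z, MvPowerSeries.X_pow_eq, MvPowerSeries.coeff_monomial_mul, coeff_iot]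
  by_cases h : k ≤ m 1
  · rw [if_pos (by simpa using h)]
    have : (m 1 - k = 0) ↔ m 1 = k := by omega
    simp [this]
  · rw [if_neg (by simpa using h), if_neg (by omega)]

theorem bivariate_eq (a : PowerSeries QSer) :
    bivariate (fun n => PowerSeries.coeff n a) = biv a := by
  ext m
  have hd : m 1 ≤ Finsupp.degree m := by
    rw [Finsupp.degree_eq_sum]; simp
  rw [coeff_bivariate, biv, coeff_evalHom _ _ _ (Nat.lt_succ_self _), evalPartial,
    Polynomial.eval₂_eq_sum_range' _ (PowerSeries.natDegree_trunc_lt _ _), map_sum,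
    Finset.sum_eq_single (m 1)]
  · rw [coeff_iot_mul_pow, if_pos rfl, PowerSeries.coeff_trunc, if_pos (by omega)]
  · intro k _ hk
    rw [coeff_iot_mul_pow, if_neg (Ne.symm hk)]
  · intro h
    exact absurd (Finset.mem_range.mpr (by omega)) h

theorem hasSubst_pair {u v : ZSer} (hu : MvPowerSeries.constantCoeff u = 0)
    (hv : MvPowerSeries.constantCoeff v = 0) : MvPowerSeries.HasSubst ![u, v] :=
  MvPowerSeries.hasSubst_of_constantCoeff_zero fun i => by
    fin_cases i
    · exact hu
    · exact hv

/-- Substitution of two power series without constant term. -/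
def pairHom {u v : ZSer} (hu : MvPowerSeries.constantCoeff u = 0)
    (hv : MvPowerSeries.constantCoeff v = 0) : ZSer →+* ZSer :=
  (MvPowerSeries.substAlgHom (R := ℚ) (hasSubst_pair hu hv)).toRingHom

theorem pairHom_apply {u v : ZSer} (hu : MvPowerSeries.constantCoeff u = 0)
    (hv : MvPowerSeries.constantCoeff v = 0) (f : ZSer) :
    pairHom hu hv f = MvPowerSeries.subst ![u, v] f :=
  congrFun (MvPowerSeries.coe_substAlgHom (hasSubst_pair hu hv)) f

theorem pairHom_z {u v : ZSer} (hu : MvPowerSeries.constantCoeff u = 0)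
    (hv : MvPowerSeries.constantCoeff v = 0) (i : Fin 2) : pairHom hu hv (z i) = ![u, v] i := by
  rw [pairHom_apply, z, MvPowerSeries.subst_X (hasSubst_pair hu hv)]

theorem pairHom_iot {u v : ZSer} (hu : MvPowerSeries.constantCoeff u = 0)
    (hv : MvPowerSeries.constantCoeff v = 0) (f : QSer) :
    pairHom hu hv (iot f) = subHom u hu f := by
  have h : pairHom hu hv (z 0) = u := pairHom_z hu hv 0
  rw [iot_apply, Periods.inZ₁, map_subst_rat _ (constantCoeff_z 0) (by rw [h, hu]), h, subHom_apply]

theorem pairHom_biv {u v : ZSer} (hu : MvPowerSeries.constantCoeff u = 0)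
    (hv : MvPowerSeries.constantCoeff v = 0) :
    (pairHom hu hv).comp biv = evalHom (subHom u hu) v hv :=
  ringHom_ext_of_constantCoeff _ _ (fun k => by simp [pairHom_iot])
    (by simp [pairHom_z]) (by simp [pairHom_z, hv])

/-- Expansions with quasi-modular coefficients are values of a ring homomorphism. -/
theorem expansion_eq {u v : ZSer} (hu : MvPowerSeries.constantCoeff u = 0)
    (hv : MvPowerSeries.constantCoeff v = 0) (a : PowerSeries QM) :
    expansion (fun n => qexp (PowerSeries.coeff n a)) u v =
      evalHom ((subHom u hu).comp qexp.toRingHom) v hv a := by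
  have h : (fun n => qexp (PowerSeries.coeff n a)) =
      fun n => PowerSeries.coeff n (PowerSeries.map qexp.toRingHom a) := by
    ext1 n; rw [PowerSeries.coeff_map]; rfl
  have h1 := ringHom_ext_of_constantCoeff
    ((evalHom (subHom u hu) v hv).comp (PowerSeries.map qexp.toRingHom))
    (evalHom ((subHom u hu).comp qexp.toRingHom) v hv) (fun k => by simp) (by simp) (by simp [hv])
  rw [expansion, h, bivariate_eq, ← pairHom_apply hu hv, ← h1, ← pairHom_biv hu hv]
  rfl

theorem rescale_C (r k : QSer) :
    PowerSeries.rescale r (PowerSeries.C k) = PowerSeries.C k := by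
  ext1 n
  cases n <;> simp [PowerSeries.coeff_rescale, PowerSeries.coeff_C]

/-- A factor of the second argument that depends on the first argument alone can be absorbed into
the coefficients. -/
theorem evalHom_mul_unit {u v : ZSer} (hu : MvPowerSeries.constantCoeff u = 0)
    (hv : MvPowerSeries.constantCoeff v = 0) (r : QSer)
    (hrv : MvPowerSeries.constantCoeff (subHom u hu r * v) = 0) (a : PowerSeries QSer) :
    evalHom (subHom u hu) (subHom u hu r * v) hrv a =
      pairHom hu hv (biv (PowerSeries.rescale r a)) := by
  have h1 := ringHom_ext_of_constantCoeff
    (evalHom (subHom u hu) (subHom u hu r * v) hrv)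
    (((pairHom hu hv).comp biv).comp (PowerSeries.rescale r))
    (fun k => by simp [pairHom_iot, rescale_C])
    (by simp [PowerSeries.rescale_X, pairHom_z, pairHom_iot])
    (by simpa using hrv)
  rw [h1]; rfl

/-- The substitution of `u = z₁ + ⋯` and `v = z₂ + ⋯` is injective, since it does not change the
terms of lowest degree. -/
theorem pairHom_injective {a b : ZSer} (ha : MvPowerSeries.constantCoeff a = 1)
    (hb : MvPowerSeries.constantCoeff b = 1) (hu : MvPowerSeries.constantCoeff (z 0 * a) = 0)
    (hv : MvPowerSeries.constantCoeff (z 1 * b) = 0) :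
    Function.Injective (pairHom hu hv) := by
  classical
  rw [injective_iff_map_eq_zero]
  intro G hG
  suffices H : ∀ n : ℕ, ∀ m : Fin 2 →₀ ℕ, Finsupp.degree m = n → MvPowerSeries.coeff m G = 0 by
    ext m
    rw [H _ m rfl, map_zero]
  intro n
  induction n using Nat.strong_induction_on with
  | _ n ih =>
    intro m hm
    have h := congrArg (MvPowerSeries.coeff m) hG
    have hmon : ∀ d : Fin 2 →₀ ℕ, (d.prod fun s e => (![z 0 * a, z 1 * b] s) ^ e) =
        MvPowerSeries.monomial d 1 * (a ^ d 0 * b ^ d 1) := by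
      intro d
      rw [Finsupp.prod_fintype _ _ (fun i => pow_zero _), MvPowerSeries.monomial_one_eq,
        Finsupp.prod_fintype _ _ (fun i => pow_zero _)]
      simp only [Fin.prod_univ_two, Matrix.cons_val_zero, Matrix.cons_val_one, z]
      ring
    rw [pairHom_apply, MvPowerSeries.coeff_subst (hasSubst_pair hu hv), map_zero,
      finsum_eq_single _ m] at h
    · rw [hmon, MvPowerSeries.coeff_monomial_mul, if_pos le_rfl, tsub_self] at h
      simpa [ha, hb] using h
    · intro d hd
      rw [hmon, MvPowerSeries.coeff_monomial_mul]
      split_ifs with hle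
      · rw [ih (Finsupp.degree d) ?_ d rfl, zero_smul]
        obtain ⟨e, rfl⟩ := exists_add_of_le hle
        have he : Finsupp.degree e ≠ 0 := by
          intro h0
          rw [Finsupp.degree_eq_zero_iff] at h0
          simp [h0] at hd
        rw [← hm, map_add]
        omega
      · rw [smul_zero]

end Bivariate

/-! ### The flat coordinates -/

section FlatCoordinates

theorem z_ne_zero (i : Fin 2) : z i ≠ 0 := by
  intro h
  have := congrArg (MvPowerSeries.coeff (Finsupp.single i 1)) h
  simp [z] at this

theorem constantCoeff_ev_eq_zero {a : PowerSeries QM} (h : PowerSeries.constantCoeff a = 0) :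
    MvPowerSeries.constantCoeff (ev a) = 0 := by
  rw [constantCoeff_ev, h, map_zero, map_zero]

theorem constantCoeff_X₀_ne_zero : MvPowerSeries.constantCoeff periods.X₀ ≠ 0 := by
  rw [isNormalized_periods.constX₀]; exact one_ne_zero

theorem ev_delta_mul : ev delta * ev solN = (12 : ℚ) • ev (serSystem.del solN) := by
  rw [← map_mul, ← map_rat_smul, delta, smul_mul_assoc, mul_assoc, mul_comm solNinv,
    solN_mul_inv, mul_one]

theorem ev_solNinv_mul : ev solN * ev solNinv = 1 := by
  rw [← map_mul, solN_mul_inv, map_one]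

/-- In other words `t₁ = t̃ + δ`. -/
theorem S₁_div : periods.S₁ * periods.X₀⁻¹ = iot tau + ev delta := by
  refine ((MvPowerSeries.eq_mul_inv_iff_mul_eq constantCoeff_X₀_ne_zero).mpr ?_).symm
  simp only [periods]
  rw [← ev_delta_mul]
  ring

theorem S₂_div : periods.S₂ * periods.X₀⁻¹ = ev (solM * solNinv) -
    (3 / 2 : ℚ) • (iot tau + ev delta) - (3 / 2 : ℚ) • iot logDiscr := by
  refine ((MvPowerSeries.eq_mul_inv_iff_mul_eq constantCoeff_X₀_ne_zero).mpr ?_).symm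
  simp only [periods]
  rw [← ev_delta_mul, map_mul]
  have h := ev_solNinv_mul
  generalize ev solNinv = a at h ⊢
  generalize ev solN = b at h ⊢
  generalize ev solM = c
  generalize ev delta = d
  generalize iot phi = e
  generalize iot tau = f
  generalize iot logDiscr = g
  linear_combination (norm := algebra) c * e * h

theorem constantCoeff_ev_delta : MvPowerSeries.constantCoeff (ev delta) = 0 :=
  constantCoeff_ev_eq_zero constantCoeff_delta

theorem constantCoeff_S₁_div :
    MvPowerSeries.constantCoeff (periods.S₁ * periods.X₀⁻¹) = 0 := by
  rw [map_mul, isNormalized_periods.constS₁, zero_mul]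

theorem constantCoeff_S₂_div :
    MvPowerSeries.constantCoeff (periods.S₂ * periods.X₀⁻¹) = 0 := by
  rw [map_mul, isNormalized_periods.constS₂, zero_mul]

theorem iot_qt_eq : iot qt = z 0 * serExp (iot tau) := by
  have h : MvPowerSeries.constantCoeff (iot tau) = 0 := constantCoeff_iot_tau
  rw [qt_eq, map_mul, iot_X, ← exp_tau]
  congr 1
  exact map_serExp (σ := Unit) (A := ℚ) iot constantCoeff_tau h

/-- The series `q_E` is the displacement of `q̃` by `delta` on the logarithmic scale. -/
theorem qE_eq : periods.qE = iot qt * serExp (ev delta) := by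
  rw [iot_qt_eq, mul_assoc, ← serExp_add constantCoeff_iot_tau constantCoeff_ev_delta, ← S₁_div]
  rfl

theorem constantCoeff_qE : MvPowerSeries.constantCoeff periods.qE = 0 := by
  rw [Periods.qE, map_mul, constantCoeff_z, zero_mul]

theorem constantCoeff_qB : MvPowerSeries.constantCoeff periods.qB = 0 := by
  rw [Periods.qB, map_mul, constantCoeff_z, zero_mul]

/-- Evaluation of a power series at `q_E`. -/
def atE : QSer →+* ZSer := subHom periods.qE constantCoeff_qE

theorem atE_apply (f : QSer) : atE f = f.subst periods.qE := subHom_apply _ f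

theorem atE_X : atE PowerSeries.X = iot qt * serExp (ev delta) := by
  rw [atE, subHom_X, qE_eq]

/-- Evaluation of a quasi-modular form at `q_E`. -/
def qmE : QM →+* ZSer := atE.comp qexp.toRingHom

theorem qmE_apply (p : QM) : qmE p = atE (qexp p) := rfl

/-- The flow of `X d/dX` multiplies `X` by an exponential. -/
theorem taylor_qDeriv_X : taylor (qDeriv (R := ℚ)) PowerSeries.X =
    PowerSeries.C PowerSeries.X * serExp (σ := Unit) (A := QSer) PowerSeries.X := by
  have h : serExp (σ := Unit) (A := QSer) PowerSeries.X = PowerSeries.exp QSer :=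
    (PowerSeries.map_algebraMap_eq_subst_X (R := ℚ) (S := QSer) (PowerSeries.exp ℚ)).symm.trans
      (PowerSeries.map_exp _)
  have hit : ∀ n, (qDeriv (R := ℚ))^[n] PowerSeries.X = PowerSeries.X := fun n =>
    Function.iterate_fixed qDeriv_X n
  rw [h]
  ext1 n
  rw [coeff_taylor, taylorCoeff, hit, PowerSeries.coeff_C_mul, PowerSeries.coeff_exp,
    mul_comm, ← Algebra.smul_def]
  simp

/-- Taylor's theorem: displacement of the argument from `q̃` to `q_E`. -/
theorem atE_eq (f : QSer) : atE f =
    evalHom (iot.comp tild) (ev delta) constantCoeff_ev_delta (taylor (qDeriv (R := ℚ)) f) := by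
  have h := ringHom_ext_of_constantCoeff atE
    ((evalHom (iot.comp tild) (ev delta) constantCoeff_ev_delta).comp (taylor (qDeriv (R := ℚ))))
    (fun k => DFunLike.congr_fun (RingHom.ext_rat (atE.comp PowerSeries.C)
      (((evalHom (iot.comp tild) (ev delta) constantCoeff_ev_delta).comp
        (taylor (qDeriv (R := ℚ)))).comp PowerSeries.C)) k)
    (by
      rw [RingHom.comp_apply, taylor_qDeriv_X, map_mul, evalHom_C, atE, subHom_X, qE_eq,
        map_serExp (σ := Unit) (A := QSer) (evalHom (iot.comp tild) (ev delta)
          constantCoeff_ev_delta) (PowerSeries.constantCoeff_X) (by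
          refine (congrArg _ (evalHom_X _ constantCoeff_ev_delta)).trans constantCoeff_ev_delta)]
      rw [RingHom.comp_apply, tild_X]
      congr 2
      exact (evalHom_X _ constantCoeff_ev_delta).symm)
    (by rw [atE, subHom_X, constantCoeff_qE])
  rw [h]; rfl

theorem qexp_iterate_ram (n : ℕ) (p : QM) : qexp (ram^[n] p) = (qDeriv (R := ℚ))^[n] (qexp p) := by
  induction n generalizing p with
  | zero => rfl
  | succ n ih => rw [Function.iterate_succ_apply, Function.iterate_succ_apply, ih, qexp_ram]

/-- The shifted quasi-modular form at `q̃` is the quasi-modular form at `q_E`. -/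
theorem ev_PsiK (p : QM) : ev (PsiK p) = qmE p := by
  have h1 : ∀ a : PowerSeries QM, ev (evalDelta a) =
      evalHom evK (ev delta) constantCoeff_ev_delta a := fun a =>
    DFunLike.congr_fun (ringHom_ext_of_constantCoeff (ev.comp evalDelta)
      (evalHom evK (ev delta) constantCoeff_ev_delta) (fun k => by simp) (by simp)
      (by simp [constantCoeff_ev_delta])) a
  have h2 : ∀ a : PowerSeries QM, evalHom evK (ev delta) constantCoeff_ev_delta a =
      evalHom (iot.comp tild) (ev delta) constantCoeff_ev_delta
        (PowerSeries.map qexp.toRingHom a) := fun a =>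
    DFunLike.congr_fun (ringHom_ext_of_constantCoeff
      (evalHom evK (ev delta) constantCoeff_ev_delta)
      ((evalHom (iot.comp tild) (ev delta) constantCoeff_ev_delta).comp
        (PowerSeries.map qexp.toRingHom)) (fun k => by simp [evK]) (by simp)
      (by simp [constantCoeff_ev_delta])) a
  rw [PsiK, RingHom.comp_apply, h1, h2, qmE_apply, atE_eq]
  congr 1
  ext1 n
  rw [PowerSeries.coeff_map, coeff_taylor, coeff_taylor, taylorCoeff, taylorCoeff,
    ← qexp_iterate_ram]
  exact map_rat_smul qexp _ _

end FlatCoordinates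

/-! ### The variables Z and Q -/

section Coordinates

/-- Powers under a ring homomorphism, computed from a logarithm of the image. -/
theorem atE_rpow {f : QSer} (hf : PowerSeries.constantCoeff f = 1) {a : ZSer}
    (ha : MvPowerSeries.constantCoeff a = 0) (h : atE f = serExp a) (r : ℚ) :
    atE (rpow f r) = serExp (r • a) := by
  have h0 : ∀ g : QSer, PowerSeries.constantCoeff g = 0 →
      MvPowerSeries.constantCoeff (atE g) = 0 := fun g hg => by
    rw [atE, constantCoeff_subHom, hg]
  have hl := const_serLog (σ := Unit) (A := ℚ) hf
  have h1 : atE (serLog (σ := Unit) (A := ℚ) f) = a := by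
    refine serExp_injective (h0 _ hl) ha ?_
    have := map_serExp (σ := Unit) (A := ℚ) atE hl (h0 _ hl)
    rw [← this, serExp_serLog (σ := Unit) (A := ℚ) hf, h]
  have h2 : PowerSeries.constantCoeff (r • serLog (σ := Unit) (A := ℚ) f : QSer) = 0 :=
    constantCoeff_smul_serLog hf r
  rw [rpow_eq]
  refine (map_serExp (σ := Unit) (A := ℚ) atE h2 (h0 _ h2)).trans ?_
  rw [map_rat_smul, h1]

/-- The logarithm of `f(q̃)`. -/
def logTild (f : QSer) : ZSer := iot (tild (serLog (σ := Unit) (A := ℚ) f))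

theorem constantCoeff_logTild {f : QSer} (hf : PowerSeries.constantCoeff f = 1) :
    MvPowerSeries.constantCoeff (logTild f) = 0 := by
  rw [logTild, constantCoeff_iot, constantCoeff_tild]
  exact const_serLog (σ := Unit) (A := ℚ) hf

theorem serExp_logTild {f : QSer} (hf : PowerSeries.constantCoeff f = 1) :
    serExp (logTild f) = iot (tild f) := by
  have h := map_serExp (σ := Unit) (A := ℚ) (iot.comp tild)
    (const_serLog (σ := Unit) (A := ℚ) hf) (constantCoeff_logTild hf)
  rw [serExp_serLog (σ := Unit) (A := ℚ) hf] at h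
  exact h.symm

theorem serExp_ev {a : PowerSeries QM} (h : PowerSeries.constantCoeff a = 0) :
    serExp (ev a) = ev (expY a) :=
  (map_serExp (σ := Unit) (A := QM) ev h (constantCoeff_ev_eq_zero h)).symm

theorem ev_ratE₄ : ev ratE₄ = serExp (ev logE₄) := by
  rw [serExp_ev constantCoeff_logE₄, expY, logE₄,
    serExp_serLog (σ := Unit) (A := QM) constantCoeff_ratE₄]

theorem ev_ratDisc : ev ratDisc = serExp (ev logDisc) := by
  rw [serExp_ev constantCoeff_logDisc, expY, logDisc,
    serExp_serLog (σ := Unit) (A := QM) constantCoeff_ratDisc]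

theorem constantCoeff_ev_logE₄ : MvPowerSeries.constantCoeff (ev logE₄) = 0 :=
  constantCoeff_ev_eq_zero constantCoeff_logE₄

theorem constantCoeff_ev_logDisc : MvPowerSeries.constantCoeff (ev logDisc) = 0 :=
  constantCoeff_ev_eq_zero constantCoeff_logDisc

/-- The logarithm of `E₄(q̃)^{1/4}`. -/
def logPhi : ZSer := logTild rootE₄

theorem constantCoeff_logPhi : MvPowerSeries.constantCoeff logPhi = 0 :=
  constantCoeff_logTild constantCoeff_rootE₄

theorem serExp_logPhi (n : ℕ) : serExp (n • logPhi) = iot phi ^ n := by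
  rw [serExp_nsmul constantCoeff_logPhi, logPhi, serExp_logTild constantCoeff_rootE₄]; rfl

theorem constantCoeff_smul {r : ℚ} {a : ZSer} (h : MvPowerSeries.constantCoeff a = 0) :
    MvPowerSeries.constantCoeff (r • a) = 0 := by
  rw [map_rat_smul, h, smul_zero]

theorem constantCoeff_nsmul {r : ℕ} {a : ZSer} (h : MvPowerSeries.constantCoeff a = 0) :
    MvPowerSeries.constantCoeff (r • a) = 0 := by
  rw [map_nsmul, h, smul_zero]

theorem constantCoeff_add {a b : ZSer} (ha : MvPowerSeries.constantCoeff a = 0)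
    (hb : MvPowerSeries.constantCoeff b = 0) : MvPowerSeries.constantCoeff (a + b) = 0 := by
  rw [map_add, ha, hb, add_zero]

theorem atE_rpow_E₄ : atE (rpow (eisenstein 4) (9 / 2)) =
    iot phi ^ 18 * serExp ((9 / 2 : ℚ) • ev logE₄) := by
  have h4 := constantCoeff_nsmul (r := 4) constantCoeff_logPhi
  have h : atE (eisenstein 4) = serExp ((4 : ℕ) • logPhi + ev logE₄) := by
    rw [serExp_add h4 constantCoeff_ev_logE₄, serExp_logPhi, ← ev_ratE₄, ← qexp_e₄, ← qmE_apply,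
      ← ev_PsiK, PsiK_e₄, map_mul, ev_C, evK_apply, qexp_e₄, tild_E₄, map_pow]
  rw [atE_rpow (constantCoeff_eisenstein 4) (constantCoeff_add h4 constantCoeff_ev_logE₄) h,
    smul_add, serExp_add (constantCoeff_smul h4) (constantCoeff_smul constantCoeff_ev_logE₄),
    ← serExp_logPhi]
  congr 2
  algebra

theorem ev_shiftY : ev shiftY = yVal * serExp (-(9 / 2 : ℚ) • ev logE₄) := by
  rw [shiftY, map_mul, ev_X, ← map_rat_smul, serExp_ev constantCoeff_smul_logE₄]

/-- `Z` is the value of the shifted `Y`. -/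
theorem Z_eq : periods.Z = ev shiftY := by
  have hm := congrArg iot mul_mInv
  simp only [map_mul, map_sub, map_one, map_ofNat, map_pow, iot_X] at hm
  have hc : MvPowerSeries.constantCoeff ((1 - 432 * z 0) ^ 3 *
      atE (rpow (eisenstein 4) (9 / 2))) ≠ 0 := by
    rw [map_mul, atE, constantCoeff_subHom, constantCoeff_rpow (constantCoeff_eisenstein 4)]
    simp [constantCoeff_z]
  rw [Periods.Z, ← atE_apply]
  refine ((MvPowerSeries.eq_mul_inv_iff_mul_eq hc).mpr ?_).symm
  have he := serExp_neg_mul (constantCoeff_smul (r := 9 / 2) constantCoeff_ev_logE₄)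
  rw [atE_rpow_E₄, ev_shiftY, yVal, neg_smul]
  generalize serExp ((9 / 2 : ℚ) • ev logE₄) = a at he ⊢
  generalize serExp (-((9 / 2 : ℚ) • ev logE₄)) = b at he ⊢
  calc z 1 * iot mInv ^ 3 * b * ((1 - 432 * z 0) ^ 3 * (iot phi ^ 18 * a))
      = z 1 * ((1 - 432 * z 0) * iot phi ^ 6 * iot mInv) ^ 3 * (b * a) := by ring
    _ = z 1 := by rw [hm, he]; ring

theorem constantCoeff_qOverEta24 : PowerSeries.constantCoeff qOverEta24 = 1 := by
  rw [qOverEta24, PowerSeries.constantCoeff_inv, map_pow, constantCoeff_eulerProd]; simp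

theorem eulerProd_mul : eulerProd ^ 24 * qOverEta24 = 1 :=
  mul_inv_of_const (by rw [map_pow, constantCoeff_eulerProd, one_pow])

/-- The logarithm of `q_E / η(q_E)²⁴`. The first factor contributes `δ`, the second one the shift of
the discriminant. -/
theorem atE_qOverEta24 : atE qOverEta24 =
    serExp (ev delta + (logTild qOverEta24 - ev logDisc)) := by
  have hl := constantCoeff_logTild constantCoeff_qOverEta24
  have hn : MvPowerSeries.constantCoeff (-ev logDisc) = 0 := by
    rw [map_neg, constantCoeff_ev_logDisc, neg_zero]
  have h1 : atE eta24 = iot (tild eta24) * serExp (ev logDisc) := by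
    rw [← qexp_disc, ← qmE_apply, ← ev_PsiK, PsiK_disc, map_mul, ev_C, evK_apply, ev_ratDisc]
  have h2 := congrArg atE eulerProd_mul
  have h3 := congrArg (fun f => iot (tild f)) eulerProd_mul
  have h4 := serExp_neg_mul constantCoeff_ev_logDisc
  rw [eta24, map_mul, map_mul, map_mul, tild_X, atE_X] at h1
  simp only [map_mul, map_one] at h2 h3
  rw [sub_eq_add_neg, serExp_add constantCoeff_ev_delta (constantCoeff_add hl hn),
    serExp_add hl hn, serExp_logTild constantCoeff_qOverEta24]
  have hq : iot qt ≠ 0 := by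
    rw [iot_qt_eq]
    refine mul_ne_zero (z_ne_zero 0) fun h => ?_
    have := const_serExp constantCoeff_iot_tau
    rw [h, map_zero] at this
    exact zero_ne_one this
  refine mul_left_cancel₀ hq ?_
  generalize serExp (ev delta) = a at h1 ⊢
  generalize serExp (ev logDisc) = b at h1 h4 ⊢
  generalize serExp (-ev logDisc) = c at h4 ⊢
  generalize atE qOverEta24 = d at h2 ⊢
  generalize atE (eulerProd ^ 24) = e at h1 h2 ⊢
  generalize iot (tild qOverEta24) = f at h3 ⊢
  generalize iot (tild (eulerProd ^ 24)) = g at h1 h3 ⊢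
  generalize iot qt = x at h1 ⊢
  calc x * d = x * (g * f) * (c * b) * d := by rw [h3, h4]; ring
    _ = (x * g * b) * (f * c * d) := by ring
    _ = x * a * e * (f * c * d) := by rw [h1]
    _ = (e * d) * (x * (a * (f * c))) := by ring
    _ = _ := by rw [h2, one_mul]

/-- The logarithm of `1 / ((1 - 432 z₁) E₄(q̃)^{3/2})`. -/
def logMInv : ZSer := -iot logDiscr - (6 : ℕ) • logPhi

theorem constantCoeff_iot_logDiscr : MvPowerSeries.constantCoeff (iot logDiscr) = 0 := by
  rw [constantCoeff_iot, constantCoeff_logDiscr]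

theorem serExp_logDiscr : serExp (iot logDiscr) = 1 - 432 * z 0 := by
  have h1 : PowerSeries.constantCoeff (1 - 432 * PowerSeries.X : QSer) = 1 := by simp
  have h := map_serExp (σ := Unit) (A := ℚ) iot (const_serLog (σ := Unit) (A := ℚ) h1)
    constantCoeff_iot_logDiscr
  rw [serExp_serLog (σ := Unit) (A := ℚ) h1] at h
  refine h.symm.trans ?_
  change iot (1 - 432 * PowerSeries.X : QSer) = _
  rw [map_sub, map_mul, map_one, map_ofNat, iot_X]

theorem constantCoeff_neg_eq_zero {a : ZSer} (h : MvPowerSeries.constantCoeff a = 0) :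
    MvPowerSeries.constantCoeff (-a) = 0 := by
  rw [map_neg, h, neg_zero]

theorem constantCoeff_logMInv : MvPowerSeries.constantCoeff logMInv = 0 := by
  rw [logMInv, map_sub, map_neg, constantCoeff_iot_logDiscr,
    constantCoeff_nsmul constantCoeff_logPhi]
  simp

theorem serExp_logMInv : serExp logMInv = iot mInv := by
  have h6 := constantCoeff_nsmul (r := 6) constantCoeff_logPhi
  have hm := congrArg iot mul_mInv
  simp only [map_mul, map_sub, map_one, map_ofNat, map_pow, iot_X] at hm
  have h1 := serExp_neg_mul constantCoeff_iot_logDiscr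
  have h2 := serExp_neg_mul h6
  rw [serExp_logPhi] at h2
  rw [serExp_logDiscr] at h1
  rw [logMInv, sub_eq_add_neg, serExp_add (constantCoeff_neg_eq_zero constantCoeff_iot_logDiscr)
    (constantCoeff_neg_eq_zero h6)]
  generalize serExp (-iot logDiscr) = a at h1 ⊢
  generalize serExp (-((6 : ℕ) • logPhi)) = b at h2 ⊢
  linear_combination -(a * b) * hm + iot mInv * (h1 * (b * iot phi ^ 6)) + iot mInv * h2

/-- The defining equation of `q̃` in logarithmic form. -/
theorem logTild_qOverEta24 : logTild qOverEta24 - iot tau - iot logDiscr = 2 • logMInv := by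
  have hl := constantCoeff_logTild constantCoeff_qOverEta24
  have ht := constantCoeff_neg_eq_zero constantCoeff_iot_tau
  have hd := constantCoeff_neg_eq_zero constantCoeff_iot_logDiscr
  rw [sub_eq_add_neg, sub_eq_add_neg]
  refine serExp_injective (constantCoeff_add (constantCoeff_add hl ht) hd)
    (constantCoeff_nsmul constantCoeff_logMInv) ?_
  rw [serExp_add (constantCoeff_add hl ht) hd, serExp_add hl ht,
    serExp_logTild constantCoeff_qOverEta24, serExp_nsmul constantCoeff_logMInv, serExp_logMInv]
  have hm := congrArg iot mul_mInv
  simp only [map_mul, map_sub, map_one, map_ofNat, map_pow, iot_X] at hm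
  have h1 := serExp_neg_mul constantCoeff_iot_logDiscr
  rw [serExp_logDiscr] at h1
  have h2 := serExp_neg_mul constantCoeff_iot_tau
  have h3 := congrArg (fun f => iot (tild f)) eulerProd_mul
  simp only [map_mul, map_one] at h3
  have h4 := congrArg iot (congrArg tild zOfQ_mul_one_sub)
  have h5 := congrArg (fun f => iot (tild f)) (mul_inv_of_const (f := eisenstein 4 ^ 3)
    (by rw [map_pow, constantCoeff_eisenstein, one_pow]))
  simp only [eta24, map_mul, map_sub, map_one, map_ofNat, tild_zOfQ, tild_X, iot_X,
    iot_qt_eq] at h4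
  simp only [map_mul, map_pow, map_one, tild_E₄] at h5
  have hz : (z 0 : ZSer) ≠ 0 := z_ne_zero 0
  generalize iot (tild (eisenstein 4 ^ 3)⁻¹) = i4 at h4 h5
  generalize serExp (-iot logDiscr) = a at h1 ⊢
  generalize serExp (-iot tau) = b at h2 ⊢
  generalize serExp (iot tau) = c at h2 h4 ⊢
  generalize iot (tild (eulerProd ^ 24)) = e at h3 h4 ⊢
  generalize iot (tild qOverEta24) = f at h3 ⊢
  have h6 : (1 - 432 * z 0) * iot phi ^ 12 = c * e := by
    refine mul_left_cancel₀ hz ?_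
    linear_combination iot phi ^ 12 * h4 + z 0 * c * e * h5
  generalize iot phi = x at *
  generalize iot mInv = y at *
  generalize 1 - 432 * z 0 = d at *
  calc f * b * a = f * b * a * (d * x ^ 6 * y) ^ 2 := by rw [hm]; ring
    _ = (d * x ^ 12) * f * b * (a * d) * y ^ 2 := by ring
    _ = (e * f) * (b * c) * y ^ 2 := by rw [h6, h1]; ring
    _ = y ^ 2 := by rw [h3, h2]; ring

theorem constantCoeff_ev_logRatio : MvPowerSeries.constantCoeff (ev logRatio) = 0 :=
  constantCoeff_ev_eq_zero constantCoeff_logRatio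

/-- `Q / Z` is the exponential of the value of `logRatio`. -/
theorem Q_eq : periods.Q = periods.Z * serExp (ev logRatio) := by
  have hl := constantCoeff_logTild constantCoeff_qOverEta24
  have h0 : MvPowerSeries.constantCoeff
      (ev delta + (logTild qOverEta24 - ev logDisc)) = 0 := by
    rw [map_add, map_sub, hl, constantCoeff_ev_delta, constantCoeff_ev_logDisc]; simp
  have h3 : MvPowerSeries.constantCoeff (-(9 / 2 : ℚ) • ev logE₄) = 0 :=
    constantCoeff_smul constantCoeff_ev_logE₄
  have h4 := constantCoeff_nsmul (r := 3) constantCoeff_logMInv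
  have hB : periods.qB = z 1 * serExp (periods.S₂ * periods.X₀⁻¹) := rfl
  rw [Periods.Q, ← atE_apply, atE_rpow constantCoeff_qOverEta24 h0 atE_qOverEta24, hB,
    Z_eq, ev_shiftY, yVal, ← serExp_logMInv, ← serExp_nsmul constantCoeff_logMInv,
    mul_left_comm, ← serExp_add (constantCoeff_smul h0) constantCoeff_S₂_div, mul_assoc (z 1),
    ← serExp_add h4 h3, mul_assoc (z 1),
    ← serExp_add (constantCoeff_add h4 h3) constantCoeff_ev_logRatio]
  congr 2
  have h := logTild_qOverEta24
  rw [S₂_div, logRatio, map_add, map_add, map_rat_smul, map_rat_smul]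
  generalize ev delta = a1
  generalize ev logDisc = a2
  generalize ev logE₄ = a3
  generalize ev (solM * solNinv) = a4
  generalize logTild qOverEta24 = a5 at h ⊢
  generalize iot tau = a6 at h ⊢
  generalize iot logDiscr = a7 at h ⊢
  generalize logMInv = a8 at h ⊢
  linear_combination (norm := algebra) (3 / 2 : ℚ) • h

end Coordinates

/-! ### Expansions in Z and Q -/

section Expansions

theorem constantCoeff_Z : MvPowerSeries.constantCoeff periods.Z = 0 := by
  rw [Z_eq, constantCoeff_ev_eq_zero constantCoeff_shiftY]

theorem constantCoeff_Q : MvPowerSeries.constantCoeff periods.Q = 0 := by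
  rw [Q_eq, map_mul, constantCoeff_Z, zero_mul]

/-- Evaluation at `q_E` and `Z`. -/
def evZ : PowerSeries QM →+* ZSer := evalHom qmE periods.Z constantCoeff_Z

/-- Evaluation at `q_E` and `Q`. -/
def evQ : PowerSeries QM →+* ZSer := evalHom qmE periods.Q constantCoeff_Q

theorem expansion_Z (a : PowerSeries QM) :
    expansion (fun n => qexp (PowerSeries.coeff n a)) periods.qE periods.Z = evZ a :=
  expansion_eq constantCoeff_qE constantCoeff_Z a

theorem expansion_Q (a : PowerSeries QM) :
    expansion (fun n => qexp (PowerSeries.coeff n a)) periods.qE periods.Q = evQ a :=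
  expansion_eq constantCoeff_qE constantCoeff_Q a

/-- The shifted series at `q̃` and `Y` is the series at `q_E` and `Z`. -/
theorem ev_Psi (a : PowerSeries QM) : ev (Psi a) = evZ a :=
  DFunLike.congr_fun (ringHom_ext_of_constantCoeff (ev.comp Psi) evZ
    (fun k => by simp [evZ, ev_PsiK]) (by simp [evZ, Z_eq])
    (by
      rw [RingHom.comp_apply, Psi_X]
      exact constantCoeff_ev_eq_zero constantCoeff_shiftY)) a

theorem Q_eq_evZ : periods.Q = periods.Z * serExp (evZ fSer) := by
  rw [Q_eq, ← Psi_fSer, ev_Psi]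

/-- Substitution of the series for `Q` passes from expansions in `Q` to expansions in `Z`. -/
theorem evZ_Theta (a : PowerSeries QM) : evZ (Theta a) = evQ a := by
  have h0 : MvPowerSeries.constantCoeff (evZ fSer) = 0 := by
    rw [← ev_Psi, Psi_fSer, constantCoeff_ev_logRatio]
  have h : evZ qSer = periods.Q := by
    rw [qSer, map_mul, Q_eq_evZ]
    congr 1
    · exact evalHom_X _ _
    · exact map_serExp (σ := Unit) (A := QM) evZ constantCoeff_fSer h0
  exact DFunLike.congr_fun (ringHom_ext_of_constantCoeff (evZ.comp Theta) evQ
    (fun k => by simp [evZ, evQ]) (by rw [RingHom.comp_apply, Theta_X, h]; simp [evQ])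
    (by rw [RingHom.comp_apply, Theta_X, h, constantCoeff_Q])) a

theorem evQ_cSer : evQ cSer = periods.Z := by
  rw [← evZ_Theta, Theta_cSer, evZ, evalHom_X]

theorem evQ_pSer : evQ pSer = (12 : ℚ) • evZ (serSystem.del fSer) := by
  rw [← evZ_Theta, Theta_pSer, map_rat_smul]

/-- The series `Q ∂P/∂Q` at `(q_E, Q)`. -/
theorem evQ_pSer_eq : evQ pSer = (12 : ℚ) • ev (serSystem.del (solM * solNinv)) := by
  rw [evQ_pSer, ← ev_Psi, Psi_del_fSer]

theorem expansion_prepot :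
    expansion (fun s => (s : ℚ) • qexp (prepotCoeff s)) periods.qE periods.Q = evQ pSer := by
  rw [← expansion_Q]
  congr 1
  ext1 s
  rw [← smul_prepotCoeff, map_smul]

theorem expansion_del_logCoeff :
    expansion (fun n => qexp (MvPolynomial.pderiv 0 (logCoeff n))) periods.qE periods.Z =
      evZ (serSystem.del fSer) := by
  rw [← expansion_Z]
  congr 1
  ext1 n
  simp [serSystem, logCoeff]

end Expansions

/-! ### The double-logarithmic solution -/

section DoubleLogarithm

/-- `α` is the holomorphic part of the logarithmic solution. -/
theorem alpha_eq : periods.alpha = iot phi * ev solM := by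
  have h : Periods.inZ₁ (PowerSeries.logOf (1 - 432 * PowerSeries.X : QSer)) = iot logDiscr :=
    (iot_apply _).symm
  rw [Periods.alpha, h]
  simp only [periods]
  generalize ev solN = a
  generalize ev solM = b
  generalize ev (serSystem.del solN) = c
  generalize iot phi = d
  generalize iot tau = e
  generalize iot logDiscr = f
  algebra

/-- Evaluation at `q̃` and `Y`, expanded in powers of `z₂`. -/
theorem ev_eq_bivariate (a : PowerSeries QM) : ev a =
    bivariate fun n => mInv ^ (3 * n) * tild (qexp (PowerSeries.coeff n a)) := by
  have h := DFunLike.congr_fun (ringHom_ext_of_constantCoeff ev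
    ((biv.comp (PowerSeries.rescale (mInv ^ 3))).comp
      (PowerSeries.map (tild.comp qexp.toRingHom)))
    (fun k => by simp [rescale_C, evK]) (by
      simp [PowerSeries.rescale_X, yVal]
      ring) (by rw [ev_X, constantCoeff_yVal])) a
  rw [h, RingHom.comp_apply, RingHom.comp_apply, ← bivariate_eq]
  congr 1
  ext1 n
  rw [PowerSeries.coeff_rescale, PowerSeries.coeff_map, pow_mul]
  rfl

theorem iot_mul_bivariate (f : QSer) (a : ℕ → QSer) :
    iot f * bivariate a = bivariate fun n => f * a n := by
  have h1 : bivariate a = biv (PowerSeries.mk a) := by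
    rw [← bivariate_eq]; simp
  have h2 : (bivariate fun n => f * a n) = biv (PowerSeries.C f * PowerSeries.mk a) := by
    rw [← bivariate_eq]; simp
  rw [h1, h2, map_mul, biv_C]

/-- In terms of `z₁` the denominator `E₄^{3/2} + E₆` at `q̃` is `2 (1 - 432 z₁) E₄^{3/2}`. -/
theorem den_tau : Periods.den tau = 2 * ((1 - 432 * PowerSeries.X) * phi ^ 6) := by
  rw [Periods.den, ← tild_apply, map_add, ← rootE₄_pow_six, map_pow, tild_E₆]
  change phi ^ 6 + _ = _
  ring

/-- The factor `8ⁿ` is the ratio of `(E₄^{3/2} + E₆)^{3n}` and `((1 - 432 z₁) E₄^{3/2})^{3n}`. -/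
theorem quotTilde_tau (n : ℕ) (g : QM) : Periods.quotTilde tau n ((8 ^ n : ℚ) • g) =
    phi * (mInv ^ (3 * n) * tild (qexp g)) := by
  have h0 : PowerSeries.constantCoeff (Periods.den tau ^ (3 * n)) ≠ 0 := by
    rw [den_tau, map_pow]
    refine pow_ne_zero _ ?_
    rw [map_mul, map_ofNat]
    simp [constantCoeff_phi]
  rw [Periods.quotTilde, ← tild_apply]
  refine ((PowerSeries.eq_mul_inv_iff_mul_eq h0).mpr ?_).symm
  have h1 : Periods.den tau * mInv = 2 := by
    rw [den_tau, mul_assoc, mul_mInv, mul_one]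
  have h2 : (mInv * Periods.den tau) ^ (3 * n) = ((8 ^ n : ℚ) • 1 : QSer) := by
    have h8 : (8 : QSer) = (8 : ℚ) • 1 := by algebra
    rw [mul_comm, h1, pow_mul, show (2 : QSer) ^ 3 = 8 by norm_num, h8, smul_pow, one_pow]
  have h3 : tild (rpow (eisenstein 4) (1 / 4)) = phi := rfl
  rw [map_mul, h3, map_smul, map_rat_smul]
  calc phi * (mInv ^ (3 * n) * tild (qexp g)) * Periods.den tau ^ (3 * n)
      = phi * tild (qexp g) * (mInv * Periods.den tau) ^ (3 * n) := by rw [mul_pow]; ring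
    _ = _ := by rw [h2, mul_smul_comm, mul_one, mul_smul_comm]

theorem slice_alpha (n : ℕ) : slice periods.alpha n =
    Periods.quotTilde tau n (aCoeff n * MvPolynomial.X 0 + bCoeff n) := by
  rw [aCoeff_mul_add, quotTilde_tau, alpha_eq, ev_eq_bivariate, iot_mul_bivariate, slice_bivariate]

theorem bivariate_quotTilde : (bivariate fun n => Periods.quotTilde tau n (aCoeff n)) =
    iot phi * ev (serSystem.del solM) := by
  rw [ev_eq_bivariate, iot_mul_bivariate]
  congr 1
  ext1 n
  rw [aCoeff, quotTilde_tau]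
  simp [serSystem]

theorem ev_del_quotient : ev (serSystem.del (solM * solNinv)) =
    ev (serSystem.del solM) * ev solNinv -
      ev solM * (ev (serSystem.del solN) * ev solNinv ^ 2) := by
  rw [Derivation.leibniz, del_solNinv, smul_eq_mul, smul_eq_mul, map_add, map_mul, map_mul,
    map_neg, map_mul, map_pow]
  ring

/-- Both sides are `X₀` times the derivative `12 ∂(M / N)/∂E₂`. -/
theorem w₃Series_eq : periods.w₃Series tau aCoeff = periods.X₀ * evQ pSer := by
  have h1 : Periods.inZ₁ tau = iot tau := (iot_apply _).symm
  have h2 : periods.X₀ = iot phi * ev solN := rfl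
  rw [Periods.w₃Series, bivariate_quotTilde, S₁_div, h1, alpha_eq, evQ_pSer_eq, ev_del_quotient,
    h2, delta, map_rat_smul, map_mul]
  have h := ev_solNinv_mul
  generalize ev solN = a at h ⊢
  generalize ev solNinv = b at h ⊢
  generalize ev solM = c
  generalize ev (serSystem.del solN) = d
  generalize ev (serSystem.del solM) = e
  generalize iot phi = x
  generalize iot tau = t
  linear_combination (norm := algebra) (12 : ℚ) • ((x * c * d * b - x * e) * h)

theorem aeval_pderiv_classicalF :
    MvPolynomial.aeval periods.t (MvPolynomial.pderiv 1 classicalF) =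
      (3 / 2 : ℚ) • periods.t 0 ^ 2 + periods.t 0 * periods.t 1 := by
  have h : MvPolynomial.pderiv 1 classicalF = (3 / 2 : ℚ) • MvPolynomial.X 0 ^ 2 +
      MvPolynomial.X 0 * MvPolynomial.X 1 := by
    simp only [classicalF, map_add, Derivation.leibniz, Derivation.leibniz_pow,
      MvPolynomial.pderiv_C, MvPolynomial.pderiv_X_self,
      MvPolynomial.pderiv_X_of_ne (show (0 : Fin 2) ≠ 1 by decide), smul_eq_mul]
    rw [MvPolynomial.smul_eq_C_mul]
    have h2 : (MvPolynomial.C (1 / 2 : ℚ) : MvPolynomial (Fin 2) ℚ) * 2 = 1 := by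
      rw [← map_ofNat (MvPolynomial.C (σ := Fin 2) (R := ℚ)) 2, ← map_mul]
      norm_num
    simp only [nsmul_eq_mul]
    push_cast
    linear_combination (MvPolynomial.X 0 * MvPolynomial.X 1) * h2
  rw [h, map_add, map_smul, map_pow, map_mul, MvPolynomial.aeval_X, MvPolynomial.aeval_X]

/-- The solution `w₃` is the double-logarithmic solution with instanton part `Q ∂P/∂Q`. -/
theorem w₃_eq : periods.w₃ tau aCoeff = periods.doubleLog 1 (evQ pSer) := by
  rw [Periods.w₃, Periods.doubleLog, aeval_pderiv_classicalF, w₃Series_eq, map_mul]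
  exact (mul_add _ _ _).symm

theorem t_zero : periods.t 0 = logQt + MvPolynomial.C (ev delta) := by
  change MvPolynomial.X 0 + MvPolynomial.C (periods.S₁ * periods.X₀⁻¹) = _
  rw [S₁_div, logQt, map_add, add_assoc]

theorem t_one : periods.t 1 = logU + MvPolynomial.C (ev (solM * solNinv)) -
    (3 / 2 : ℚ) • periods.t 0 := by
  rw [t_zero]
  change MvPolynomial.X 1 + MvPolynomial.C (periods.S₂ * periods.X₀⁻¹) = _
  rw [S₂_div, logQt, logU, map_sub, map_sub, map_rat_smul, map_rat_smul, map_add]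
  generalize (MvPolynomial.C (ev delta) : LogSer) = a
  generalize (MvPolynomial.C (ev (solM * solNinv)) : LogSer) = b
  generalize (MvPolynomial.C (iot tau) : LogSer) = c
  generalize (MvPolynomial.C (iot logDiscr) : LogSer) = d
  generalize (MvPolynomial.X 0 : LogSer) = x
  generalize (MvPolynomial.X 1 : LogSer) = y
  algebra

/-- The lift of the logarithmic solution, written in the flat coordinates, is
`X₀ ((3/2) t₁² + t₁ t₂ + Q ∂P/∂Q)`. -/
theorem isSolution_doubleLog_evQ : IsSolution (periods.doubleLog 1 (evQ pSer)) := by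
  convert isSolution_doubleLog using 1
  have h2 : periods.X₀ = iot phi * ev solN := rfl
  have h := congrArg (MvPolynomial.C (σ := Fin 2)) ev_solNinv_mul
  rw [map_mul, map_one] at h
  rw [Periods.doubleLog, aeval_pderiv_classicalF, t_one, t_zero, evQ_pSer_eq, ev_del_quotient,
    h2, delta]
  simp only [map_mul, map_rat_smul, map_sub, map_pow]
  generalize (MvPolynomial.C (ev solN) : LogSer) = a at h ⊢
  generalize (MvPolynomial.C (ev solNinv) : LogSer) = b at h ⊢
  generalize (MvPolynomial.C (ev solM) : LogSer) = c
  generalize (MvPolynomial.C (ev (serSystem.del solN)) : LogSer) = d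
  generalize (MvPolynomial.C (ev (serSystem.del solM)) : LogSer) = e
  generalize (MvPolynomial.C (iot phi) : LogSer) = x
  generalize logQt = q
  generalize logU = u
  linear_combination (norm := algebra)
    ((12 : ℚ) • (x * d * u) + (12 : ℚ) • (x * e) + x * q * c) * h

end DoubleLogarithm

/-! ### The prepotential -/

section Prepotential

/-- The instanton part of the prepotential satisfies `∂F/∂t₂ = Q ∂P/∂Q`, because a
double-logarithmic solution is determined by its classical part up to its constant term. -/
theorem subst_thetaZ_eq {F : ZSer} (hF : periods.IsInstantonPrepotential F) :
    pairHom constantCoeff_qE constantCoeff_qB (thZ 1 F) = evQ pSer := by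
  set G := pairHom constantCoeff_qE constantCoeff_qB (thZ 1 F) with hG
  have h1 : IsSolution (periods.doubleLog 1 G) := by
    rw [hG, pairHom_apply]
    exact hF.2 1
  have h2 := isSolution_sub h1 isSolution_doubleLog_evQ
  rw [Periods.doubleLog, Periods.doubleLog, ← mul_sub, add_sub_add_left_eq_sub, ← map_sub,
    ← map_mul] at h2
  have h3 : MvPowerSeries.constantCoeff G = 0 := by
    have : MvPowerSeries.constantCoeff (thZ 1 F) = 0 := by
      rw [thZ_apply, thetaZ, map_mul]; simp
    rw [hG, pairHom_apply]
    exact MvPowerSeries.constantCoeff_subst_eq_zero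
      (hasSubst_pair constantCoeff_qE constantCoeff_qB) (fun i => by
        fin_cases i
        · exact constantCoeff_qE
        · exact constantCoeff_qB) this
  have h4 : MvPowerSeries.constantCoeff (evQ pSer) = 0 := by
    have h0 := coeff_zero_pSer
    rw [PowerSeries.coeff_zero_eq_constantCoeff_apply] at h0
    rw [evQ, constantCoeff_evalHom, h0, map_zero, map_zero]
  have h5 := eq_zero_of_isSolution h2 (by rw [map_mul, map_sub, h3, h4, sub_self, mul_zero])
  have h6 : periods.X₀ ≠ 0 := fun h => constantCoeff_X₀_ne_zero (by rw [h, map_zero])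
  exact sub_eq_zero.mp ((mul_eq_zero.mp h5).resolve_left h6)

/-- The expansion in `q_E` and `Q` as an expansion in `q_E` and `q_B`. -/
theorem evQ_eq_pairHom (a : PowerSeries QM) : evQ a =
    pairHom constantCoeff_qE constantCoeff_qB (bivariate fun n =>
      rpow qOverEta24 (3 / 2) ^ n * qexp (PowerSeries.coeff n a)) := by
  have hQ : periods.Q = atE (rpow qOverEta24 (3 / 2)) * periods.qB := by
    rw [Periods.Q, ← atE_apply]
  have h0 : MvPowerSeries.constantCoeff (atE (rpow qOverEta24 (3 / 2)) * periods.qB) = 0 := by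
    rw [map_mul, constantCoeff_qB, mul_zero]
  have h1 := DFunLike.congr_fun (ringHom_ext_of_constantCoeff evQ
    ((evalHom atE (atE (rpow qOverEta24 (3 / 2)) * periods.qB) h0).comp
      (PowerSeries.map qexp.toRingHom)) (fun k => by simp [evQ, qmE])
      (by simp [evQ, hQ]) (by simp [evQ, constantCoeff_Q])) a
  rw [h1, RingHom.comp_apply]
  refine (evalHom_mul_unit constantCoeff_qE constantCoeff_qB _ h0 _).trans ?_
  rw [← bivariate_eq]
  congr 2
  ext1 n
  rw [PowerSeries.coeff_rescale, PowerSeries.coeff_map]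
  rfl

/-- Comparison of the coefficients of `q_Bˢ` in `∂F/∂t₂ = Q ∂P/∂Q`. -/
theorem slice_prepotential {F : ZSer} (hF : periods.IsInstantonPrepotential F) {s : ℕ}
    (hs : 1 ≤ s) : slice F s = qexp (prepotCoeff s) * rpow qOverEta24 (3 / 2) ^ s := by
  have h := subst_thetaZ_eq hF
  rw [evQ_eq_pairHom] at h
  have h1 := pairHom_injective (const_serExp constantCoeff_S₁_div)
    (const_serExp constantCoeff_S₂_div) constantCoeff_qE constantCoeff_qB h
  have hs0 : (s : ℚ) ≠ 0 := by exact_mod_cast (by omega : s ≠ 0)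
  ext1 k
  have h2 := congrArg
    (MvPowerSeries.coeff (Finsupp.single 0 k + Finsupp.single 1 s)) h1
  rw [coeff_thZ, coeff_bivariate] at h2
  simp only [Finsupp.add_apply, Finsupp.single_apply] at h2
  simp only [← smul_prepotCoeff, map_smul] at h2
  rw [slice, PowerSeries.coeff_mk]
  refine mul_left_cancel₀ hs0 ?_
  rw [mul_comm (qexp _)]
  simpa using h2

end Prepotential

end EllFib

end

theorem mainTheorem3 :
    (∃! p : EllFib.Periods, p.IsNormalized) ∧
    ∀ p : EllFib.Periods, p.IsNormalized →
      ∃ (c P f A B : ℕ → EllFib.QM) (τ : EllFib.QSer),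
        -- the coefficients are (quasi-)modular forms
        (c 0 = 0 ∧ ∀ n, EllFib.IsQuasiModular (18 * n) (c (n + 1))) ∧
        (P 0 = 0 ∧ ∀ n, EllFib.IsQuasiModular (18 * n + 16) (P (n + 1))) ∧
        (f 0 = 0 ∧ ∀ n, EllFib.IsQuasiModular (18 * (n + 1)) (f (n + 1))) ∧
        -- `P s` is the base degree `s` part of the prepotential
        (∀ F : EllFib.ZSer, p.IsInstantonPrepotential F → ∀ s, 1 ≤ s →
          EllFib.slice F s =
            EllFib.qexp (P s) * EllFib.rpow EllFib.qOverEta24 (3 / 2) ^ s) ∧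
        EllFib.IsSolution (p.doubleLog 1
          (EllFib.expansion (fun s => (s : ℚ) • EllFib.qexp (P s)) p.qE p.Q)) ∧
        -- `Z` lies in `W₁`
        p.Z = EllFib.expansion (fun n => EllFib.qexp (c n)) p.qE p.Q ∧
        (∀ n, 1 ≤ n → MvPolynomial.pderiv 0 (c n) =
          (-1 / 12 : ℚ) • ∑ s ∈ Finset.Ico 1 n,
            ((s : ℚ) * ((n : ℚ) - (s : ℚ))) • (c (n - s) * P s)) ∧
        -- `∂ log Q / ∂E₂ = (1/12) Q ∂P/∂Q`, where `log Q = log Z + ∑ fₙ Zⁿ`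
        p.Q = p.Z * EllFib.expZ
          (EllFib.expansion (fun n => EllFib.qexp (f n)) p.qE p.Z) ∧
        EllFib.expansion (fun n => EllFib.qexp (MvPolynomial.pderiv 0 (f n))) p.qE p.Z =
          (1 / 12 : ℚ) •
            EllFib.expansion (fun s => (s : ℚ) • EllFib.qexp (P s)) p.qE p.Q ∧
        -- the double-logarithmic solution `w₃`
        EllFib.Periods.IsTau τ ∧
        (A 0 = 0 ∧ ∀ n, EllFib.IsModular (18 * n + 16) (A (n + 1))) ∧
        (B 0 = 0 ∧ ∀ n, EllFib.IsModular (18 * (n + 1)) (B (n + 1))) ∧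
        (∀ n, EllFib.slice p.alpha n =
          EllFib.Periods.quotTilde τ n (A n * MvPolynomial.X 0 + B n)) ∧
        EllFib.IsSolution (p.w₃ τ A) ∧
        p.w₃ τ A = p.doubleLog 1
          (EllFib.expansion (fun s => (s : ℚ) • EllFib.qexp (P s)) p.qE p.Q) := by
  refine ⟨⟨EllFib.periods, EllFib.isNormalized_periods,
    fun p hp => EllFib.normalized_unique hp EllFib.isNormalized_periods⟩, fun p hp => ?_⟩
  obtain rfl := EllFib.normalized_unique hp EllFib.isNormalized_periods
  refine ⟨EllFib.zCoeff, EllFib.prepotCoeff, EllFib.logCoeff, EllFib.aCoeff, EllFib.bCoeff,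
    EllFib.tau, ⟨EllFib.zCoeff_zero, EllFib.isQuasiModular_zCoeff⟩,
    ⟨EllFib.prepotCoeff_zero, EllFib.isQuasiModular_prepotCoeff⟩,
    ⟨EllFib.logCoeff_zero, EllFib.isQuasiModular_logCoeff⟩,
    fun F hF s hs => EllFib.slice_prepotential hF hs, ?_, ?_,
    fun n _ => EllFib.pderiv_zCoeff n, ?_, ?_, EllFib.isTau_tau,
    ⟨EllFib.aCoeff_zero, EllFib.isModular_aCoeff⟩,
    ⟨EllFib.bCoeff_zero, EllFib.isModular_bCoeff⟩, EllFib.slice_alpha, ?_, ?_⟩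
  · rw [EllFib.expansion_prepot]
    exact EllFib.isSolution_doubleLog_evQ
  · exact EllFib.evQ_cSer.symm.trans (EllFib.expansion_Q _).symm
  · exact EllFib.Q_eq_evZ.trans
      (congrArg (fun a => EllFib.periods.Z * EllFib.expZ a) (EllFib.expansion_Z _).symm)
  · rw [EllFib.expansion_del_logCoeff, EllFib.expansion_prepot, EllFib.evQ_pSer, smul_smul]
    norm_num
  · rw [EllFib.w₃_eq]
    exact EllFib.isSolution_doubleLog_evQ
  · rw [EllFib.w₃_eq, EllFib.expansion_prepot]
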